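/- Let $p>2$ be a prime, $F$ a finite extension of $\mathbb{Q}_p$, $E/F$ the unramified quadratic extension, $x\mapsto\bar x$ the nontrivial element of $\mathrm{Gal}(E/F)$, $\varpi$ a uniformizer of $F$, $q$ the cardinality of the residue field of $F$, and $v$ the valuation on $E$ with $v(\varpi)=1$ and $v(0)=\infty$. Let $|x|_F=q^{-v(x)}$ and $\eta(x)=(-1)^{v(x)}$ for $x\in F^\times$. Let $S_2(F)=\{g\in \mathrm{GL}_2(E): g\bar g=1\}$ and $K'_{S,\le r}=S_2(F)\cap\varpi^{-r}\mathrm{Mat}_2(\mathcal O_E)$ for $r\ge 0$. Let $V'_2(F)=F^2\times(F^2)^\vee$ (column vectors and row vectors). For $(\gamma,\mathbf u,\mathbf v^\top)\in S_2(F)\times V_2'(F)$, a test function $\phi$ on $S_2(F)$ and $s\in\mathbb{C}$ put $$\mathrm{Orb}((\gamma,\mathbf u,\mathbf v^\top),\phi,s)=\int_{\mathrm{GL}_2(F)}\phi(h\gamma h^{-1})\,\mathbf 1_{\mathcal O_F^2\times(\mathcal O_F^2)^\vee}(h\mathbf u,\mathbf v^\top h^{-1})\,\eta(\det h)\,|\det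 h|_F^{-s}\,dh,$$ where $dh$ is the Haar measure giving $\mathrm{GL}_2(\mathcal O_F)$ volume $1$, and let $\partial\mathrm{Orb}((\gamma,\mathbf u,\mathbf v^\top),\phi)$ be the derivative of this function of $s$ at $s=0$. A triple $(A,\mathbf u,\mathbf v^\top)$ over $E$ is regular semisimple if $(\mathbf u,A\mathbf u)$ and $(\mathbf v^\top,\mathbf v^\top A)$ are bases of $E^2$. Let $(S_2(F)\times V'_2(F))_{\mathrm{rs}}^-$ be the set of regular semisimple $(\gamma,\mathbf u,\mathbf v^\top)\in S_2(F)\times V'_2(F)$ that match a regular semisimple $(g,w)\in \mathrm U(\mathbb V)\times\mathbb V$, where $\mathbb V$ is the non-split nondegenerate $2$-dimensional $E/F$-Hermitian space; matching means that $\begin{pmatrix}\gamma&\mathbf u\\ \mathbf v^\top&0\end{pmatrix}$ and $\begin{pmatrix}g&w\\ w^*&0\end{pmatrix}$, with $w^*=\langle\cdot,w\rangle$, are conjugate by an element of $\mathrm{GL}_2(E)$ (embedded in $\mathrm{GL}_3(E)$ as the upper left block), and that $(g,w)$ is regular semisimple means that $(g,w,w^*)$ is. Let $$(\gamma,\mathbf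 u,\mathbf v^\top)=\left(\begin{pmatrix}a&b\\c&d\end{pmatrix},\begin{pmatrix}0\\1\end{pmatrix},\begin{pmatrix}0&e\end{pmatrix}\right)\in(S_2(F)\times V'_2(F))_{\mathrm{rs}}^-,\qquad a,b,c,d\in E,\ e\in F.$$ (In this situation $b,c,e$ are automatically nonzero and $v(b)+v(c)$ is automatically odd and positive.) Let $r\ge1$ and put $$N=\min\left(v(e),\ \tfrac{v(b)+v(c)-1}{2}+r,\ v(d-a)+r\right),\qquad \varkappa=v(e)-(v(d-a)+r)$$ (with $\varkappa=-\infty$ if $d=a$), and $$C=\begin{cases}\frac{\varkappa-1}{2}&\text{if }\varkappa>0\text{ is odd and }v(b)+v(c)>2v(d-a),\\[2pt] \frac{\varkappa+v(b)+v(c)-2v(d-a)-1}{2}&\text{if }\varkappa\ge0\text{ is even and }v(b)+v(c)>2v(d-a),\\[2pt] v(e)-N&\text{if }v(e)\ge\frac{v(b)+v(c)-1}{2}+r\text{ and }2v(d-a)>v(b)+v(c),\\[2pt] 0&\text{otherwise,}\end{cases}$$ $$C'=\begin{cases}C+1&\text{if }\varkappa\ge0\text{ and }v(b)+v(c)>2v(d-a),\\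 0&\text{otherwise.}\end{cases}$$ Then, for $\phi=\mathbf 1_{K'_{S,\le r}}+\mathbf 1_{K'_{S,\le r-1}}$, the integral defining $\mathrm{Orb}((\gamma,\mathbf u,\mathbf v^\top),\phi,s)$ converges absolutely for every $s\in\mathbb{C}$, it is differentiable in $s$ at $s=0$, and $$\frac{(-1)^{v(c)+r}}{\log q}\,\partial\mathrm{Orb}\bigl((\gamma,\mathbf u,\mathbf v^\top),\mathbf 1_{K'_{S,\le r}}+\mathbf 1_{K'_{S,\le r-1}}\bigr)=\sum_{j=0}^{N}q^j+C\,q^{N}+C'\,q^{N-1},$$ where the sum over $j$ is empty if $N<0$ (which happens only if $v(e)<0$, and then both sides are $0$). -/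

import Mathlib

open MeasureTheory
open scoped Matrix

noncomputable section

namespace SemiLie

/-- `ϖ` generates the maximal ideal `{x | ‖x‖ < 1}` of the ring of integers `{x | ‖x‖ ≤ 1}`. -/
def IsUniformizer {K : Type*} [NormedField K] (ϖ : K) : Prop :=
  ϖ ≠ 0 ∧ ‖ϖ‖ < 1 ∧ ∀ x : K, ‖x‖ < 1 → ‖x‖ ≤ ‖ϖ‖

/-- `E / F` is unramified: a uniformizer of `F` is still a uniformizer of `E`
(the residue fields are finite, so separability of the residue extension is automatic). -/
def IsUnramified (F E : Type*) [NormedField F] [NormedField E] [NormedAlgebra F E] : Prop :=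
  ∀ ϖ : F, IsUniformizer ϖ → IsUniformizer (algebraMap F E ϖ)

/-- The number `q` of elements of the residue field of `F`. -/
def residueCard (F : Type*) [NormedField F] [IsUltrametricDist F] : ℕ :=
  Nat.card (IsLocalRing.ResidueField (NormedField.valuation (K := F)).valuationSubring)

open Classical in
/-- The integer valuation `v(x)` of a nonzero `x`, normalized by `v(ϖ) = 1`: the integer `n` such
that `‖x‖ = ‖ϖ‖ ^ n`.  (The value at `0` is the placeholder `0`; see `ord` for `v(0) = ∞`.) -/
def val {K : Type*} [NormedField K] (ϖ x : K) : ℤ :=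
  if h : ∃ n : ℤ, ‖x‖ = ‖ϖ‖ ^ n then h.choose else 0

open Classical in
/-- The valuation with the convention `v(0) = ∞`. -/
def ord {K : Type*} [NormedField K] (ϖ x : K) : WithTop ℤ :=
  if x = 0 then ⊤ else (val ϖ x : WithTop ℤ)

section Spaces

variable {F E : Type*} [NormedField F] [NormedField E] [NormedAlgebra F E]

/-- The entrywise conjugate of an invertible matrix. -/
def conjGL (σ : E ≃ₐ[F] E) (g : GL (Fin 2) E) : GL (Fin 2) E :=
  Matrix.GeneralLinearGroup.map (σ : E →+* E) g

/-- The inclusion `GL₂(F) → GL₂(E)`. -/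
def extGL (E : Type*) [NormedField E] [NormedAlgebra F E] (h : GL (Fin 2) F) : GL (Fin 2) E :=
  Matrix.GeneralLinearGroup.map (algebraMap F E) h

/-- The symmetric space `S₂(F) = {g ∈ GL₂(E) | g ḡ = 1}`. -/
def S2 (σ : E ≃ₐ[F] E) : Set (GL (Fin 2) E) := {g | g * conjGL σ g = 1}

theorem conjGL_extGL (σ : E ≃ₐ[F] E) (h : GL (Fin 2) F) :
    conjGL σ (extGL E h) = extGL E h := by
  ext i j
  simp [conjGL, extGL]

/-- The action `h • γ = h γ h⁻¹` of `GL₂(F)` on `S₂(F)`. -/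
def actS2 {σ : E ≃ₐ[F] E} (h : GL (Fin 2) F) (γ : S2 σ) : S2 σ :=
  ⟨extGL E h * (γ : GL (Fin 2) E) * (extGL E h)⁻¹, by
    have hγ : (γ : GL (Fin 2) E) * conjGL σ γ = 1 := γ.2
    have hh := conjGL_extGL (E := E) σ h
    show _ * conjGL σ _ = 1
    have : conjGL σ (extGL E h * (γ : GL (Fin 2) E) * (extGL E h)⁻¹)
        = extGL E h * conjGL σ γ * (extGL E h)⁻¹ := by
      conv_rhs => rw [← hh]
      simp only [conjGL, map_mul, map_inv]
    rw [this]
    calc _ = extGL E h * ((γ : GL (Fin 2) E) * conjGL σ γ) * (extGL E h)⁻¹ := by group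
      _ = 1 := by rw [hγ]; group⟩

/-- `K'_{S,≤r} = S₂(F) ∩ ϖ^{-r} Mat₂(O_E)`. -/
def KSle (σ : E ≃ₐ[F] E) (ϖ : F) (r : ℕ) : Set (S2 σ) :=
  {g | ∀ i j, ‖(algebraMap F E ϖ) ^ r * (g : GL (Fin 2) E) i j‖ ≤ 1}

/-- The indicator function of `K'_{S,≤r}`. -/
def indKSle (σ : E ≃ₐ[F] E) (ϖ : F) (r : ℕ) : S2 σ → ℂ :=
  (KSle σ ϖ r).indicator 1

/-- The indicator function of `O_F² × (O_F²)^∨` on `V'₂(F) = F² × (F²)^∨`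
(column vectors and row vectors). -/
def indInt : (Fin 2 → F) × (Fin 2 → F) → ℂ :=
  Set.indicator {x | (∀ i, ‖x.1 i‖ ≤ 1) ∧ ∀ i, ‖x.2 i‖ ≤ 1} 1

/-- `GL₂(O_F)` inside `GL₂(F)`. -/
def integralGL (F : Type*) [NormedField F] : Set (GL (Fin 2) F) :=
  {h | (∀ i j, ‖h i j‖ ≤ 1) ∧ ∀ i j, ‖h⁻¹ i j‖ ≤ 1}

/-- The quadratic character `η` of `F^×` attached to the unramified extension `E / F`. -/
def eta (ϖ x : F) : ℂ := (-1) ^ val ϖ x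

/-- The normalized absolute value `|x|_F = q^{-v(x)}` of a nonzero `x`. -/
def absF [IsUltrametricDist F] (ϖ x : F) : ℝ := (residueCard F : ℝ) ^ (-val ϖ x)

/-- The integrand of the weighted orbital integral at `(γ, u, vᵀ)` for the test function
`φ ⊗ 1_{O_F² × (O_F²)^∨}`. -/
def orbIntegrand [IsUltrametricDist F] (ϖ : F) {σ : E ≃ₐ[F] E} (γ : S2 σ) (u v : Fin 2 → F)
    (φ : S2 σ → ℂ) (s : ℂ) (h : GL (Fin 2) F) : ℂ :=
  φ (actS2 h γ)
    * indInt ((h : Matrix (Fin 2) (Fin 2) F) *ᵥ u, v ᵥ* ((h⁻¹ : GL (Fin 2) F) : Matrix _ _ F))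
    * eta ϖ (h : Matrix (Fin 2) (Fin 2) F).det
    * (absF ϖ (h : Matrix (Fin 2) (Fin 2) F).det : ℂ) ^ (-s)

/-- The weighted orbital integral `Orb((γ, u, vᵀ), φ ⊗ 1_{O_F² × (O_F²)^∨}, s)`. -/
def Orb [IsUltrametricDist F] [MeasurableSpace (GL (Fin 2) F)] (μ : Measure (GL (Fin 2) F))
    (ϖ : F) {σ : E ≃ₐ[F] E} (γ : S2 σ) (u v : Fin 2 → F) (φ : S2 σ → ℂ) (s : ℂ) : ℂ :=
  ∫ h, orbIntegrand ϖ γ u v φ s h ∂μ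

/-- `∂Orb((γ, u, vᵀ), φ)`, the derivative of the weighted orbital integral at `s = 0`. -/
def dOrb [IsUltrametricDist F] [MeasurableSpace (GL (Fin 2) F)] (μ : Measure (GL (Fin 2) F))
    (ϖ : F) {σ : E ≃ₐ[F] E} (γ : S2 σ) (u v : Fin 2 → F) (φ : S2 σ → ℂ) : ℂ :=
  deriv (Orb μ ϖ γ u v φ) 0

/-- A triple (matrix, column vector, row vector) is regular semisimple: `(u, A u)` and
`(vᵀ, vᵀ A)` are bases of `E²`. -/
def IsRegSS (A : Matrix (Fin 2) (Fin 2) E) (u v : Fin 2 → E) : Prop :=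
  LinearIndependent E (fun i : Fin 2 => (A ^ (i : ℕ)) *ᵥ u) ∧
    LinearIndependent E (fun i : Fin 2 => v ᵥ* (A ^ (i : ℕ)))

/-- Conjugate transpose with respect to `σ`. -/
def adj (σ : E ≃ₐ[F] E) (A : Matrix (Fin 2) (Fin 2) E) : Matrix (Fin 2) (Fin 2) E :=
  (A.map σ)ᵀ

/-- `J` is the Gram matrix of a nondegenerate non-split Hermitian form `⟨x, y⟩ = y^* J x` on `E²`:
it is not isometric to the split form, whose Gram matrix is antidiagonal with entries `1`. -/
def IsNonsplitHermitian (σ : E ≃ₐ[F] E) (J : Matrix (Fin 2) (Fin 2) E) : Prop :=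
  adj σ J = J ∧ J.det ≠ 0 ∧
    ¬ ∃ P : GL (Fin 2) E,
      adj σ (P : Matrix (Fin 2) (Fin 2) E) * J * (P : Matrix (Fin 2) (Fin 2) E) = !![0, 1; 1, 0]

/-- For a Hermitian form with Gram matrix `J`, the row vector `w^*`, i.e. the functional
`x ↦ ⟨x, w⟩`. -/
def hermStar (σ : E ≃ₐ[F] E) (J : Matrix (Fin 2) (Fin 2) E) (w : Fin 2 → E) : Fin 2 → E :=
  (fun i => σ (w i)) ᵥ* J

/-- `(γ, u, vᵀ) ∈ (S₂(F) × V'₂(F))_rs^-`: it is regular semisimple, and it matches some regular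
semisimple `(g, w)` in `U(V₂^-) × V₂^-`, that is, the block matrices `[γ, u; vᵀ, 0]` and
`[g, w; w^*, 0]` are conjugate by an element `P` of `GL₂(E)`. -/
def IsRegSSMinus {σ : E ≃ₐ[F] E} (γ : S2 σ) (u v : Fin 2 → F) : Prop :=
  IsRegSS ((γ : GL (Fin 2) E) : Matrix (Fin 2) (Fin 2) E)
      (fun i => algebraMap F E (u i)) (fun i => algebraMap F E (v i)) ∧
    ∃ J : Matrix (Fin 2) (Fin 2) E, IsNonsplitHermitian σ J ∧
      ∃ (g : GL (Fin 2) E) (w : Fin 2 → E),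
        adj σ (g : Matrix (Fin 2) (Fin 2) E) * J * (g : Matrix (Fin 2) (Fin 2) E) = J ∧
        IsRegSS (g : Matrix (Fin 2) (Fin 2) E) w (hermStar σ J w) ∧
        ∃ P : GL (Fin 2) E,
          P * (γ : GL (Fin 2) E) * P⁻¹ = g ∧
          (P : Matrix (Fin 2) (Fin 2) E) *ᵥ (fun i => algebraMap F E (u i)) = w ∧
          (fun i => algebraMap F E (v i)) ᵥ* ((P⁻¹ : GL (Fin 2) E) : Matrix _ _ E) = hermStar σ J w

end Spaces

section Constants

/-- `N = min(v(e), (v(b)+v(c)-1)/2 + r, v(d-a) + r)`.  Here `vb`, `vc`, `ve` are the valuations of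
the nonzero elements `b`, `c`, `e`, and `δ = v(d-a)` may be `∞`; the minimum is always finite.
The number `vb + vc - 1` is even where this is used. -/
def constN (r : ℕ) (vb vc ve : ℤ) (δ : WithTop ℤ) : ℤ :=
  (min (ve : WithTop ℤ)
    (min (((vb + vc - 1) / 2 + r : ℤ) : WithTop ℤ) (δ + ((r : ℤ) : WithTop ℤ)))).untopD 0

/-- `ϰ = v(e) - (v(d-a) + r)`; only used under the condition `2 v(d-a) < v(b) + v(c)`, which
forces `v(d-a)` to be finite. -/
def kappa (r : ℕ) (ve : ℤ) (δ : WithTop ℤ) : ℤ := ve - (δ.untopD 0 + r)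

open Classical in
/-- The constant `C`. -/
def constC (r : ℕ) (vb vc ve : ℤ) (δ : WithTop ℤ) : ℚ :=
  let ϰ := kappa r ve δ
  if 0 < ϰ ∧ Odd ϰ ∧ δ + δ < ((vb + vc : ℤ) : WithTop ℤ) then
    ((ϰ : ℚ) - 1) / 2
  else if 0 ≤ ϰ ∧ Even ϰ ∧ δ + δ < ((vb + vc : ℤ) : WithTop ℤ) then
    ((ϰ : ℚ) + vb + vc - 2 * (δ.untopD 0 : ℤ) - 1) / 2
  else if (vb + vc - 1) / 2 + r ≤ ve ∧ ((vb + vc : ℤ) : WithTop ℤ) < δ + δ then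
    (ve : ℚ) - constN r vb vc ve δ
  else 0

open Classical in
/-- The constant `C'`. -/
def constC' (r : ℕ) (vb vc ve : ℤ) (δ : WithTop ℤ) : ℚ :=
  if 0 ≤ kappa r ve δ ∧ δ + δ < ((vb + vc : ℤ) : WithTop ℤ) then
    constC r vb vc ve δ + 1
  else 0

end Constants

end SemiLie

end

/-!
By the Iwasawa decomposition, `h` may be taken upper triangular with diagonal
`(ϖ ^ (k + v(c)), ϖ ^ n)` and upper right entry `y` modulo `ϖ ^ n`; integrality of `h u` and
`vᵀ h⁻¹` says `0 ≤ n ≤ v(e)` and `y ∈ O_F`. So the orbital integral is a finite sum of powers of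
`q ^ s`, and its derivative at `s = 0` is `log q` times a sum weighted by `(-1) ^ m * m`, where
`m = v(det h)`.

The relation `γ γ̄ = 1` puts `b c̄` and `(d - a) c̄` in `F`, so `c̄` times the upper right entry of
`h γ h⁻¹` is, up to a scalar, the value of a binary quadratic form `x² B + x y D - ε y²` over `F`
at `x = ϖ ^ k`, where `v(B) = v(b) + v(c)`, `v(D) = v(d - a)` and `v(ε) = 0`. Units of `F` are norms
from `E`, so the matched Hermitian space can be non-split only if `v(b) + v(c)` is odd. If
`2 v(d - a) > v(b) + v(c)`, the oddness prevents cancellation in the form and the admissible `y`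
form one ball; if `2 v(d - a) < v(b) + v(c)`, the discriminant is a square by Hensel's lemma and
they form balls around the two roots. In both cases the ball counts are constant on long ranges of
`k`, so that the alternating sum over `k` collapses, and the contributions of `r` and `r - 1` have
opposite signs, so that for each `n` only a couple of terms survive, such as
`q ^ min(n, (v(b) + v(c) - 1) / 2 + r)` in the first case.
-/

namespace SemiLie

section Valuation

variable {K : Type*} [NormedField K] {ϖ : K}

theorem IsUniformizer.norm_pos (h : IsUniformizer ϖ) : 0 < ‖ϖ‖ := norm_pos_iff.2 h.1

theorem IsUniformizer.norm_lt_one (h : IsUniformizer ϖ) : ‖ϖ‖ < 1 := h.2.1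

theorem IsUniformizer.norm_lt_one_iff (h : IsUniformizer ϖ) {x : K} : ‖x‖ < 1 ↔ ‖x‖ ≤ ‖ϖ‖ :=
  ⟨h.2.2 x, fun hx => hx.trans_lt h.norm_lt_one⟩

theorem IsUniformizer.zpow_le_zpow_iff (h : IsUniformizer ϖ) {m n : ℤ} :
    ‖ϖ‖ ^ m ≤ ‖ϖ‖ ^ n ↔ n ≤ m :=
  zpow_le_zpow_iff_right_of_lt_one₀ h.norm_pos h.norm_lt_one

theorem IsUniformizer.zpow_lt_zpow_iff (h : IsUniformizer ϖ) {m n : ℤ} :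
    ‖ϖ‖ ^ m < ‖ϖ‖ ^ n ↔ n < m :=
  zpow_lt_zpow_iff_right_of_lt_one₀ h.norm_pos h.norm_lt_one

theorem IsUniformizer.zpow_inj (h : IsUniformizer ϖ) {m n : ℤ} : ‖ϖ‖ ^ m = ‖ϖ‖ ^ n ↔ m = n :=
  zpow_right_inj₀ h.norm_pos h.norm_lt_one.ne

theorem IsUniformizer.zpow_le_one_iff (h : IsUniformizer ϖ) {m : ℤ} : ‖ϖ‖ ^ m ≤ 1 ↔ 0 ≤ m := by
  rw [← zpow_zero ‖ϖ‖, h.zpow_le_zpow_iff]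

theorem IsUniformizer.exists_norm_eq_zpow (h : IsUniformizer ϖ) {x : K} (hx : x ≠ 0) :
    ∃ n : ℤ, ‖x‖ = ‖ϖ‖ ^ n := by
  obtain ⟨n, hlt, hle⟩ := exists_mem_Ioc_zpow (norm_pos_iff.2 hx)
    ((one_lt_inv₀ h.norm_pos).2 h.norm_lt_one)
  have hscale (m : ℤ) : ‖x * ϖ ^ m‖ = ‖x‖ / ‖ϖ‖⁻¹ ^ m := by
    rw [norm_mul, norm_zpow, inv_zpow, div_inv_eq_mul]
  have hle_one : ‖x * ϖ ^ (n + 1)‖ ≤ 1 := by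
    rw [hscale]; exact div_le_one_of_le₀ hle (by positivity)
  have hnot_lt : ¬ ‖x * ϖ ^ (n + 1)‖ < 1 := by
    rw [h.norm_lt_one_iff, not_le, zpow_add_one₀ h.1, ← mul_assoc, norm_mul]
    refine lt_mul_of_one_lt_left h.norm_pos ?_
    rwa [hscale, one_lt_div (zpow_pos (inv_pos.2 h.norm_pos) n)]
  have heq := hle_one.antisymm (not_lt.1 hnot_lt)
  rw [norm_mul, norm_zpow] at heq
  exact ⟨-(n + 1), by rw [zpow_neg]; exact eq_inv_of_mul_eq_one_left heq⟩

theorem val_eq_of_norm (h : IsUniformizer ϖ) {x : K} {n : ℤ} (hx : ‖x‖ = ‖ϖ‖ ^ n) :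
    val ϖ x = n := by
  have hex : ∃ n : ℤ, ‖x‖ = ‖ϖ‖ ^ n := ⟨n, hx⟩
  rw [val, dif_pos hex]
  exact h.zpow_inj.1 (hex.choose_spec.symm.trans hx)

theorem norm_eq_zpow_val (h : IsUniformizer ϖ) {x : K} (hx : x ≠ 0) :
    ‖x‖ = ‖ϖ‖ ^ val ϖ x := by
  obtain ⟨n, hn⟩ := h.exists_norm_eq_zpow hx
  rw [val_eq_of_norm h hn, hn]

theorem val_congr (h : IsUniformizer ϖ) {x y : K} (hx : x ≠ 0) (hxy : ‖x‖ = ‖y‖) :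
    val ϖ x = val ϖ y :=
  (val_eq_of_norm h (hxy.symm.trans (norm_eq_zpow_val h hx))).symm

end Valuation

section Ultrametric

variable {K : Type*} [NormedField K] [IsUltrametricDist K]

theorem norm_add_le_of_le {x y : K} {t : ℝ} (hx : ‖x‖ ≤ t) (hy : ‖y‖ ≤ t) : ‖x + y‖ ≤ t :=
  (IsUltrametricDist.norm_add_le_max x y).trans (max_le hx hy)

theorem norm_sub_le_of_le {x y : K} {t : ℝ} (hx : ‖x‖ ≤ t) (hy : ‖y‖ ≤ t) : ‖x - y‖ ≤ t :=
  sub_eq_add_neg x y ▸ norm_add_le_of_le hx ((norm_neg y).trans_le hy)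

theorem norm_add_le_iff_right {x y : K} {t : ℝ} (hx : ‖x‖ ≤ t) : ‖x + y‖ ≤ t ↔ ‖y‖ ≤ t :=
  ⟨fun h => add_sub_cancel_left x y ▸ norm_sub_le_of_le h hx, norm_add_le_of_le hx⟩

theorem norm_sub_le_iff_right {x y : K} {t : ℝ} (hx : ‖x‖ ≤ t) : ‖x - y‖ ≤ t ↔ ‖y‖ ≤ t :=
  ⟨fun h => sub_sub_cancel x y ▸ norm_sub_le_of_le hx h, norm_sub_le_of_le hx⟩

theorem norm_sub_le_trans {x y z : K} {t : ℝ} (hxy : ‖x - y‖ ≤ t) (hyz : ‖y - z‖ ≤ t) :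
    ‖x - z‖ ≤ t :=
  sub_add_sub_cancel x y z ▸ norm_add_le_of_le hxy hyz

theorem norm_add_eq_left {x y : K} (h : ‖y‖ < ‖x‖) : ‖x + y‖ = ‖x‖ := by
  rw [IsUltrametricDist.norm_add_eq_max_of_norm_ne_norm h.ne', max_eq_left h.le]

theorem norm_sub_eq_left {x y : K} (h : ‖y‖ < ‖x‖) : ‖x - y‖ = ‖x‖ := by
  rw [sub_eq_add_neg]; exact norm_add_eq_left (by rwa [norm_neg])

theorem norm_sub_eq_right {x y : K} (h : ‖x‖ < ‖y‖) : ‖x - y‖ = ‖y‖ := by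
  rw [norm_sub_rev]; exact norm_sub_eq_left h

/- The root is the fixed point of `z ↦ (t - z ^ 2) / 2`, a contraction of the closed ball of radius
`‖t‖` because `(t - z ^ 2) / 2 - (t - w ^ 2) / 2 = -(z + w) * (z - w) / 2`. -/
theorem exists_two_mul_add_sq_eq [CompleteSpace K] (h2 : ‖(2 : K)‖ = 1) {t : K} (ht : ‖t‖ < 1) :
    ∃ z : K, 2 * z + z ^ 2 = t := by
  have h20 : (2 : K) ≠ 0 := norm_ne_zero_iff.1 (h2 ▸ one_ne_zero)
  let B : Set K := Metric.closedBall 0 ‖t‖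
  let f : K → K := fun z => (t - z ^ 2) / 2
  have hmem {z : K} : z ∈ B ↔ ‖z‖ ≤ ‖t‖ := mem_closedBall_zero_iff
  have hmaps : Set.MapsTo f B B := fun z hz => by
    rw [hmem] at hz ⊢
    simp only [f, norm_div, h2, div_one]
    refine norm_sub_le_of_le le_rfl ?_
    rw [norm_pow]
    exact (pow_le_of_le_one (norm_nonneg z) (hz.trans ht.le) two_ne_zero).trans hz
  have hcontr : ContractingWith ‖t‖₊ (hmaps.restrict f B B) := by
    refine ⟨mod_cast ht, LipschitzWith.of_dist_le_mul ?_⟩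
    rintro ⟨z, hz⟩ ⟨w, hw⟩
    rw [hmem] at hz hw
    simp only [Subtype.dist_eq, Set.MapsTo.val_restrict_apply, f, dist_eq_norm, coe_nnnorm]
    rw [show (t - z ^ 2) / 2 - (t - w ^ 2) / 2 = -((z + w) * (z - w)) / 2 by ring,
      norm_div, h2, div_one, norm_neg, norm_mul]
    exact mul_le_mul_of_nonneg_right (norm_add_le_of_le hz hw) (norm_nonneg _)
  obtain ⟨z, -, hz, -⟩ := hcontr.exists_fixedPoint' Metric.isClosed_closedBall.isComplete hmaps
    (hmem.2 (by simp) : (0 : K) ∈ B) (edist_ne_top _ _)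
  exact ⟨z, by linear_combination -((div_eq_iff h20).1 hz)⟩

theorem exists_sq_eq_of_norm_sub_one_lt [CompleteSpace K] (h2 : ‖(2 : K)‖ = 1) {x : K}
    (hx : ‖x - 1‖ < 1) : ∃ y : K, y ^ 2 = x := by
  obtain ⟨z, hz⟩ := exists_two_mul_add_sq_eq h2 hx
  exact ⟨1 + z, by linear_combination hz⟩

end Ultrametric

section Representatives

variable {K : Type*} [NormedField K]

/-- `Y` is a complete set of representatives of the ring of integers modulo `ϖ ^ n`. -/
def IsReps (ϖ : K) (n : ℕ) (Y : Finset K) : Prop :=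
  (∀ y ∈ Y, ‖y‖ ≤ 1) ∧ ∀ x : K, ‖x‖ ≤ 1 → ∃! y, y ∈ Y ∧ ‖x - y‖ ≤ ‖ϖ‖ ^ n

variable {ϖ : K}

theorem IsReps.norm_le_one {n : ℕ} {Y : Finset K} (hY : IsReps ϖ n Y) {y : K} (hy : y ∈ Y) :
    ‖y‖ ≤ 1 := hY.1 y hy

theorem IsReps.eq_of_norm_sub_le {n : ℕ} {Y : Finset K} (hY : IsReps ϖ n Y) {y z : K}
    (hy : y ∈ Y) (hz : z ∈ Y) (h : ‖y - z‖ ≤ ‖ϖ‖ ^ n) : y = z :=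
  (hY.2 y (hY.norm_le_one hy)).unique ⟨hy, by simp⟩ ⟨hz, h⟩

open Classical in
theorem card_image_sub_div_pow (h : IsUniformizer ϖ) (Y : Finset K) (c : K) (j : ℕ) :
    (Y.image fun y => (y - c) / ϖ ^ j).card = Y.card :=
  Finset.card_image_of_injective _ fun _ _ hyz =>
    sub_left_injective ((div_left_inj' (pow_ne_zero j h.1)).1 hyz)

variable [IsUltrametricDist K]

/- A finite family of closed balls of radius `‖ϖ‖ ^ n` which covers the ring of integers and is
minimal has no two meeting members, since meeting ultrametric balls of equal radius coincide. -/
theorem exists_isReps [ProperSpace K] (h : IsUniformizer ϖ) (n : ℕ) :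
    ∃ Y : Finset K, IsReps ϖ n Y := by
  classical
  let Covers (Y : Finset K) : Prop :=
    (∀ y ∈ Y, ‖y‖ ≤ 1) ∧ ∀ x : K, ‖x‖ ≤ 1 → ∃ y ∈ Y, ‖x - y‖ ≤ ‖ϖ‖ ^ n
  have hcovers : ∃ Y, Covers Y := by
    obtain ⟨t, ht, htfin, hcov⟩ := finite_cover_balls_of_compact
      (isCompact_closedBall (0 : K) 1) (pow_pos h.norm_pos n)
    refine ⟨htfin.toFinset, fun y hy => by simpa using ht (htfin.mem_toFinset.1 hy), fun x hx => ?_⟩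
    obtain ⟨y, hy, hxy⟩ := Set.mem_iUnion₂.1 (hcov (mem_closedBall_zero_iff.2 hx))
    exact ⟨y, htfin.mem_toFinset.2 hy, (mem_ball_iff_norm.1 hxy).le⟩
  obtain ⟨Y, ⟨hint, hcov⟩, hmin⟩ := exists_minimal_of_wellFoundedLT Covers hcovers
  refine ⟨Y, hint, fun x hx => existsUnique_of_exists_of_unique (hcov x hx) ?_⟩
  rintro y z ⟨hy, hxy⟩ ⟨hz, hxz⟩
  by_contra hyz
  have hzy : ‖z - y‖ ≤ ‖ϖ‖ ^ n := norm_sub_le_trans (norm_sub_rev x z ▸ hxz) hxy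
  have herase : Covers (Y.erase z) := by
    refine ⟨fun w hw => hint w (Finset.mem_of_mem_erase hw), fun w hw => ?_⟩
    obtain ⟨u, hu, hwu⟩ := hcov w hw
    rcases eq_or_ne u z with rfl | huz
    · exact ⟨y, Finset.mem_erase.2 ⟨hyz, hy⟩, norm_sub_le_trans hwu hzy⟩
    · exact ⟨u, Finset.mem_erase.2 ⟨huz, hu⟩, hwu⟩
  exact Finset.notMem_erase z Y (hmin herase (Finset.erase_subset z Y) hz)

open Classical in
theorem IsReps.rescale_ball (h : IsUniformizer ϖ) {n j : ℕ} {Y : Finset K}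
    (hY : IsReps ϖ (n + j) Y) {c : K} (hc : ‖c‖ ≤ 1) :
    IsReps ϖ n ({y ∈ Y | ‖y - c‖ ≤ ‖ϖ‖ ^ j}.image fun y => (y - c) / ϖ ^ j) := by
  have hpos : 0 < ‖ϖ‖ ^ j := pow_pos h.norm_pos j
  have h0 : ϖ ^ j ≠ 0 := pow_ne_zero j h.1
  have hrescale (x y : K) : ‖x - (y - c) / ϖ ^ j‖ ≤ ‖ϖ‖ ^ n ↔
      ‖(c + ϖ ^ j * x) - y‖ ≤ ‖ϖ‖ ^ (n + j) := by
    rw [show (c + ϖ ^ j * x) - y = (x - (y - c) / ϖ ^ j) * ϖ ^ j by field_simp; ring,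
      norm_mul, norm_pow, pow_add, mul_le_mul_iff_left₀ hpos]
  constructor
  · simp only [Finset.mem_image, Finset.mem_filter]
    rintro _ ⟨y, ⟨-, hy⟩, rfl⟩
    rwa [norm_div, norm_pow, div_le_one hpos]
  · intro x hx
    have hxj : ‖ϖ ^ j * x‖ ≤ ‖ϖ‖ ^ j := by
      rw [norm_mul, norm_pow]; exact mul_le_of_le_one_right hpos.le hx
    obtain ⟨y, ⟨hy, hxy⟩, huniq⟩ := hY.2 (c + ϖ ^ j * x)
      (norm_add_le_of_le hc (hxj.trans (pow_le_one₀ h.norm_pos.le h.norm_lt_one.le)))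
    refine ⟨(y - c) / ϖ ^ j, ⟨?_, (hrescale x y).2 hxy⟩, ?_⟩
    · refine Finset.mem_image_of_mem _ (Finset.mem_filter.2 ⟨hy, ?_⟩)
      have hyj := norm_sub_le_of_le hxj (hxy.trans
        (pow_le_pow_of_le_one h.norm_pos.le h.norm_lt_one.le (Nat.le_add_left j n)))
      rwa [show ϖ ^ j * x - (c + ϖ ^ j * x - y) = y - c by ring] at hyj
    · rintro _ ⟨hz, hxz⟩
      obtain ⟨z, hzY, rfl⟩ := Finset.mem_image.1 hz
      rw [huniq z ⟨(Finset.mem_filter.1 hzY).1, (hrescale x z).1 hxz⟩]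

theorem residue_eq_residue_iff (h : IsUniformizer ϖ)
    (x y : (NormedField.valuation (K := K)).valuationSubring) :
    IsLocalRing.residue _ x = IsLocalRing.residue _ y ↔ ‖(x : K) - y‖ ≤ ‖ϖ‖ := by
  rw [← sub_eq_zero, ← map_sub, IsLocalRing.residue_eq_zero_iff, Valuation.mem_maximalIdeal_iff,
    ← h.norm_lt_one_iff]
  exact Iff.rfl

theorem IsReps.card_one (h : IsUniformizer ϖ) {Y : Finset K} (hY : IsReps ϖ 1 Y) :
    Y.card = residueCard K := by
  rw [residueCard, ← Nat.card_eq_finsetCard]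
  refine Nat.card_congr (Equiv.ofBijective (fun y : Y =>
    IsLocalRing.residue (NormedField.valuation (K := K)).valuationSubring
      ⟨y, hY.norm_le_one y.2⟩) ⟨?_, ?_⟩)
  · intro y z hyz
    have hclose := (residue_eq_residue_iff h _ _).1 hyz
    exact Subtype.ext (hY.eq_of_norm_sub_le y.2 z.2 (by simpa using hclose))
  · intro r
    obtain ⟨x, rfl⟩ := IsLocalRing.residue_surjective r
    obtain ⟨y, ⟨hy, hxy⟩, -⟩ := hY.2 x x.2
    refine ⟨⟨y, hy⟩, (residue_eq_residue_iff h _ _).2 ?_⟩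
    rw [norm_sub_rev]
    simpa using hxy

open Classical in
theorem IsReps.card [ProperSpace K] (h : IsUniformizer ϖ) {n : ℕ} {Y : Finset K}
    (hY : IsReps ϖ n Y) : Y.card = residueCard K ^ n := by
  induction n generalizing Y with
  | zero =>
    rw [pow_zero, Finset.card_eq_one]
    obtain ⟨y, ⟨hy, -⟩, hu⟩ := hY.2 0 (by simp)
    refine ⟨y, Finset.eq_singleton_iff_unique_mem.2 ⟨hy, fun z hz => hu z ⟨hz, ?_⟩⟩⟩
    simpa using hY.norm_le_one hz
  | succ n ih =>
    obtain ⟨R, hR⟩ := exists_isReps h 1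
    have hnear (y) (hy : y ∈ Y) : ∃ s, s ∈ R ∧ ‖y - s‖ ≤ ‖ϖ‖ ^ 1 :=
      (hR.2 y (hY.norm_le_one hy)).exists
    choose! f hfR hf using hnear
    have hfiber (s) (hs : s ∈ R) : {y ∈ Y | f y = s} = {y ∈ Y | ‖y - s‖ ≤ ‖ϖ‖ ^ 1} :=
      Finset.filter_congr fun y hy => ⟨fun e => e ▸ hf y hy, fun e =>
        (hR.2 y (hY.norm_le_one hy)).unique ⟨hfR y hy, hf y hy⟩ ⟨hs, e⟩⟩
    rw [Finset.card_eq_sum_card_fiberwise (f := f) (t := R) hfR, pow_succ', ← hR.card_one h,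
      ← smul_eq_mul, ← Finset.sum_const]
    refine Finset.sum_congr rfl fun s hs => ?_
    rw [hfiber s hs, ← card_image_sub_div_pow h _ s 1, hR.card_one h]
    exact ih (hY.rescale_ball h (hR.norm_le_one hs))

open Classical in
theorem IsReps.card_ball [ProperSpace K] (h : IsUniformizer ϖ) {n j : ℕ} (hj : j ≤ n)
    {Y : Finset K} (hY : IsReps ϖ n Y) {c : K} (hc : ‖c‖ ≤ 1) :
    {y ∈ Y | ‖y - c‖ ≤ ‖ϖ‖ ^ j}.card = residueCard K ^ (n - j) := by
  obtain ⟨k, rfl⟩ := Nat.exists_eq_add_of_le' hj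
  rw [← card_image_sub_div_pow h _ c j, Nat.add_sub_cancel]
  exact (hY.rescale_ball h hc).card h

theorem one_lt_residueCard [ProperSpace K] (h : IsUniformizer ϖ) : 1 < residueCard K := by
  obtain ⟨R, hR⟩ := exists_isReps h 1
  obtain ⟨y, ⟨hy, h0y⟩, -⟩ := hR.2 0 (by simp)
  obtain ⟨z, ⟨hz, h1z⟩, -⟩ := hR.2 1 (by simp)
  rw [← hR.card_one h, Finset.one_lt_card]
  refine ⟨y, hy, z, hz, ?_⟩
  rintro rfl
  have hone : ‖(1 : K) - 0‖ ≤ ‖ϖ‖ ^ 1 := norm_sub_le_trans h1z (norm_sub_rev (0 : K) y ▸ h0y)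
  rw [sub_zero, norm_one, pow_one] at hone
  exact hone.not_gt h.norm_lt_one

end Representatives

section CosetIntegration

variable {G : Type*} [Group G] [MeasurableSpace G] [MeasurableMul G]
  {V : Type*} [NormedAddCommGroup V] [NormedSpace ℝ V] [CompleteSpace V]

theorem integral_eq_sum_of_left_invariant (μ : Measure G) [μ.IsMulRightInvariant]
    {U : Subgroup G} (hU : MeasurableSet (U : Set G)) (hμU : μ U ≠ ⊤)
    {ι : Type*} (T : Finset ι) (g : ι → G) {f : G → V} (hf : ∀ κ ∈ U, ∀ h, f (κ * h) = f h)
    (hT : ∀ i ∈ T, ∀ j ∈ T, g j * (g i)⁻¹ ∈ U → i = j)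
    (hsupp : ∀ h, f h ≠ 0 → ∃ i ∈ T, h * (g i)⁻¹ ∈ U) :
    Integrable f μ ∧ ∫ h, f h ∂μ = ∑ i ∈ T, μ.real U • f (g i) := by
  let S (i : ι) : Set G := (· * (g i)⁻¹) ⁻¹' U
  have hS (i : ι) : MeasurableSet (S i) := measurable_mul_const _ hU
  have hμS (i : ι) : μ (S i) = μ U := measure_preimage_mul_right μ (g i)⁻¹ U
  have hfS {i : ι} {h : G} (hh : h ∈ S i) : f h = f (g i) := by
    rw [← hf _ hh (g i), inv_mul_cancel_right]
  have hdisj {i j : ι} (hi : i ∈ T) (hj : j ∈ T) {h : G} (hhi : h ∈ S i) (hhj : h ∈ S j) :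
      i = j := by
    refine hT i hi j hj ?_
    have hquot := U.mul_mem (U.inv_mem hhj) hhi
    rwa [mul_inv_rev, inv_inv, mul_assoc, inv_mul_cancel_left] at hquot
  have hf_eq : f = fun h => ∑ i ∈ T, (S i).indicator (fun _ => f (g i)) h := by
    funext h
    by_cases hex : ∃ i ∈ T, h ∈ S i
    · obtain ⟨i, hi, hhi⟩ := hex
      rw [Finset.sum_eq_single_of_mem i hi, Set.indicator_of_mem hhi, hfS hhi]
      exact fun j hj hji => Set.indicator_of_notMem (fun hhj => hji (hdisj hj hi hhj hhi)) _
    · rw [Finset.sum_eq_zero fun i hi =>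
        Set.indicator_of_notMem (fun hh => hex ⟨i, hi, hh⟩) _]
      exact not_not.1 fun h0 => hex (hsupp h h0)
  have hint (i : ι) : Integrable ((S i).indicator fun _ => f (g i)) μ :=
    (integrable_indicator_iff (hS i)).2 (integrableOn_const (by rwa [hμS]))
  refine ⟨hf_eq ▸ integrable_finsetSum _ fun i _ => hint i, ?_⟩
  calc ∫ h, f h ∂μ = ∑ i ∈ T, ∫ h, (S i).indicator (fun _ => f (g i)) h ∂μ := by
        rw [← integral_finsetSum _ fun i _ => hint i, ← hf_eq]
    _ = ∑ i ∈ T, μ.real U • f (g i) := Finset.sum_congr rfl fun i _ => by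
        rw [integral_indicator_const _ (hS i), measureReal_def, measureReal_def, hμS]

end CosetIntegration

section Unimodular

variable {G : Type*} [TopologicalSpace G] [Group G] [IsTopologicalGroup G] [LocallyCompactSpace G]

theorem modularCharacter_eq_one_of_mem_center {g : G} (hg : g ∈ Subgroup.center G) :
    Measure.modularCharacter g = 1 := by
  borelize G
  have hcomm : (· * g : G → G) = (g * ·) := funext (Subgroup.mem_center_iff.1 hg)
  change Measure.modularCharacterFun g = 1
  rw [Measure.modularCharacterFun_eq_haarScalarFactor Measure.haar]
  simp only [hcomm, map_mul_left_eq_self, Measure.haarScalarFactor_self]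

theorem isMulRightInvariant_of_modularCharacter_eq_one [SecondCountableTopology G]
    [MeasurableSpace G] [BorelSpace G] (hG : Measure.modularCharacter (G := G) = 1)
    (μ : Measure G) [μ.IsHaarMeasure] : μ.IsMulRightInvariant where
  map_mul_right_eq_self g := by
    have hg : Measure.modularCharacterFun g = 1 := DFunLike.congr_fun hG g
    rw [Measure.isMulLeftInvariant_eq_smul (Measure.map (· * g) μ) μ,
      ← Measure.modularCharacterFun_eq_haarScalarFactor, hg, one_smul]

/- `SL₂(F)` is perfect, and the square of `g` lies in `SL₂(F)` up to the scalar `det g`. -/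
theorem monoidHom_GL_two_eq_one {F : Type*} [Field F] {a : F} (ha : a ≠ 0) (ha2 : a ^ 2 ≠ 1)
    (Δ : GL (Fin 2) F →* NNReal)
    (hΔ : ∀ u : Fˣ, Δ (Matrix.GeneralLinearGroup.scalar (Fin 2) u) = 1) : Δ = 1 := by
  have hSL (s : Matrix.SpecialLinearGroup (Fin 2) F) : Δ s = 1 := by
    have hs := Abelianization.commutator_subset_ker
      (Δ.comp Matrix.SpecialLinearGroup.toGL).toHomUnits
      (Matrix.SL2.commutator_eq_top ha ha2 ▸ Subgroup.mem_top s)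
    exact congrArg Units.val hs
  ext1 g
  let s : Matrix.SpecialLinearGroup (Fin 2) F :=
    ⟨(g : Matrix (Fin 2) (Fin 2) F).det⁻¹ • (g * g : Matrix (Fin 2) (Fin 2) F), by
      rw [Matrix.det_smul, Matrix.det_mul, Fintype.card_fin, ← sq, ← mul_pow,
        inv_mul_cancel₀ g.det_ne_zero, one_pow]⟩
  have hgg : g * g = Matrix.GeneralLinearGroup.scalar (Fin 2) g.det * s := by
    ext i j
    have hs : (s : Matrix (Fin 2) (Fin 2) F) i j = g.1.det⁻¹ * (g * g : Matrix _ _ F) i j := rfl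
    simp [hs, g.det_ne_zero]
  have hsq : Δ g ^ 2 = 1 := by rw [sq, ← map_mul, hgg, map_mul, hΔ, hSL, one_mul]
  exact (pow_eq_one_iff_of_nonneg zero_le two_ne_zero).1 hsq

variable {F : Type*} [NormedField F] [ProperSpace F]

instance : LocallyCompactSpace (GL (Fin 2) F) :=
  have : LocallyCompactSpace (Matrix (Fin 2) (Fin 2) F) :=
    inferInstanceAs (LocallyCompactSpace (Fin 2 → Fin 2 → F))
  inferInstanceAs (LocallyCompactSpace (Matrix (Fin 2) (Fin 2) F)ˣ)

instance : SecondCountableTopology (GL (Fin 2) F) :=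
  have : SecondCountableTopology (Matrix (Fin 2) (Fin 2) F) :=
    inferInstanceAs (SecondCountableTopology (Fin 2 → Fin 2 → F))
  have : SecondCountableTopology (Matrix (Fin 2) (Fin 2) F)ᵐᵒᵖ :=
    MulOpposite.opHomeomorph.symm.secondCountableTopology
  Units.isEmbedding_embedProduct.secondCountableTopology

theorem isMulRightInvariant_GL_two {ϖ : F} (hϖ : IsUniformizer ϖ)
    [MeasurableSpace (GL (Fin 2) F)] [BorelSpace (GL (Fin 2) F)] (μ : Measure (GL (Fin 2) F))
    [μ.IsHaarMeasure] : μ.IsMulRightInvariant := by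
  have hϖ2 : ϖ ^ 2 ≠ 1 := fun h => (pow_lt_one₀ hϖ.norm_pos.le hϖ.norm_lt_one two_ne_zero).ne
    (by rw [← norm_pow, h, norm_one])
  refine isMulRightInvariant_of_modularCharacter_eq_one
    (monoidHom_GL_two_eq_one hϖ.1 hϖ2 _ fun u => modularCharacter_eq_one_of_mem_center ?_) μ
  exact Subgroup.mem_center_iff.2 fun g => (Matrix.GeneralLinearGroup.scalar_commute u g).symm

end Unimodular

section Iwasawa

variable {F : Type*} [NormedField F] {ϖ : F}

/-- The upper triangular matrix with rows `(x, y)` and `(0, z)`, its inverse being written out. -/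
def upperGL (x : Fˣ) (y : F) (z : Fˣ) : GL (Fin 2) F where
  val := !![(x : F), y; 0, z]
  inv := !![(↑x⁻¹ : F), -(↑x⁻¹ * y * ↑z⁻¹); 0, ↑z⁻¹]
  val_inv := by simp [Matrix.one_fin_two, mul_assoc]
  inv_val := by simp [Matrix.one_fin_two, mul_assoc]

theorem upperGL_val (x : Fˣ) (y : F) (z : Fˣ) :
    (upperGL x y z : Matrix (Fin 2) (Fin 2) F) = !![(x : F), y; 0, z] := rfl

theorem upperGL_inv (x : Fˣ) (y : F) (z : Fˣ) :
    (upperGL x y z)⁻¹ = upperGL x⁻¹ (-(↑x⁻¹ * y * ↑z⁻¹)) z⁻¹ := Units.ext rfl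

theorem upperGL_mul (x : Fˣ) (y : F) (z x' : Fˣ) (y' : F) (z' : Fˣ) :
    upperGL x y z * upperGL x' y' z' = upperGL (x * x') (x * y' + y * z') (z * z') := by
  ext i j
  fin_cases i <;> fin_cases j <;> simp [upperGL_val]

theorem eq_upperGL_of_lower_left_eq_zero {h : GL (Fin 2) F} (h0 : h 1 0 = 0) :
    ∃ x y z, h = upperGL x y z := by
  have hdet := h.det_ne_zero
  rw [Matrix.det_fin_two, h0, mul_zero, sub_zero] at hdet
  refine ⟨Units.mk0 _ (left_ne_zero_of_mul hdet), h 0 1,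
    Units.mk0 _ (right_ne_zero_of_mul hdet), ?_⟩
  ext i j
  fin_cases i <;> fin_cases j <;> simp [upperGL_val, h0]

/-- The Weyl element: the permutation matrix of the transposition. -/
def swapGL (F : Type*) [NormedField F] : GL (Fin 2) F where
  val := !![0, 1; 1, 0]
  inv := !![0, 1; 1, 0]
  val_inv := by simp [Matrix.one_fin_two]
  inv_val := by simp [Matrix.one_fin_two]

theorem swapGL_mul_apply (h : GL (Fin 2) F) (j : Fin 2) :
    (swapGL F * h) 0 j = h 1 j ∧ (swapGL F * h) 1 j = h 0 j := by
  simp [swapGL, Matrix.mul_apply]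

/-- A uniformizer as an element of the multiplicative group. -/
def IsUniformizer.unit (hϖ : IsUniformizer ϖ) : Fˣ := Units.mk0 ϖ hϖ.1

theorem IsUniformizer.unit_zpow_val (hϖ : IsUniformizer ϖ) (n : ℤ) :
    ((hϖ.unit ^ n : Fˣ) : F) = ϖ ^ n := Units.val_zpow_eq_zpow_val _ _

/-- The matrix with rows `(ϖ ^ m, y)` and `(0, ϖ ^ n)`; by the Iwasawa decomposition these
represent `GL₂(O_F) \ GL₂(F)`. -/
def triangularRep (hϖ : IsUniformizer ϖ) (m n : ℤ) (y : F) : GL (Fin 2) F :=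
  upperGL (hϖ.unit ^ m) y (hϖ.unit ^ n)

theorem triangularRep_val (hϖ : IsUniformizer ϖ) (m n : ℤ) (y : F) :
    (triangularRep hϖ m n y : Matrix (Fin 2) (Fin 2) F) = !![ϖ ^ m, y; 0, ϖ ^ n] := by
  rw [triangularRep, upperGL_val, hϖ.unit_zpow_val, hϖ.unit_zpow_val]

theorem triangularRep_inv_val (hϖ : IsUniformizer ϖ) (m n : ℤ) (y : F) :
    ((triangularRep hϖ m n y)⁻¹ : GL (Fin 2) F).val =
      !![(ϖ ^ m)⁻¹, -((ϖ ^ m)⁻¹ * y * (ϖ ^ n)⁻¹); 0, (ϖ ^ n)⁻¹] := by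
  simp only [triangularRep, upperGL_inv, upperGL_val, Units.val_inv_eq_inv_val,
    hϖ.unit_zpow_val]

variable [IsUltrametricDist F]

theorem norm_matrix_mul_apply_le_one {A B : Matrix (Fin 2) (Fin 2) F} (hA : ∀ i j, ‖A i j‖ ≤ 1)
    (hB : ∀ i j, ‖B i j‖ ≤ 1) (i j : Fin 2) : ‖(A * B) i j‖ ≤ 1 := by
  rw [Matrix.mul_apply]
  refine IsUltrametricDist.norm_sum_le_of_forall_le_of_nonneg zero_le_one fun k _ => ?_
  rw [norm_mul]
  exact mul_le_one₀ (hA i k) (norm_nonneg _) (hB k j)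

/-- `GL₂(O_F)` as a subgroup of `GL₂(F)`. -/
def integralSubgroup (F : Type*) [NormedField F] [IsUltrametricDist F] :
    Subgroup (GL (Fin 2) F) where
  carrier := integralGL F
  one_mem' := by
    have hone (i j : Fin 2) : ‖(1 : Matrix (Fin 2) (Fin 2) F) i j‖ ≤ 1 := by
      by_cases h : i = j <;> simp [Matrix.one_apply, h]
    exact ⟨hone, by rwa [inv_one]⟩
  mul_mem' := fun hg hh => ⟨norm_matrix_mul_apply_le_one hg.1 hh.1, by
    rw [mul_inv_rev]
    exact norm_matrix_mul_apply_le_one hh.2 hg.2⟩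
  inv_mem' := fun h => ⟨h.2, by simpa using h.1⟩

theorem upperGL_mem_integralSubgroup_iff {x : Fˣ} {y : F} {z : Fˣ} :
    upperGL x y z ∈ integralSubgroup F ↔ ‖(x : F)‖ = 1 ∧ ‖y‖ ≤ 1 ∧ ‖(z : F)‖ = 1 := by
  have norm_unit_eq_one {t : Fˣ} (ht : ‖(t : F)‖ ≤ 1) (ht' : ‖(↑t⁻¹ : F)‖ ≤ 1) :
      ‖(t : F)‖ = 1 := by
    rw [Units.val_inv_eq_inv_val, norm_inv] at ht'
    exact le_antisymm ht ((inv_le_one₀ (norm_pos_iff.2 t.ne_zero)).1 ht')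
  refine ⟨fun h => ⟨norm_unit_eq_one (h.1 0 0) (h.2 0 0), h.1 0 1,
    norm_unit_eq_one (h.1 1 1) (h.2 1 1)⟩, fun ⟨hx, hy, hz⟩ => ⟨fun i j => ?_, fun i j => ?_⟩⟩
  · fin_cases i <;> fin_cases j <;> simp [upperGL_val, hx, hy, hz]
  · fin_cases i <;> fin_cases j <;> simp [upperGL_inv, upperGL_val, hx, hy, hz]

theorem swapGL_mem_integralSubgroup : swapGL F ∈ integralSubgroup F := by
  have hswap (i j : Fin 2) : ‖(!![0, 1; 1, 0] : Matrix (Fin 2) (Fin 2) F) i j‖ ≤ 1 := by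
    fin_cases i <;> fin_cases j <;> simp
  exact ⟨hswap, hswap⟩

theorem triangularRep_mul_inv_mem_iff (hϖ : IsUniformizer ϖ) {m n m' n' : ℤ} {y y' : F} :
    triangularRep hϖ m' n' y' * (triangularRep hϖ m n y)⁻¹ ∈ integralSubgroup F ↔
      m = m' ∧ n = n' ∧ ‖y' - y‖ ≤ ‖ϖ‖ ^ n := by
  have hzpow (i j : ℤ) : ‖ϖ ^ i * (ϖ ^ j)⁻¹‖ = 1 ↔ j = i := by
    rw [← zpow_neg, ← zpow_add₀ hϖ.1, norm_zpow, ← zpow_zero ‖ϖ‖, hϖ.zpow_inj]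
    omega
  rw [triangularRep, triangularRep, upperGL_inv, upperGL_mul, upperGL_mem_integralSubgroup_iff]
  simp only [Units.val_mul, Units.val_inv_eq_inv_val, hϖ.unit_zpow_val, hzpow]
  have hentry : ‖ϖ ^ m * -((ϖ ^ m)⁻¹ * y * (ϖ ^ n)⁻¹) + y' * (ϖ ^ n)⁻¹‖ ≤ 1 ↔
      ‖y' - y‖ ≤ ‖ϖ‖ ^ n := by
    have hm := zpow_ne_zero m hϖ.1
    rw [show ϖ ^ m * -((ϖ ^ m)⁻¹ * y * (ϖ ^ n)⁻¹) + y' * (ϖ ^ n)⁻¹ = (y' - y) / ϖ ^ n by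
      field_simp; ring, norm_div, norm_zpow, div_le_one (zpow_pos hϖ.norm_pos n)]
  constructor
  · rintro ⟨rfl, hy, rfl⟩
    exact ⟨rfl, rfl, hentry.1 hy⟩
  · rintro ⟨rfl, rfl, hy⟩
    exact ⟨rfl, hentry.2 hy, rfl⟩

theorem exists_integral_mul_lower_left_eq_zero (h : GL (Fin 2) F) :
    ∃ κ ∈ integralSubgroup F, (κ * h) 1 0 = 0 := by
  have eliminate (g : GL (Fin 2) F) (hg : ‖g 0 0‖ ≤ ‖g 1 0‖) :
      ∃ κ ∈ integralSubgroup F, (κ * g) 1 0 = 0 := by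
    have hg10 : g 1 0 ≠ 0 := fun h0 => g.det_ne_zero <| by
      rw [h0, norm_zero, norm_le_zero_iff] at hg
      rw [Matrix.det_fin_two, hg, h0, zero_mul, mul_zero, sub_zero]
    refine ⟨swapGL F * upperGL 1 (-(g 0 0 / g 1 0)) 1, mul_mem swapGL_mem_integralSubgroup
      (upperGL_mem_integralSubgroup_iff.2 ⟨by simp, ?_, by simp⟩), ?_⟩
    · rw [norm_neg, norm_div]
      exact div_le_one_of_le₀ hg (norm_nonneg _)
    · rw [mul_assoc, (swapGL_mul_apply _ 0).2]
      simp [upperGL_val, Matrix.vecMul, dotProduct, hg10]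
  rcases le_total ‖h 0 0‖ ‖h 1 0‖ with hle | hle
  · exact eliminate h hle
  · obtain ⟨κ, hκ, h0⟩ := eliminate (swapGL F * h)
      (by rwa [(swapGL_mul_apply h 0).1, (swapGL_mul_apply h 0).2])
    exact ⟨κ * swapGL F, mul_mem hκ swapGL_mem_integralSubgroup, by rwa [mul_assoc]⟩

theorem exists_mul_triangularRep_inv_mem (hϖ : IsUniformizer ϖ) (h : GL (Fin 2) F) :
    ∃ m n y, h * (triangularRep hϖ m n y)⁻¹ ∈ integralSubgroup F := by
  obtain ⟨κ, hκ, h0⟩ := exists_integral_mul_lower_left_eq_zero h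
  obtain ⟨x, y, z, hxyz⟩ := eq_upperGL_of_lower_left_eq_zero h0
  have norm_normalized (t : Fˣ) : ‖((t * (hϖ.unit ^ val ϖ t)⁻¹ : Fˣ) : F)‖ = 1 := by
    rw [Units.val_mul, Units.val_inv_eq_inv_val, hϖ.unit_zpow_val, norm_mul, norm_inv, norm_zpow,
      ← norm_eq_zpow_val hϖ t.ne_zero, mul_inv_cancel₀ (norm_ne_zero_iff.2 t.ne_zero)]
  refine ⟨val ϖ x, val ϖ z, ϖ ^ val ϖ x * (↑x⁻¹ * y), ?_⟩
  rw [← (integralSubgroup F).mul_mem_cancel_left hκ, ← mul_assoc, hxyz, triangularRep, upperGL_inv,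
    upperGL_mul, upperGL_mem_integralSubgroup_iff]
  refine ⟨norm_normalized x, ?_, norm_normalized z⟩
  have := zpow_ne_zero (val ϖ (x : F)) hϖ.1
  simp [hϖ.unit_zpow_val, this, ← mul_assoc]

end Iwasawa

section IntegralOpen

variable {F : Type*} [NormedField F] [IsUltrametricDist F]

theorem isOpen_integralGL : IsOpen (integralGL F) := by
  have hentry (i j : Fin 2) : IsOpen {h : GL (Fin 2) F | ‖h i j‖ ≤ 1} := by
    have hcont : Continuous fun h : GL (Fin 2) F => h i j :=
      (Units.continuous_val (M := Matrix (Fin 2) (Fin 2) F)).matrix_elem i j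
    simpa [Set.preimage] using
      (IsUltrametricDist.isOpen_closedBall (0 : F) one_ne_zero).preimage hcont
  have hinter : integralGL F = (⋂ i, ⋂ j, {h : GL (Fin 2) F | ‖h i j‖ ≤ 1}) ∩
      ⋂ i, ⋂ j, (·⁻¹) ⁻¹' {h : GL (Fin 2) F | ‖h i j‖ ≤ 1} := by
    ext h
    simp [integralGL]
  rw [hinter]
  exact (isOpen_iInter_of_finite fun i => isOpen_iInter_of_finite fun j => hentry i j).inter
    (isOpen_iInter_of_finite fun i => isOpen_iInter_of_finite fun j =>
      (hentry i j).preimage continuous_inv)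

end IntegralOpen

section AlternatingSums

/-- The alternating weight `(-1) ^ j * j`; up to the factor `log q` it is the derivative at
`s = 0` of `η(x) |x| ^ (-s)` for `v(x) = j`. -/
noncomputable def altWeight (j : ℤ) : ℂ := (-1) ^ j * j

/-- A discrete primitive of `altWeight`. -/
noncomputable def altPrim (j : ℤ) : ℂ := -((-1) ^ j * (2 * j - 1) / 4)

theorem neg_one_zpow_add_one (j : ℤ) : (-1 : ℂ) ^ (j + 1) = -(-1) ^ j := by
  rw [zpow_add₀ (by norm_num), zpow_one, mul_neg_one]

theorem neg_one_zpow_eq_of_even_sub {i j : ℤ} (h : Even (i - j)) : (-1 : ℂ) ^ i = (-1) ^ j := by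
  rw [← sub_add_cancel i j, zpow_add₀ (by norm_num), h.neg_one_zpow, one_mul]

theorem neg_one_zpow_mul_self (j : ℤ) : (-1 : ℂ) ^ j * (-1) ^ j = 1 := by
  rw [← zpow_add₀ (by norm_num), Even.neg_one_zpow ⟨j, rfl⟩]

theorem sum_Ico_int_succ_top {M : Type*} [AddCommMonoid M] {a b : ℤ} (h : a ≤ b) (f : ℤ → M) :
    ∑ i ∈ Finset.Ico a (b + 1), f i = ∑ i ∈ Finset.Ico a b, f i + f b := by
  rw [← Finset.insert_Ico_right_eq_Ico_add_one h, Finset.sum_insert (by simp), add_comm]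

theorem sum_Ico_int_eq_add_bot {M : Type*} [AddCommMonoid M] {a b : ℤ} (h : a < b) (f : ℤ → M) :
    ∑ i ∈ Finset.Ico a b, f i = f a + ∑ i ∈ Finset.Ico (a + 1) b, f i := by
  rw [← Finset.insert_Ico_add_one_left_eq_Ico h, Finset.sum_insert (by simp)]

theorem sum_Ico_altWeight (c : ℤ) {a b : ℤ} (hab : a ≤ b) :
    ∑ k ∈ Finset.Ico a b, altWeight (k + c) = altPrim (b + c) - altPrim (a + c) := by
  induction b, hab using Int.leInduction with
  | base => simp
  | succ b hab ih =>
    rw [sum_Ico_int_succ_top hab, ih, add_right_comm, altPrim, altPrim, altPrim, altWeight,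
      neg_one_zpow_add_one]
    push_cast
    ring

theorem sum_Ico_altWeight_mul_half (w : ℤ → ℂ) (c t : ℤ) {a b : ℤ} (hab : a ≤ b) :
    ∑ k ∈ Finset.Ico (2 * a - 1 - t) (2 * b - 1 - t), altWeight (k + c) * w ((k + t + 1) / 2)
      = (-1) ^ (c - t) * ∑ j ∈ Finset.Ico a b, w j := by
  induction b, hab using Int.leInduction with
  | base => simp
  | succ b hab ih =>
    rw [show 2 * (b + 1) - 1 - t = 2 * b - 1 - t + 1 + 1 by ring, sum_Ico_int_succ_top (by omega),
      sum_Ico_int_succ_top (by omega), sum_Ico_int_succ_top hab, ih,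
      show (2 * b - 1 - t + t + 1) / 2 = b by omega,
      show (2 * b - 1 - t + 1 + t + 1) / 2 = b by omega, altWeight, altWeight,
      show 2 * b - 1 - t + 1 + c = 2 * b - 1 - t + c + 1 by ring, neg_one_zpow_add_one,
      neg_one_zpow_eq_of_even_sub (i := 2 * b - 1 - t + c) (j := c - t + 1) ⟨b - 1, by ring⟩,
      neg_one_zpow_add_one]
    push_cast
    ring

theorem sum_Ico_mul_ite_mem_Ico (f g : ℤ → ℂ) {lo a b hi : ℤ} (hlo : lo ≤ a) (hhi : b ≤ hi) :
    ∑ k ∈ Finset.Ico lo hi, f k * (if k ∈ Finset.Ico a b then g k else 0) =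
      ∑ k ∈ Finset.Ico a b, f k * g k := by
  simp only [mul_ite, mul_zero]
  rw [Finset.sum_ite_mem, Finset.inter_eq_right.2 (Finset.Ico_subset_Ico hlo hhi)]

end AlternatingSums

section IntervalSums

/-- `ballCount Q n j = Q ^ (n - max 0 j)`: for `Q = q` and `j ≤ n`, this is the number of classes
modulo `ϖ ^ n` contained in a ball of radius `|ϖ| ^ max 0 j` of the ring of integers. -/
noncomputable def ballCount (Q : ℂ) (n : ℕ) (j : ℤ) : ℂ := Q ^ (n - j.toNat)

/-- The alternating sum over `k` (see `sum_altWeight_mul_of_ball`) when the relevant classes always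
form one ball, the quadratic form having a discriminant of odd valuation `2 * h + 1`. -/
noncomputable def ballSum (Q : ℂ) (h : ℤ) (n r : ℕ) : ℂ :=
  ∑ j ∈ Finset.Ico (n - r - h : ℤ) (n + 1), ballCount Q n j

/-- The alternating sum over `k` (see `sum_altWeight_mul_of_split`) when the relevant classes may
form balls around two distinct roots, of valuations `δ` and `l - δ`. -/
noncomputable def splitSum (Q : ℂ) (l δ : ℤ) (n r : ℕ) : ℂ :=
  ∑ j ∈ Finset.Ico (n - r - δ : ℤ) (n + 1), ballCount Q n j +
    ballCount Q n (n - r - δ) * (((-1) ^ (n - r - δ : ℤ) * (l - 2 * δ) - 1) / 2)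

variable (Q : ℂ)

theorem sum_altWeight_mul_of_ball {n r : ℕ} {l : ℤ} (hl : Odd l) (hl0 : 0 < l) {lo hi : ℤ}
    (hlo : lo ≤ n - r - l) (hhi : n + r < hi) (c : ℤ) {cnt : ℤ → ℂ}
    (hcnt : ∀ k, cnt k = if n - r - l ≤ k ∧ k ≤ n + r then
      ballCount Q n ((k + n - r + 1) / 2) else 0) :
    ∑ k ∈ Finset.Ico lo hi, altWeight (k + (n + c)) * cnt k =
      (-1) ^ (c + r) * ballSum Q ((l - 1) / 2) n r := by
  obtain ⟨h, rfl⟩ := hl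
  have hcnt' (k : ℤ) : cnt k = if k ∈ Finset.Ico (2 * (n - r - h) - 1 - (n - r) : ℤ)
      (2 * (n + 1) - 1 - (n - r)) then ballCount Q n ((k + (n - r) + 1) / 2) else 0 := by
    rw [hcnt, ← add_sub_assoc]
    simp only [Finset.mem_Ico]
    exact if_congr (by omega) rfl rfl
  simp only [hcnt']
  rw [sum_Ico_mul_ite_mem_Ico _ _ (by omega) (by omega),
    sum_Ico_altWeight_mul_half _ _ _ (by omega), ballSum, show (2 * h + 1 - 1) / 2 = h by omega,
    show (n + c - (n - r) : ℤ) = c + r by ring]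

theorem altPrim_add_altPrim_sub_one (j : ℤ) : altPrim j + altPrim (j - 1) = -(-1) ^ j / 2 := by
  have h := neg_one_zpow_add_one (j - 1)
  rw [sub_add_cancel] at h
  rw [altPrim, altPrim, h]
  push_cast
  ring

theorem altPrim_add_altPrim_sub {l : ℤ} (hl : Odd l) (j : ℤ) :
    altPrim j + altPrim (j - l) = -(-1) ^ j * l / 2 := by
  have h := neg_one_zpow_add_one (j - l)
  rw [neg_one_zpow_eq_of_even_sub (j := j) (by
    rw [show j - l + 1 - j = 1 - l by ring]; exact odd_one.sub_odd hl)] at h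
  rw [altPrim, altPrim, h]
  push_cast
  ring

/- With `R = n - r - δ`, the count is the sum of three functions of `k`: the one ball count on
`k ≥ R - δ - 1`, and the constant `ballCount Q n R` on `[-δ, R - δ)` and on `[δ - l, R - δ - 1)`. -/
theorem sum_altWeight_mul_of_split {n r : ℕ} {l δ : ℤ} (hl : Odd l) (hδ : 0 ≤ δ) (hlδ : 2 * δ < l)
    (hR : 0 ≤ (n - r - δ : ℤ)) {lo hi : ℤ} (hlo : lo ≤ δ - l) (hhi : n + r < hi) (c : ℤ)
    {cnt : ℤ → ℂ} (hcnt : ∀ k, cnt k = if n - r - 2 * δ ≤ k then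
        (if k ≤ n + r then ballCount Q n ((k + n - r + 1) / 2) else 0)
      else (if -δ ≤ k then ballCount Q n (n - r - δ) else 0) +
        (if δ - l ≤ k then ballCount Q n (n - r - δ) else 0)) :
    ∑ k ∈ Finset.Ico lo hi, altWeight (k + (n + c)) * cnt k =
      (-1) ^ (c + r) * splitSum Q l δ n r := by
  obtain ⟨R, hRdef⟩ : ∃ R : ℤ, R = n - r - δ := ⟨_, rfl⟩
  have hcnt' (k : ℤ) : cnt k =
      (if k ∈ Finset.Ico (2 * R - 1 - (n - r) : ℤ) (2 * (n + 1) - 1 - (n - r)) then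
        ballCount Q n ((k + (n - r) + 1) / 2) else 0) +
      (if k ∈ Finset.Ico (-δ) (R - δ) then ballCount Q n R else 0) +
      (if k ∈ Finset.Ico (δ - l) (R - δ - 1) then ballCount Q n R else 0) := by
    rw [hcnt, ← add_sub_assoc, ← hRdef]
    simp only [Finset.mem_Ico]
    by_cases hk : k = R - δ - 1
    · rw [show (k + n - r + 1) / 2 = R by omega]
      split_ifs <;> first | omega | simp
    · split_ifs <;> first | omega | simp
  simp_rw [hcnt', mul_add (altWeight _), Finset.sum_add_distrib]
  rw [sum_Ico_mul_ite_mem_Ico _ _ (by omega) (by omega),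
    sum_Ico_mul_ite_mem_Ico _ _ (by omega) (by omega),
    sum_Ico_mul_ite_mem_Ico _ _ (by omega) (by omega), ← Finset.sum_mul, ← Finset.sum_mul,
    sum_Ico_altWeight_mul_half _ _ _ (by omega), sum_Ico_altWeight _ (by omega),
    sum_Ico_altWeight _ (by omega), splitSum, ← hRdef]
  have htop := altPrim_add_altPrim_sub_one (R - δ + (n + c))
  have hbot := altPrim_add_altPrim_sub (l := l - 2 * δ) (hl.sub_even (even_two_mul δ))
    (-δ + (n + c))
  rw [show R - δ + (n + c) - 1 = R - δ - 1 + (n + c) by ring,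
    neg_one_zpow_eq_of_even_sub (j := c + r) ⟨R, by omega⟩] at htop
  rw [show -δ + (n + c) - (l - 2 * δ) = δ - l + (n + c) by ring,
    neg_one_zpow_eq_of_even_sub (i := -δ + (n + c)) (j := c + r + R) ⟨0, by omega⟩,
    zpow_add₀ (by norm_num)] at hbot
  rw [show (n + c - (n - r) : ℤ) = c + r by ring]
  push_cast at hbot ⊢
  linear_combination ballCount Q n R * (htop - hbot)

theorem ballSum_succ_sub {h : ℤ} (hh : 0 ≤ h) (n r : ℕ) :
    ballSum Q h n (r + 1) - ballSum Q h n r = Q ^ min n (h + (r + 1 : ℕ)).toNat := by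
  rw [ballSum, ballSum, sum_Ico_int_eq_add_bot (by omega),
    show (n - (r + 1 : ℕ) - h + 1 : ℤ) = n - r - h by push_cast; ring, add_sub_cancel_right,
    ballCount]
  congr 1
  omega

theorem splitSum_succ_sub {l δ : ℤ} (hδ : 0 ≤ δ) {n r : ℕ} (hR : 0 ≤ (n - (r + 1 : ℕ) - δ : ℤ)) :
    splitSum Q l δ n (r + 1) - splitSum Q l δ n r =
      (Q ^ (δ + r).toNat + Q ^ ((δ + r).toNat + 1)) *
        ((1 + (-1) ^ (n - (r + 1 : ℕ) - δ : ℤ) * (l - 2 * δ)) / 2) := by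
  rw [splitSum, splitSum, sum_Ico_int_eq_add_bot (by omega),
    show (n - (r + 1 : ℕ) - δ + 1 : ℤ) = n - r - δ by push_cast; ring,
    show (n - r - δ : ℤ) = n - (r + 1 : ℕ) - δ + 1 by push_cast; ring, neg_one_zpow_add_one,
    ballCount, ballCount, show n - (n - (r + 1 : ℕ) - δ + 1 : ℤ).toNat = (δ + r).toNat by omega,
    show n - (n - (r + 1 : ℕ) - δ : ℤ).toNat = (δ + r).toNat + 1 by omega]
  ring

end IntervalSums

section Totals

/-- The right-hand side `∑ Q ^ j + C Q ^ N + C' Q ^ (N - 1)` of the main theorem. -/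
noncomputable def closedForm (Q : ℂ) (r : ℕ) (vb vc ve : ℤ) (δ : WithTop ℤ) : ℂ :=
  ∑ j ∈ Finset.Icc (0 : ℤ) (constN r vb vc ve δ), Q ^ j +
    (constC r vb vc ve δ : ℂ) * Q ^ constN r vb vc ve δ +
    (constC' r vb vc ve δ : ℂ) * Q ^ (constN r vb vc ve δ - 1)

theorem constN_of_lt_add_self (r : ℕ) {vb vc : ℤ} (ve : ℤ) {δ : WithTop ℤ}
    (h : ((vb + vc : ℤ) : WithTop ℤ) < δ + δ) :
    constN r vb vc ve δ = min ve ((vb + vc - 1) / 2 + r) := by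
  rw [constN]
  induction δ using WithTop.recTopCoe with
  | top => rw [top_add, min_top_right, ← WithTop.coe_min, WithTop.untopD_coe]
  | coe d =>
    rw [← WithTop.coe_add, WithTop.coe_lt_coe] at h
    rw [← WithTop.coe_add, ← WithTop.coe_min, ← WithTop.coe_min, WithTop.untopD_coe]
    omega

theorem constN_of_add_self_lt (r : ℕ) {vb vc d : ℤ} (ve : ℤ) (h : d + d < vb + vc) :
    constN r vb vc ve d = min ve (d + r) := by
  rw [constN, ← WithTop.coe_add, ← WithTop.coe_min, ← WithTop.coe_min, WithTop.untopD_coe]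
  omega

theorem constC_of_lt_add_self (r : ℕ) {vb vc : ℤ} (ve : ℤ) {δ : WithTop ℤ}
    (h : ((vb + vc : ℤ) : WithTop ℤ) < δ + δ) :
    constC r vb vc ve δ = ve - constN r vb vc ve δ := by
  simp only [constC, h, h.not_gt, and_true, and_false, if_false, constN_of_lt_add_self r ve h]
  split_ifs with hve
  · rfl
  · rw [min_eq_left (not_le.1 hve).le, sub_self]

theorem constC'_of_lt_add_self (r : ℕ) {vb vc : ℤ} (ve : ℤ) {δ : WithTop ℤ}
    (h : ((vb + vc : ℤ) : WithTop ℤ) < δ + δ) : constC' r vb vc ve δ = 0 := by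
  rw [constC', if_neg (fun hc => h.not_gt hc.2)]

theorem constC_of_kappa_neg {r : ℕ} {vb vc ve d : ℤ} (h : d + d < vb + vc)
    (hve : ve < d + r) : constC r vb vc ve d = 0 := by
  have hlt : (d : WithTop ℤ) + d < ((vb + vc : ℤ) : WithTop ℤ) := by exact_mod_cast h
  have hk : kappa r ve d < 0 := by rw [kappa, WithTop.untopD_coe]; omega
  simp only [constC, hk.le.not_gt, hk.not_ge, hlt.not_gt, false_and, and_false, if_false]

theorem constC'_of_kappa_neg {r : ℕ} (vb vc : ℤ) {ve d : ℤ} (hve : ve < d + r) :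
    constC' r vb vc ve d = 0 := by
  have hk : kappa r ve d < 0 := by rw [kappa, WithTop.untopD_coe]; omega
  rw [constC', if_neg (fun hc => hk.not_ge hc.1)]

theorem sum_range_half_one_add_neg_one_pow_mul (x : ℂ) (t : ℕ) :
    ∑ i ∈ Finset.range (t + 1), (1 + (-1) ^ i * x) / 2 =
      if Even t then t / 2 + (1 + x) / 2 else (t + 1) / 2 := by
  induction t with
  | zero => simp
  | succ t ih =>
    rw [Finset.sum_range_succ, ih]
    by_cases ht : Even t
    · rw [if_pos ht, if_neg (by simpa [Nat.even_add_one] using ht), ht.add_one.neg_one_pow]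
      push_cast
      ring
    · have ht' : Even (t + 1) := Nat.even_add_one.2 ht
      rw [if_neg ht, if_pos ht', ht'.neg_one_pow]
      push_cast
      ring

theorem constC_add_one_eq_sum {r : ℕ} {vb vc d : ℤ} (h : d + d < vb + vc) (t : ℕ) :
    (constC r vb vc (d + r + t) d : ℂ) + 1 =
      ∑ i ∈ Finset.range (t + 1), (1 + (-1) ^ i * ((vb + vc : ℤ) - 2 * (d : ℂ))) / 2 := by
  have hlt : (d : WithTop ℤ) + d < ((vb + vc : ℤ) : WithTop ℤ) := by exact_mod_cast h
  have hk : kappa r (d + r + t) d = t := by rw [kappa, WithTop.untopD_coe]; ring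
  rw [sum_range_half_one_add_neg_one_pow_mul]
  simp only [constC, hk, hlt, and_true, WithTop.untopD_coe, Int.even_coe_nat, Int.odd_coe_nat]
  by_cases ht : Even t
  · rw [if_neg (fun hc => Nat.not_odd_iff_even.2 ht hc.2), if_pos ⟨by omega, ht⟩, if_pos ht]
    push_cast
    ring
  · have ht' : Odd t := Nat.not_even_iff_odd.1 ht
    rw [if_pos ⟨by exact_mod_cast ht'.pos, ht'⟩, if_neg ht]
    push_cast
    ring

variable (Q : ℂ)

theorem sum_Icc_zpow (N : ℤ) :
    ∑ j ∈ Finset.Icc (0 : ℤ) N, Q ^ j = ∑ n ∈ Finset.range (N + 1).toNat, Q ^ n := by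
  refine (Finset.sum_bij (fun (n : ℕ) _ => (n : ℤ)) ?_ ?_ ?_ ?_).symm
  · intro n hn
    rw [Finset.mem_range] at hn
    rw [Finset.mem_Icc]
    omega
  · exact fun _ _ _ _ h => by exact_mod_cast h
  · intro j hj
    rw [Finset.mem_Icc] at hj
    exact ⟨j.toNat, by rw [Finset.mem_range]; omega, by omega⟩
  · exact fun n _ => (zpow_natCast Q n).symm

theorem sum_range_pow_min (m : ℕ) (ve : ℤ) :
    ∑ n ∈ Finset.range (ve + 1).toNat, Q ^ min n m =
      ∑ j ∈ Finset.Icc (0 : ℤ) (min ve m), Q ^ j +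
        (ve - (min ve m : ℤ) : ℂ) * Q ^ (min ve m) := by
  have hlow (t : ℕ) (ht : t ≤ m + 1) :
      ∑ n ∈ Finset.range t, Q ^ min n m = ∑ n ∈ Finset.range t, Q ^ n :=
    Finset.sum_congr rfl fun n hn => by
      rw [Finset.mem_range] at hn
      rw [min_eq_left (by omega)]
  rw [sum_Icc_zpow]
  rcases lt_or_ge ve m with hve | hve
  · rw [min_eq_left hve.le, sub_self, zero_mul, add_zero, hlow _ (by omega)]
  · obtain ⟨t, rfl⟩ := Int.le.dest hve
    rw [min_eq_right hve, show (m + t + 1 : ℤ).toNat = m + 1 + t by omega,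
      show (m + 1 : ℤ).toNat = m + 1 by omega, Finset.sum_range_add, hlow _ le_rfl]
    simp only [show ∀ i, min (m + 1 + i) m = m by omega]
    simp

theorem sum_eq_closedForm_of_ball {r : ℕ} {vb vc : ℤ} (ve : ℤ) {δ : WithTop ℤ}
    (hpos : 0 < vb + vc) (h : ((vb + vc : ℤ) : WithTop ℤ) < δ + δ) :
    ∑ n ∈ Finset.range (ve + 1).toNat, Q ^ min n ((vb + vc - 1) / 2 + r).toNat =
      closedForm Q r vb vc ve δ := by
  rw [sum_range_pow_min, closedForm, constC'_of_lt_add_self r ve h, constC_of_lt_add_self r ve h,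
    constN_of_lt_add_self r ve h, Int.toNat_of_nonneg (by omega),
    Rat.cast_sub, Rat.cast_intCast, Rat.cast_intCast, Rat.cast_zero, zero_mul, add_zero]

theorem sum_eq_closedForm_of_split {r : ℕ} {vb vc d : ℤ} (ve : ℤ) (hd : 0 ≤ d)
    (h : d + d < vb + vc) {T : ℕ → ℂ}
    (hlow : ∀ n : ℕ, n ≤ ve → n < d + (r + 1 : ℕ) → T n = Q ^ n)
    (hhigh : ∀ n : ℕ, n ≤ ve → d + (r + 1 : ℕ) ≤ n →
      T n = (Q ^ (d + r).toNat + Q ^ ((d + r).toNat + 1)) *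
        ((1 + (-1) ^ (n - (r + 1 : ℕ) - d : ℤ) * ((vb + vc : ℤ) - 2 * d)) / 2)) :
    ∑ n ∈ Finset.range (ve + 1).toNat, T n = closedForm Q (r + 1) vb vc ve d := by
  obtain ⟨m, hm⟩ : ∃ m : ℕ, d + (r + 1 : ℕ) = (m + 1 : ℕ) := ⟨(d + r).toNat, by omega⟩
  rw [closedForm, constN_of_add_self_lt _ _ h, sum_Icc_zpow]
  rcases lt_or_ge ve (d + (r + 1 : ℕ)) with hve | hve
  · rw [constC_of_kappa_neg h hve, constC'_of_kappa_neg vb vc hve, min_eq_left hve.le,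
      Finset.sum_congr rfl fun n hn => hlow n (by rw [Finset.mem_range] at hn; omega)
        (by rw [Finset.mem_range] at hn; omega)]
    simp
  · obtain ⟨t, rfl⟩ := Int.le.dest hve
    have hC' : constC' (r + 1) vb vc (d + (r + 1 : ℕ) + t) d =
        constC (r + 1) vb vc (d + (r + 1 : ℕ) + t) d + 1 :=
      if_pos ⟨by rw [kappa, WithTop.untopD_coe]; omega, by exact_mod_cast h⟩
    rw [hC', min_eq_right hve, hm, show ((m + 1 : ℕ) + t + 1 : ℤ).toNat = m + 1 + (t + 1) by omega,
      show ((m + 1 : ℕ) + 1 : ℤ).toNat = m + 1 + 1 by omega, Finset.sum_range_add,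
      Finset.sum_range_succ _ (m + 1),
      Finset.sum_congr rfl fun n hn => hlow n (by rw [Finset.mem_range] at hn; omega)
        (by rw [Finset.mem_range] at hn; omega),
      Finset.sum_congr rfl fun i hi => hhigh (m + 1 + i) (by rw [Finset.mem_range] at hi; omega)
        (by omega)]
    simp only [show ∀ i : ℕ, ((m + 1 + i : ℕ) - (r + 1 : ℕ) - d : ℤ) = i by omega, zpow_natCast]
    rw [← Finset.mul_sum, ← constC_add_one_eq_sum (r := r + 1) h, hm,
      show (d + r).toNat = m by omega, show ((m + 1 : ℕ) - 1 : ℤ) = m by omega, zpow_natCast]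
    push_cast
    ring

end Totals

section QuadraticForms

variable {K : Type*} [NormedField K]

/-- The binary quadratic form `B x² + D x y - ε y²`. -/
def quadForm (B D ε x y : K) : K := x ^ 2 * B + x * y * D - ε * y ^ 2

/-- The roots `y / x` of the form `quadForm B D ε` lie in the field and have valuations `δ` and
`l - δ`, with `δ < l - δ`. -/
structure IsSplitForm (ϖ B D ε ρ₁ ρ₂ : K) (l δ : ℤ) : Prop where
  two_mul_lt : 2 * δ < l
  norm_eps : ‖ε‖ = 1
  norm_root₁ : ‖ρ₁‖ = ‖ϖ‖ ^ δ
  norm_root₂ : ‖ρ₂‖ = ‖ϖ‖ ^ (l - δ)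
  linear_eq : D = ε * (ρ₁ + ρ₂)
  const_eq : B = -ε * (ρ₁ * ρ₂)

variable {ϖ : K}

theorem IsSplitForm.norm_quadForm {B D ε ρ₁ ρ₂ : K} {l δ : ℤ}
    (hS : IsSplitForm ϖ B D ε ρ₁ ρ₂ l δ) (x y : K) :
    ‖quadForm B D ε x y‖ = ‖(y - x * ρ₁) * (y - x * ρ₂)‖ := by
  have : quadForm B D ε x y = -ε * ((y - x * ρ₁) * (y - x * ρ₂)) := by
    rw [quadForm, hS.linear_eq, hS.const_eq]
    ring
  rw [this, norm_mul, norm_neg, hS.norm_eps, one_mul]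

theorem IsSplitForm.norm_zpow_mul_root₁ (h : IsUniformizer ϖ)
    {B D ε ρ₁ ρ₂ : K} {l δ : ℤ} (hS : IsSplitForm ϖ B D ε ρ₁ ρ₂ l δ) (k : ℤ) :
    ‖ϖ ^ k * ρ₁‖ = ‖ϖ‖ ^ (k + δ) := by
  rw [norm_mul, norm_zpow, hS.norm_root₁, zpow_add₀ h.norm_pos.ne']

theorem IsSplitForm.norm_zpow_mul_root₂ (h : IsUniformizer ϖ)
    {B D ε ρ₁ ρ₂ : K} {l δ : ℤ} (hS : IsSplitForm ϖ B D ε ρ₁ ρ₂ l δ) (k : ℤ) :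
    ‖ϖ ^ k * ρ₂‖ = ‖ϖ‖ ^ (k + (l - δ)) := by
  rw [norm_mul, norm_zpow, hS.norm_root₂, zpow_add₀ h.norm_pos.ne']

theorem IsSplitForm.norm_zpow_mul_root_lt (h : IsUniformizer ϖ)
    {B D ε ρ₁ ρ₂ : K} {l δ : ℤ} (hS : IsSplitForm ϖ B D ε ρ₁ ρ₂ l δ) (k : ℤ) :
    ‖ϖ ^ k * ρ₂‖ < ‖ϖ ^ k * ρ₁‖ := by
  have := hS.two_mul_lt
  rw [hS.norm_zpow_mul_root₁ h, hS.norm_zpow_mul_root₂ h, h.zpow_lt_zpow_iff]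
  omega

theorem IsUniformizer.sq_norm_le_zpow_iff (h : IsUniformizer ϖ) {M : ℤ} {y : K} :
    ‖y‖ ^ 2 ≤ ‖ϖ‖ ^ M ↔ ‖y‖ ≤ ‖ϖ‖ ^ ((M + 1) / 2) := by
  rcases eq_or_ne y 0 with rfl | hy
  · simp [zpow_nonneg]
  · rw [norm_eq_zpow_val h hy, ← zpow_natCast, ← zpow_mul, h.zpow_le_zpow_iff, h.zpow_le_zpow_iff]
    omega

variable [IsUltrametricDist K]

/- The valuations of `x² B` and of `ε y²` have different parities, so these terms cannot cancel,
and the middle term is smaller than the larger of the two. -/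
theorem norm_quadForm_eq_max (h : IsUniformizer ϖ) {B D ε : K} {l : ℤ} (hl : Odd l)
    (hB : ‖B‖ = ‖ϖ‖ ^ l) (hD : ‖D‖ ≤ ‖ϖ‖ ^ ((l + 1) / 2)) (hε : ‖ε‖ = 1) (k : ℤ) (y : K) :
    ‖quadForm B D ε (ϖ ^ k) y‖ = max (‖ϖ‖ ^ (2 * k + l)) (‖y‖ ^ 2) := by
  have hne := h.norm_pos.ne'
  have hB' : ‖(ϖ ^ k) ^ 2 * B‖ = ‖ϖ‖ ^ (2 * k + l) := by
    rw [norm_mul, norm_pow, norm_zpow, hB, ← zpow_natCast, ← zpow_mul, ← zpow_add₀ hne]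
    ring_nf
  rw [quadForm]
  rcases eq_or_ne y 0 with rfl | hy
  · simp [hB', zpow_nonneg]
  obtain ⟨t, rfl⟩ := hl
  have hyv := norm_eq_zpow_val h hy
  set v := val ϖ y
  have hε' : ‖ε * y ^ 2‖ = ‖ϖ‖ ^ (2 * v) := by
    rw [norm_mul, norm_pow, hyv, hε, one_mul, ← zpow_natCast, ← zpow_mul, mul_comm]
    rfl
  have hD' : ‖ϖ ^ k * y * D‖ ≤ ‖ϖ‖ ^ (k + v + (2 * t + 1 + 1) / 2) := by
    rw [norm_mul, norm_mul, norm_zpow, hyv, zpow_add₀ hne, zpow_add₀ hne k v]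
    exact mul_le_mul_of_nonneg_left hD (by positivity)
  rw [show ‖y‖ ^ 2 = ‖ε * y ^ 2‖ by rw [norm_mul, hε, one_mul, norm_pow], ← hB']
  have hne' : ‖(ϖ ^ k) ^ 2 * B‖ ≠ ‖ε * y ^ 2‖ := by
    rw [hB', hε', Ne, h.zpow_inj]
    omega
  rcases hne'.lt_or_gt with hlt | hlt
  · rw [max_eq_right hlt.le, norm_sub_eq_right]
    refine (IsUltrametricDist.norm_add_le_max _ _).trans_lt (max_lt hlt (hD'.trans_lt ?_))
    rw [hB', hε', h.zpow_lt_zpow_iff] at hlt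
    rw [hε', h.zpow_lt_zpow_iff]
    omega
  · rw [max_eq_left hlt.le, add_sub_assoc, norm_add_eq_left]
    refine (norm_sub_le_of_le (le_max_left _ _) (le_max_right _ _)).trans_lt
      (max_lt (hD'.trans_lt ?_) hlt)
    rw [hB', hε', h.zpow_lt_zpow_iff] at hlt
    rw [hB', h.zpow_lt_zpow_iff]
    omega

theorem norm_sub_mul_sub_le_iff_of_le (h : IsUniformizer ϖ) {α β : K} {a M : ℤ}
    (hα : ‖α‖ = ‖ϖ‖ ^ a) (hβ : ‖β‖ ≤ ‖α‖) (hM : M ≤ 2 * a) (y : K) :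
    ‖(y - α) * (y - β)‖ ≤ ‖ϖ‖ ^ M ↔ ‖y‖ ≤ ‖ϖ‖ ^ ((M + 1) / 2) := by
  rcases lt_or_ge ‖α‖ ‖y‖ with hy | hy
  · rw [norm_mul, norm_sub_eq_left hy, norm_sub_eq_left (hβ.trans_lt hy), ← sq,
      h.sq_norm_le_zpow_iff]
  · refine iff_of_true ?_ (hy.trans (by rw [hα, h.zpow_le_zpow_iff]; omega))
    calc ‖(y - α) * (y - β)‖ ≤ ‖ϖ‖ ^ a * ‖ϖ‖ ^ a := by
          rw [norm_mul, ← hα]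
          gcongr
          exacts [norm_sub_le_of_le hy le_rfl, norm_sub_le_of_le hy hβ]
      _ ≤ ‖ϖ‖ ^ M := by
          rw [← zpow_add₀ h.norm_pos.ne', h.zpow_le_zpow_iff]
          omega

theorem norm_sub_mul_sub_le_iff_of_lt (h : IsUniformizer ϖ) {α β : K} {a R : ℤ}
    (hα : ‖α‖ = ‖ϖ‖ ^ a) (hβ : ‖β‖ < ‖α‖) (hR : a < R) (y : K) :
    ‖(y - α) * (y - β)‖ ≤ ‖ϖ‖ ^ (R + a) ↔ ‖y - α‖ ≤ ‖ϖ‖ ^ R ∨ ‖y - β‖ ≤ ‖ϖ‖ ^ R := by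
  have hpos : 0 < ‖ϖ‖ ^ a := zpow_pos h.norm_pos a
  have hRa : ‖ϖ‖ ^ R < ‖ϖ‖ ^ a := h.zpow_lt_zpow_iff.2 hR
  have hαβ : ‖α - β‖ = ‖ϖ‖ ^ a := by rw [norm_sub_eq_left hβ, hα]
  rw [norm_mul, zpow_add₀ h.norm_pos.ne']
  rcases lt_or_ge ‖y - α‖ (‖ϖ‖ ^ a) with hy | hy
  · have hyβ : ‖y - β‖ = ‖ϖ‖ ^ a := by
      rw [← sub_add_sub_cancel' α β y, norm_add_eq_left (by rwa [hαβ]), hαβ]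
    rw [hyβ, mul_le_mul_iff_left₀ hpos, or_iff_left hRa.not_ge]
  rcases lt_or_ge ‖y - β‖ (‖ϖ‖ ^ a) with hy' | hy'
  · have hyα : ‖y - α‖ = ‖ϖ‖ ^ a := by
      rw [← sub_add_sub_cancel' β α y, norm_add_eq_left, norm_sub_rev, hαβ]
      rwa [norm_sub_rev β α, hαβ]
    rw [hyα, mul_comm, mul_le_mul_iff_left₀ hpos, or_iff_right hRa.not_ge]
  · refine iff_of_false (not_le.2 ?_)
      (not_or.2 ⟨(hRa.trans_le hy).not_ge, (hRa.trans_le hy').not_ge⟩)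
    exact mul_lt_mul (hRa.trans_le hy) hy' hpos (norm_nonneg _)

theorem norm_eq_zpow_of_norm_add_of_norm_mul (h : IsUniformizer ϖ) {a b : K} {l δ : ℤ}
    (hlδ : 2 * δ < l) (hadd : ‖a + b‖ = ‖ϖ‖ ^ δ) (hmul : ‖a * b‖ = ‖ϖ‖ ^ l) (hab : ‖b‖ ≤ ‖a‖) :
    ‖a‖ = ‖ϖ‖ ^ δ ∧ ‖b‖ = ‖ϖ‖ ^ (l - δ) := by
  have hne := h.norm_pos.ne'
  have hlt : ‖b‖ < ‖a‖ := by
    refine lt_of_le_of_ne hab fun he => ?_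
    have hδa : ‖ϖ‖ ^ δ ≤ ‖a‖ := hadd ▸ norm_add_le_of_le le_rfl hab
    have hsq : ‖ϖ‖ ^ δ * ‖ϖ‖ ^ δ ≤ ‖ϖ‖ ^ l := by
      rw [← hmul, norm_mul, he]
      gcongr
    rw [← zpow_add₀ hne, h.zpow_le_zpow_iff] at hsq
    omega
  have ha : ‖a‖ = ‖ϖ‖ ^ δ := by rw [← hadd, norm_add_eq_left hlt]
  refine ⟨ha, ?_⟩
  rw [norm_mul, ha] at hmul
  rw [zpow_sub₀ hne, ← hmul, mul_div_cancel_left₀ _ (zpow_pos h.norm_pos _).ne']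

theorem exists_isSplitForm [CompleteSpace K] (h : IsUniformizer ϖ) (h2 : ‖(2 : K)‖ = 1)
    {B D ε : K} {l δ : ℤ} (hε : ‖ε‖ = 1) (hlδ : 2 * δ < l) (hB : ‖B‖ = ‖ϖ‖ ^ l)
    (hD : ‖D‖ = ‖ϖ‖ ^ δ) : ∃ ρ₁ ρ₂ : K, IsSplitForm ϖ B D ε ρ₁ ρ₂ l δ := by
  have h20 : (2 : K) ≠ 0 := norm_ne_zero_iff.1 (h2 ▸ one_ne_zero)
  have hε0 : ε ≠ 0 := norm_ne_zero_iff.1 (hε ▸ one_ne_zero)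
  have hD0 : D ≠ 0 := norm_ne_zero_iff.1 (hD ▸ (zpow_pos h.norm_pos _).ne')
  obtain ⟨u, hu⟩ : ∃ u : K, u ^ 2 = 1 + 2 * 2 * ε * B / D ^ 2 := by
    refine exists_sq_eq_of_norm_sub_one_lt h2 ?_
    rw [add_sub_cancel_left]
    simp only [norm_div, norm_mul, norm_pow, h2, hε, hB, hD, one_mul]
    rw [← zpow_natCast, ← zpow_mul, ← zpow_sub₀ h.norm_pos.ne', ← zpow_zero ‖ϖ‖,
      h.zpow_lt_zpow_iff]
    omega
  obtain ⟨a, ha⟩ : ∃ a, a = D * (1 + u) / (2 * ε) := ⟨_, rfl⟩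
  obtain ⟨b, hb⟩ : ∃ b, b = D * (1 - u) / (2 * ε) := ⟨_, rfl⟩
  have hsum : D = ε * (a + b) := by rw [ha, hb]; field_simp; ring
  have hprod : B = -ε * (a * b) := by
    have : -ε * (a * b) = -(D ^ 2 * (1 - u ^ 2) / (2 * 2 * ε)) := by rw [ha, hb]; field_simp; ring
    rw [this, hu]
    field_simp
    ring
  have hadd : ‖a + b‖ = ‖ϖ‖ ^ δ := by rw [← hD, hsum, norm_mul, hε, one_mul]
  have hmul : ‖a * b‖ = ‖ϖ‖ ^ l := by rw [← hB, hprod, norm_mul (-ε), norm_neg, hε, one_mul]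
  rcases le_total ‖b‖ ‖a‖ with hab | hab
  · obtain ⟨hna, hnb⟩ := norm_eq_zpow_of_norm_add_of_norm_mul h hlδ hadd hmul hab
    exact ⟨a, b, hlδ, hε, hna, hnb, hsum, hprod⟩
  · rw [add_comm] at hadd hsum
    rw [mul_comm a] at hmul hprod
    obtain ⟨hnb, hna⟩ := norm_eq_zpow_of_norm_add_of_norm_mul h hlδ hadd hmul hab
    exact ⟨b, a, hlδ, hε, hnb, hna, hsum, hprod⟩

end QuadraticForms

section Counting

variable {K : Type*} [NormedField K]

/-- The condition on `k` and `y` expressing, for `γ` as in the main theorem and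
`h = !![ϖ ^ (k + v(c)), y; 0, ϖ ^ n]`, that `h γ h⁻¹` has entries in `ϖ ^ (-r) O_E`
(see `FormCoeffs.actS2_triangularRep_mem_KSle_iff`). -/
def FormCond (ϖ B D ε : K) (n r : ℕ) (k : ℤ) (y : K) : Prop :=
  ‖y‖ ≤ ‖ϖ‖ ^ (k - r) ∧ k ≤ n + r ∧ ‖quadForm B D ε (ϖ ^ k) y‖ ≤ ‖ϖ‖ ^ (k + n - r)

variable [IsUltrametricDist K] {ϖ B D ε ρ₁ ρ₂ : K} {l δ : ℤ} {n : ℕ} {Y : Finset K}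

theorem IsSplitForm.formCond_iff_of_lt (h : IsUniformizer ϖ)
    (hS : IsSplitForm ϖ B D ε ρ₁ ρ₂ l δ) (hδ : 0 ≤ δ) {r : ℕ} {k : ℤ}
    (hk : k < n - r - 2 * δ) (y : K) :
    FormCond ϖ B D ε n r k y ↔ ‖y - ϖ ^ k * ρ₁‖ ≤ ‖ϖ‖ ^ (n - r - δ : ℤ) ∨
      ‖y - ϖ ^ k * ρ₂‖ ≤ ‖ϖ‖ ^ (n - r - δ : ℤ) := by
  have hlt := hS.norm_zpow_mul_root_lt h k
  rw [FormCond, hS.norm_quadForm, show k + n - r = (n - r - δ) + (k + δ) by ring,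
    norm_sub_mul_sub_le_iff_of_lt h (hS.norm_zpow_mul_root₁ h k) hlt (by omega)]
  refine ⟨fun hy => hy.2.2, fun hy => ⟨?_, by omega, hy⟩⟩
  have hR : ‖ϖ‖ ^ (n - r - δ : ℤ) ≤ ‖ϖ‖ ^ (k - r) := h.zpow_le_zpow_iff.2 (by omega)
  have hroot : ‖ϖ ^ k * ρ₁‖ ≤ ‖ϖ‖ ^ (k - r) := by
    rw [hS.norm_zpow_mul_root₁ h, h.zpow_le_zpow_iff]
    omega
  rcases hy with hy | hy
  · exact sub_add_cancel y _ ▸ norm_add_le_of_le (hy.trans hR) hroot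
  · exact sub_add_cancel y _ ▸ norm_add_le_of_le (hy.trans hR) (hlt.le.trans hroot)

variable [ProperSpace K]

open Classical in
theorem IsReps.card_ball_int (h : IsUniformizer ϖ) {j : ℤ} (hj : j ≤ n)
    (hY : IsReps ϖ n Y) {c : K} (hc : ‖c‖ ≤ 1) :
    ({y ∈ Y | ‖y - c‖ ≤ ‖ϖ‖ ^ j}.card : ℂ) = ballCount (residueCard K) n j := by
  have hfilter : {y ∈ Y | ‖y - c‖ ≤ ‖ϖ‖ ^ j} = {y ∈ Y | ‖y - c‖ ≤ ‖ϖ‖ ^ j.toNat} := by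
    refine Finset.filter_congr fun y hy => ?_
    rcases le_total 0 j with hj0 | hj0
    · rw [← zpow_natCast, Int.toNat_of_nonneg hj0]
    · have hyc : ‖y - c‖ ≤ 1 := norm_sub_le_of_le (hY.norm_le_one hy) hc
      rw [Int.toNat_of_nonpos hj0, pow_zero]
      refine iff_of_true (hyc.trans ?_) hyc
      rwa [← zpow_zero ‖ϖ‖, h.zpow_le_zpow_iff]
  rw [hfilter, hY.card_ball h (by omega) hc, ballCount, Nat.cast_pow]

/- A centre outside the ring of integers contributes only if the ball contains that ring. -/
open Classical in
theorem IsReps.card_ball_of_norm_eq (h : IsUniformizer ϖ)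
    (hY : IsReps ϖ n Y) {c : K} {v R : ℤ} (hc : ‖c‖ = ‖ϖ‖ ^ v) (hR : R ≤ n) :
    ({y ∈ Y | ‖y - c‖ ≤ ‖ϖ‖ ^ R}.card : ℂ) =
      if min 0 R ≤ v then ballCount (residueCard K) n R else 0 := by
  rcases le_or_gt 0 v with hv | hv
  · rw [if_pos (by omega), hY.card_ball_int h hR (by rw [hc]; exact h.zpow_le_one_iff.2 hv)]
  have hyc (y : K) (hy : y ∈ Y) : ‖y - c‖ ≤ ‖ϖ‖ ^ R ↔ R ≤ v := by
    have hlt : ‖y‖ < ‖c‖ := (hY.norm_le_one hy).trans_lt (by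
      rwa [hc, ← zpow_zero ‖ϖ‖, h.zpow_lt_zpow_iff])
    rw [norm_sub_eq_right hlt, hc, h.zpow_le_zpow_iff]
  rw [Finset.filter_congr hyc]
  rcases le_or_gt R v with hRv | hRv
  · rw [if_pos (by omega), Finset.filter_true_of_mem fun _ _ => hRv, hY.card h, ballCount,
      Int.toNat_of_nonpos (by omega), Nat.sub_zero, Nat.cast_pow]
  · rw [if_neg (by omega), Finset.filter_false_of_mem fun _ _ => hRv.not_ge, Finset.card_empty,
      Nat.cast_zero]

open Classical in
theorem IsReps.card_formCond_of_odd (h : IsUniformizer ϖ) (hY : IsReps ϖ n Y) (hl : Odd l)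
    (hB : ‖B‖ = ‖ϖ‖ ^ l) (hD : ‖D‖ ≤ ‖ϖ‖ ^ ((l + 1) / 2)) (hε : ‖ε‖ = 1) (r : ℕ) (k : ℤ) :
    ({y ∈ Y | FormCond ϖ B D ε n r k y}.card : ℂ) =
      if n - r - l ≤ k ∧ k ≤ n + r then ballCount (residueCard K) n ((k + n - r + 1) / 2)
        else 0 := by
  simp only [FormCond, norm_quadForm_eq_max h hl hB hD hε, max_le_iff, h.zpow_le_zpow_iff,
    h.sq_norm_le_zpow_iff]
  split_ifs with hk
  · rw [← hY.card_ball_int h (by omega) (c := 0) (by simp)]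
    congr 2
    refine Finset.filter_congr fun y _ => ?_
    rw [sub_zero]
    refine ⟨fun hy => hy.2.2.2, fun hy => ⟨hy.trans ?_, hk.2, by omega, hy⟩⟩
    rw [h.zpow_le_zpow_iff]
    omega
  · rw [Nat.cast_eq_zero, Finset.card_eq_zero, Finset.filter_eq_empty_iff]
    exact fun y _ hy => hk ⟨by omega, hy.2.1⟩

open Classical in
theorem IsSplitForm.card_formCond_of_le (h : IsUniformizer ϖ)
    (hS : IsSplitForm ϖ B D ε ρ₁ ρ₂ l δ) (hY : IsReps ϖ n Y) {r : ℕ} {k : ℤ}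
    (hk : n - r - 2 * δ ≤ k) :
    ({y ∈ Y | FormCond ϖ B D ε n r k y}.card : ℂ) =
      if k ≤ n + r then ballCount (residueCard K) n ((k + n - r + 1) / 2) else 0 := by
  simp only [FormCond, hS.norm_quadForm, norm_sub_mul_sub_le_iff_of_le h
    (hS.norm_zpow_mul_root₁ h k) (hS.norm_zpow_mul_root_lt h k).le
    (show k + n - r ≤ 2 * (k + δ) by omega)]
  split_ifs with hkn
  · rw [← hY.card_ball_int h (by omega) (c := 0) (by simp)]
    congr 2
    refine Finset.filter_congr fun y _ => ?_
    rw [sub_zero]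
    refine ⟨fun hy => hy.2.2, fun hy => ⟨hy.trans ?_, hkn, hy⟩⟩
    rw [h.zpow_le_zpow_iff]
    omega
  · rw [Nat.cast_eq_zero, Finset.card_eq_zero, Finset.filter_eq_empty_iff]
    exact fun y _ hy => hkn hy.2.1

open Classical in
theorem IsSplitForm.card_formCond_of_lt (h : IsUniformizer ϖ)
    (hS : IsSplitForm ϖ B D ε ρ₁ ρ₂ l δ) (hδ : 0 ≤ δ) (hY : IsReps ϖ n Y) {r : ℕ} {k : ℤ}
    (hk : k < n - r - 2 * δ) :
    ({y ∈ Y | FormCond ϖ B D ε n r k y}.card : ℂ) =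
      (if min 0 (n - r - δ) ≤ k + δ then ballCount (residueCard K) n (n - r - δ) else 0) +
        (if min 0 (n - r - δ) ≤ k + (l - δ) then ballCount (residueCard K) n (n - r - δ)
          else 0) := by
  have hdisj : Disjoint {y ∈ Y | ‖y - ϖ ^ k * ρ₁‖ ≤ ‖ϖ‖ ^ (n - r - δ : ℤ)}
      {y ∈ Y | ‖y - ϖ ^ k * ρ₂‖ ≤ ‖ϖ‖ ^ (n - r - δ : ℤ)} := by
    refine Finset.disjoint_filter.2 fun y _ hy₁ hy₂ => ?_
    rw [norm_sub_rev] at hy₁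
    have := norm_sub_le_trans hy₁ hy₂
    rw [norm_sub_eq_left (hS.norm_zpow_mul_root_lt h k), hS.norm_zpow_mul_root₁ h,
      h.zpow_le_zpow_iff] at this
    omega
  rw [Finset.filter_congr fun y _ => hS.formCond_iff_of_lt h hδ hk y, Finset.filter_or,
    Finset.card_union_of_disjoint hdisj, Nat.cast_add,
    hY.card_ball_of_norm_eq h (hS.norm_zpow_mul_root₁ h k) (by omega),
    hY.card_ball_of_norm_eq h (hS.norm_zpow_mul_root₂ h k) (by omega)]

end Counting

section ResidueCharacteristic

theorem norm_two_eq_one {p : ℕ} [Fact p.Prime] (hp : p ≠ 2) (K : Type*) [NormedField K]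
    [NormedAlgebra ℚ_[p] K] : ‖(2 : K)‖ = 1 := by
  have h : ‖((2 : ℕ) : ℚ_[p])‖ = 1 :=
    Padic.norm_natCast_eq_one_iff.2 ((Nat.coprime_primes Fact.out Nat.prime_two).2 hp)
  rw [← map_ofNat (algebraMap ℚ_[p] K) 2, norm_algebraMap']
  exact_mod_cast h

end ResidueCharacteristic

section QuadraticExtension

theorem card_aut_eq_two {F E : Type*} [Field F] [Field E] [Algebra F E]
    (hdeg : Module.finrank F E = 2) {σ : E ≃ₐ[F] E} (hσ : σ ≠ AlgEquiv.refl) :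
    Nat.card (E ≃ₐ[F] E) = 2 := by
  have : FiniteDimensional F E := .of_finrank_eq_succ hdeg
  have : Nontrivial (E ≃ₐ[F] E) := ⟨σ, AlgEquiv.refl, hσ⟩
  have hle : Nat.card (E ≃ₐ[F] E) ≤ 2 := by
    rw [Nat.card_eq_fintype_card, ← hdeg]
    exact AlgEquiv.card_le
  exact le_antisymm hle Finite.one_lt_card

theorem conj_conj {F E : Type*} [Field F] [Field E] [Algebra F E]
    (hdeg : Module.finrank F E = 2) {σ : E ≃ₐ[F] E} (hσ : σ ≠ AlgEquiv.refl) (x : E) :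
    σ (σ x) = x := by
  have : σ ^ 2 = 1 := by rw [← card_aut_eq_two hdeg hσ, pow_card_eq_one']
  rw [← AlgEquiv.mul_apply, ← sq, this, AlgEquiv.one_apply]

theorem exists_algebraMap_eq_of_conj_eq {F E : Type*} [Field F] [Field E] [Algebra F E]
    (hdeg : Module.finrank F E = 2) {σ : E ≃ₐ[F] E} (hσ : σ ≠ AlgEquiv.refl) {x : E}
    (hx : σ x = x) : ∃ s : F, algebraMap F E s = x := by
  have hcard := card_aut_eq_two hdeg hσ
  have : FiniteDimensional F E := .of_finrank_eq_succ hdeg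
  have : IsGalois F E := IsGalois.of_card_aut_eq_finrank F E (hcard.trans hdeg.symm)
  refine (IsGalois.mem_range_algebraMap_iff_fixed x).2 fun τ => ?_
  obtain ⟨ρ, hρ⟩ := (Nat.card_eq_two_iff' (AlgEquiv.refl : E ≃ₐ[F] E)).1 hcard
  rcases eq_or_ne τ AlgEquiv.refl with rfl | hτ
  · rfl
  · rwa [hρ.2 τ hτ, ← hρ.2 σ hσ]

theorem isUltrametricDist_of_normedAlgebra (F E : Type*) [NormedField F] [NormedField E]
    [NormedAlgebra F E] [IsUltrametricDist F] : IsUltrametricDist E := by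
  refine IsUltrametricDist.isUltrametricDist_of_forall_norm_natCast_le_one fun n => ?_
  rw [← map_natCast (algebraMap F E), norm_algebraMap']
  exact IsUltrametricDist.norm_natCast_le_one F n

variable {F E : Type*} [NormedField F] [NormedField E] [NormedAlgebra F E] {ϖ : F}

theorem exists_norm_eq_one_conj_eq_neg (hdeg : Module.finrank F E = 2)
    (hϖ : IsUniformizer (algebraMap F E ϖ)) {σ : E ≃ₐ[F] E} (hσ : σ ≠ AlgEquiv.refl) :
    ∃ x : E, ‖x‖ = 1 ∧ σ x = -x := by
  obtain ⟨y, hy⟩ : ∃ y, σ y ≠ y := by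
    by_contra! hc
    exact hσ (AlgEquiv.ext hc)
  have hσy : σ (y - σ y) = -(y - σ y) := by rw [map_sub, conj_conj hdeg hσ, neg_sub]
  refine ⟨(y - σ y) * algebraMap F E (ϖ ^ (-val (algebraMap F E ϖ) (y - σ y))), ?_, ?_⟩
  · rw [norm_mul, map_zpow₀, norm_zpow, norm_eq_zpow_val hϖ (sub_ne_zero.2 hy.symm),
      ← zpow_add₀ hϖ.norm_pos.ne', add_neg_cancel, zpow_zero]
  · rw [map_mul, AlgEquiv.commutes, hσy, neg_mul]

theorem norm_conj [IsUltrametricDist F] [CompleteSpace F] [FiniteDimensional F E]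
    (hϖ : IsUniformizer ϖ) (σ : E ≃ₐ[F] E) (x : E) : ‖σ x‖ = ‖x‖ := by
  let _ : NontriviallyNormedField F :=
    { ‹NormedField F› with
      non_trivial := ⟨ϖ⁻¹, by rw [norm_inv]; exact (one_lt_inv₀ hϖ.norm_pos).2 hϖ.norm_lt_one⟩ }
  rw [NormedAlgebra.norm_eq_spectralNorm F x, NormedAlgebra.norm_eq_spectralNorm F (σ x)]
  exact (spectralNorm_eq_of_equiv σ x).symm

end QuadraticExtension

section NormEquation

theorem exists_sq_sub_mul_sq_eq_of_finite {k : Type*} [Field k] [Finite k] (h2 : (2 : k) ≠ 0)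
    {α : k} (hα : α ≠ 0) (u : k) : ∃ s t : k, s ^ 2 - α * t ^ 2 = u := by
  let _ : Fintype k := Fintype.ofFinite k
  have hchar : ringChar k ≠ 2 := fun hc => h2 (by exact_mod_cast hc ▸ ringChar.Nat.cast_ringChar)
  obtain ⟨s, t, hst⟩ := FiniteField.exists_root_sum_quadratic
    (f := Polynomial.X ^ 2 - Polynomial.C u) (g := Polynomial.C (-α) * Polynomial.X ^ 2)
    (Polynomial.degree_X_pow_sub_C two_pos u)
    (Polynomial.degree_C_mul_X_pow 2 (neg_ne_zero.2 hα))
    (FiniteField.odd_card_of_char_ne_two hchar)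
  refine ⟨s, t, ?_⟩
  simp only [Polynomial.eval_sub, Polynomial.eval_pow, Polynomial.eval_X, Polynomial.eval_C,
    Polynomial.eval_mul] at hst
  linear_combination hst

variable {F : Type*} [NormedField F] [IsUltrametricDist F] {ϖ : F}

theorem exists_norm_sq_sub_mul_sq_sub_lt_one [ProperSpace F] (hϖ : IsUniformizer ϖ)
    (h2 : ‖(2 : F)‖ = 1) {α u : F} (hα : ‖α‖ = 1) (hu : ‖u‖ ≤ 1) :
    ∃ s t : F, ‖s‖ ≤ 1 ∧ ‖t‖ ≤ 1 ∧ ‖s ^ 2 - α * t ^ 2 - u‖ < 1 := by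
  let O := (NormedField.valuation (K := F)).valuationSubring
  let k := IsLocalRing.ResidueField O
  have : Finite k := Nat.finite_of_card_ne_zero
    (show residueCard F ≠ 0 from (zero_lt_one.trans (one_lt_residueCard hϖ)).ne')
  have hres (x : O) : IsLocalRing.residue O x = 0 ↔ ‖(x : F)‖ < 1 := by
    rw [← map_zero (IsLocalRing.residue O), residue_eq_residue_iff hϖ, hϖ.norm_lt_one_iff,
      ZeroMemClass.coe_zero, sub_zero]
  have h2k : (2 : k) ≠ 0 := by
    rw [← map_ofNat (IsLocalRing.residue O) 2, Ne, hres]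
    exact h2.not_lt
  have hαk : IsLocalRing.residue O ⟨α, hα.le⟩ ≠ 0 := (hres _).not.2 hα.not_lt
  obtain ⟨s, t, hst⟩ := exists_sq_sub_mul_sq_eq_of_finite h2k hαk (IsLocalRing.residue O ⟨u, hu⟩)
  obtain ⟨s, rfl⟩ := IsLocalRing.residue_surjective s
  obtain ⟨t, rfl⟩ := IsLocalRing.residue_surjective t
  refine ⟨s, t, s.2, t.2, (hres (s ^ 2 - ⟨α, hα.le⟩ * t ^ 2 - ⟨u, hu⟩)).1 ?_⟩
  rw [map_sub, map_sub, map_mul, map_pow, map_pow, hst, sub_self]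

theorem exists_mul_sq_eq_of_norm_sub_lt_one [CompleteSpace F] (h2 : ‖(2 : F)‖ = 1) {α t w : F}
    (hα : ‖α‖ = 1) (ht : ‖t‖ = 1) (h : ‖w - α * t ^ 2‖ < 1) : ∃ z : F, α * z ^ 2 = w := by
  have hα0 : α ≠ 0 := norm_ne_zero_iff.1 (hα ▸ one_ne_zero)
  have ht0 : t ≠ 0 := norm_ne_zero_iff.1 (ht ▸ one_ne_zero)
  obtain ⟨z, hz⟩ := exists_sq_eq_of_norm_sub_one_lt h2 (x := w / (α * t ^ 2)) (by
    rwa [← div_self (mul_ne_zero hα0 (pow_ne_zero 2 ht0)), ← sub_div, norm_div, norm_mul,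
      norm_pow, hα, ht, one_pow, mul_one, div_one])
  refine ⟨t * z, ?_⟩
  rw [mul_pow, hz]
  field_simp

theorem exists_sq_sub_mul_sq_eq [ProperSpace F] (hϖ : IsUniformizer ϖ) (h2 : ‖(2 : F)‖ = 1)
    {α u : F} (hα : ‖α‖ = 1) (hu : ‖u‖ = 1) : ∃ s t : F, s ^ 2 - α * t ^ 2 = u := by
  obtain ⟨s, t, -, ht, hst⟩ := exists_norm_sq_sub_mul_sq_sub_lt_one hϖ h2 hα hu.le
  rcases ht.eq_or_lt with ht | ht
  · obtain ⟨z, hz⟩ := exists_mul_sq_eq_of_norm_sub_lt_one h2 (w := s ^ 2 - u) hα ht (by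
      rwa [sub_right_comm])
    exact ⟨s, z, by rw [hz, sub_sub_cancel]⟩
  · have hαt : ‖α * t ^ 2‖ < 1 := by
      rw [norm_mul, hα, one_mul, norm_pow]
      exact pow_lt_one₀ (norm_nonneg _) ht two_ne_zero
    have hw : ‖u + α * t ^ 2‖ = 1 := by rw [norm_add_eq_left (by rwa [hu]), hu]
    have hs' : ‖s‖ = 1 := by
      rw [← pow_eq_one_iff_of_nonneg (norm_nonneg _) two_ne_zero, ← norm_pow,
        ← add_sub_cancel (u + α * t ^ 2) (s ^ 2), ← sub_sub, sub_right_comm,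
        norm_add_eq_left (by rwa [hw]), hw]
    obtain ⟨z, hz⟩ := exists_mul_sq_eq_of_norm_sub_lt_one h2 (w := u + α * t ^ 2) norm_one hs' (by
      rwa [one_mul, norm_sub_rev, ← sub_sub, sub_right_comm])
    exact ⟨z, t, by linear_combination hz⟩

variable {E : Type*} [NormedField E] [NormedAlgebra F E]

/- Up to an even power of `ϖ`, `f` is a unit, and `s² - α t² = (s + t x)(s - t x)` is a norm when
`x² = α` and `σ x = -x`. -/
theorem exists_mul_conj_eq_of_even_val [ProperSpace F] (hdeg : Module.finrank F E = 2)
    (hϖ : IsUniformizer ϖ) (hϖE : IsUniformizer (algebraMap F E ϖ)) {σ : E ≃ₐ[F] E}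
    (hσ : σ ≠ AlgEquiv.refl) (h2 : ‖(2 : F)‖ = 1) {f : F} (hf : f ≠ 0) (heven : Even (val ϖ f)) :
    ∃ t : E, t * σ t = algebraMap F E f := by
  obtain ⟨x, hx, hσx⟩ := exists_norm_eq_one_conj_eq_neg hdeg hϖE hσ
  obtain ⟨α, hα⟩ := exists_algebraMap_eq_of_conj_eq hdeg hσ (x := x ^ 2) (by
    rw [map_pow, hσx, neg_sq])
  have hαn : ‖α‖ = 1 := by rw [← norm_algebraMap' E, hα, norm_pow, hx, one_pow]
  obtain ⟨m, hm⟩ := heven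
  obtain ⟨s, t, hst⟩ := exists_sq_sub_mul_sq_eq hϖ h2 hαn (u := f * ϖ ^ (-(m + m))) (by
    rw [norm_mul, norm_zpow, norm_eq_zpow_val hϖ hf, hm, ← zpow_add₀ hϖ.norm_pos.ne',
      add_neg_cancel, zpow_zero])
  have hfst : f = ϖ ^ m * ϖ ^ m * (s ^ 2 - α * t ^ 2) := by
    rw [hst, ← zpow_add₀ hϖ.1, mul_left_comm, ← zpow_add₀ hϖ.1, add_neg_cancel, zpow_zero, mul_one]
  refine ⟨algebraMap F E (ϖ ^ m) * (algebraMap F E s + algebraMap F E t * x), ?_⟩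
  rw [hfst]
  simp only [map_mul, map_add, map_sub, map_pow, AlgEquiv.commutes, hσx, hα]
  ring

end NormEquation

section HermitianForms

variable {F E : Type*} [NormedField F] [NormedField E] [NormedAlgebra F E]
  {σ : E ≃ₐ[F] E} {J : Matrix (Fin 2) (Fin 2) E}

/-- The Hermitian form with Gram matrix `J`, conjugate linear in the first variable. -/
def herm (σ : E ≃ₐ[F] E) (J : Matrix (Fin 2) (Fin 2) E) (x y : Fin 2 → E) : E :=
  hermStar σ J x ⬝ᵥ y

theorem herm_eq (x y : Fin 2 → E) :
    herm σ J x y =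
      σ (x 0) * (J 0 0 * y 0 + J 0 1 * y 1) + σ (x 1) * (J 1 0 * y 0 + J 1 1 * y 1) := by
  simp only [herm, hermStar, dotProduct, Matrix.vecMul, Fin.sum_univ_two]
  ring

theorem herm_symm (hσ : ∀ z, σ (σ z) = z) (hJ : adj σ J = J) (x y : Fin 2 → E) :
    herm σ J y x = σ (herm σ J x y) := by
  have hJσ (i j) : σ (J i j) = J j i := congrFun (congrFun hJ j) i
  simp only [herm_eq, map_add, map_mul, hσ, hJσ]
  ring

theorem herm_add_left (x y z : Fin 2 → E) :
    herm σ J (x + y) z = herm σ J x z + herm σ J y z := by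
  simp only [herm_eq, Pi.add_apply, map_add]
  ring

theorem herm_add_right (x y z : Fin 2 → E) :
    herm σ J x (y + z) = herm σ J x y + herm σ J x z := by
  simp only [herm_eq, Pi.add_apply]
  ring

theorem herm_smul_left (t : E) (x y : Fin 2 → E) :
    herm σ J (t • x) y = σ t * herm σ J x y := by
  simp only [herm_eq, Pi.smul_apply, smul_eq_mul, map_mul]
  ring

theorem herm_smul_right (t : E) (x y : Fin 2 → E) :
    herm σ J x (t • y) = t * herm σ J x y := by
  simp only [herm_eq, Pi.smul_apply, smul_eq_mul]
  ring

theorem herm_mulVec_mulVec {g : Matrix (Fin 2) (Fin 2) E} (hg : adj σ g * J * g = J)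
    (x y : Fin 2 → E) : herm σ J (g *ᵥ x) (g *ᵥ y) = herm σ J x y := by
  nth_rewrite 2 [← hg]
  simp only [herm_eq, adj, Matrix.mulVec, dotProduct, Fin.sum_univ_two, map_add, map_mul,
    Matrix.mul_apply, Matrix.transpose_apply, Matrix.map_apply]
  ring

theorem adj_mul_mul_eq_gram (x y : Fin 2 → E) :
    adj σ !![x 0, y 0; x 1, y 1] * J * !![x 0, y 0; x 1, y 1] =
      !![herm σ J x x, herm σ J x y; herm σ J y x, herm σ J y y] := by
  ext i j
  fin_cases i <;> fin_cases j <;>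
    simp [adj, herm_eq, Matrix.mul_apply, Fin.sum_univ_two] <;> ring

theorem exists_herm_eq_one (hdet : J.det ≠ 0) {z : Fin 2 → E} (hz : z ≠ 0) :
    ∃ y, herm σ J z y = 1 := by
  obtain ⟨y, hy⟩ : ∃ y, herm σ J z y ≠ 0 := by
    by_contra! hc
    have hσz : (fun i => σ (z i)) = 0 :=
      Matrix.eq_zero_of_vecMul_eq_zero hdet (dotProduct_eq_zero _ hc)
    exact hz (funext fun i => by simpa using congrFun hσz i)
  exact ⟨(herm σ J z y)⁻¹ • y, by rw [herm_smul_right, inv_mul_cancel₀ hy]⟩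

theorem exists_hyperbolic_partner (hσ : ∀ z, σ (σ z) = z) (h2 : (2 : E) ≠ 0)
    (hJ : adj σ J = J) (hdet : J.det ≠ 0) {z : Fin 2 → E} (hz : z ≠ 0)
    (hzz : herm σ J z z = 0) : ∃ y, herm σ J z y = 1 ∧ herm σ J y y = 0 := by
  obtain ⟨y, hzy⟩ := exists_herm_eq_one (σ := σ) hdet hz
  have hyz : herm σ J y z = 1 := by rw [herm_symm hσ hJ z, hzy, map_one]
  have hyy : σ (herm σ J y y) = herm σ J y y := (herm_symm hσ hJ y y).symm
  refine ⟨y + (-(herm σ J y y / 2)) • z, ?_, ?_⟩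
  · rw [herm_add_right, herm_smul_right, hzy, hzz, mul_zero, add_zero]
  · simp only [herm_add_left, herm_add_right, herm_smul_left, herm_smul_right, hyz, hzy, hzz,
      map_neg, map_div₀, hyy, map_ofNat]
    field_simp
    ring

theorem not_isNonsplitHermitian_of_isotropic (hσ : ∀ z, σ (σ z) = z) (h2 : (2 : E) ≠ 0)
    {z : Fin 2 → E} (hz : z ≠ 0) (hzz : herm σ J z z = 0) : ¬ IsNonsplitHermitian σ J := by
  rintro ⟨hJ, hdet, hns⟩
  obtain ⟨y, hzy, hyy⟩ := exists_hyperbolic_partner hσ h2 hJ hdet hz hzz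
  have hyz : herm σ J y z = 1 := by rw [herm_symm hσ hJ z, hzy, map_one]
  have hP := adj_mul_mul_eq_gram (σ := σ) (J := J) z y
  rw [hzz, hzy, hyz, hyy] at hP
  refine hns ⟨Matrix.GeneralLinearGroup.mkOfDetNeZero _ fun h0 => ?_, hP⟩
  have := congrArg Matrix.det hP
  rw [Matrix.det_mul, h0, mul_zero, Matrix.det_fin_two_of] at this
  simp at this

end HermitianForms

section Matching

variable {F E : Type*} [NormedField F] [NormedField E] [NormedAlgebra F E] {σ : E ≃ₐ[F] E}

theorem S2_entries {γ : S2 σ} {a b c d : E}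
    (hγ : ((γ : GL (Fin 2) E) : Matrix (Fin 2) (Fin 2) E) = !![a, b; c, d]) :
    a * σ a + b * σ c = 1 ∧ c * σ a + d * σ c = 0 ∧ c * σ b + d * σ d = 1 := by
  have h : ((γ : GL (Fin 2) E) : Matrix (Fin 2) (Fin 2) E) *
      ((γ : GL (Fin 2) E) : Matrix (Fin 2) (Fin 2) E).map σ = 1 := congrArg Units.val γ.2
  rw [hγ] at h
  refine ⟨?_, ?_, ?_⟩
  · simpa [Matrix.mul_apply, Fin.sum_univ_two] using congrFun (congrFun h 0) 0
  · simpa [Matrix.mul_apply, Fin.sum_univ_two] using congrFun (congrFun h 1) 0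
  · simpa [Matrix.mul_apply, Fin.sum_univ_two] using congrFun (congrFun h 1) 1

theorem linearIndependent_of_isRegSS {A : Matrix (Fin 2) (Fin 2) E} {u v : Fin 2 → E}
    (h : IsRegSS A u v) :
    LinearIndependent E ![u, A *ᵥ u] ∧ LinearIndependent E ![v, v ᵥ* A] := by
  constructor
  · convert h.1 using 1
    funext i
    fin_cases i <;> simp
  · convert h.2 using 1
    funext i
    fin_cases i <;> simp

theorem ne_zero_of_isRegSS {a b c d e : E}
    (h : IsRegSS !![a, b; c, d] ![0, 1] ![0, e]) : b ≠ 0 ∧ c ≠ 0 ∧ e ≠ 0 := by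
  obtain ⟨hu, hv⟩ := linearIndependent_of_isRegSS h
  rw [LinearIndependent.pair_iff] at hu hv
  refine ⟨?_, ?_, ?_⟩
  · rintro rfl
    exact one_ne_zero (hu (-d) 1 (by ext i; fin_cases i <;> simp)).2
  · rintro rfl
    exact one_ne_zero (hv (-d) 1 (by ext i; fin_cases i <;> simp; ring)).2
  · rintro rfl
    exact one_ne_zero (hv 1 0 (by ext i; fin_cases i <;> simp)).1

theorem ne_zero_of_isRegSSMinus {γ : S2 σ} {a b c d : E} {e : F}
    (hγ : ((γ : GL (Fin 2) E) : Matrix (Fin 2) (Fin 2) E) = !![a, b; c, d])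
    (hrs : IsRegSSMinus γ ![0, 1] ![0, e]) : b ≠ 0 ∧ c ≠ 0 ∧ e ≠ 0 := by
  rw [← map_ne_zero (algebraMap F E)]
  refine ne_zero_of_isRegSS (a := a) (d := d) ?_
  convert hrs.1 using 1
  · exact hγ.symm
  · ext i
    fin_cases i <;> simp
  · ext i
    fin_cases i <;> simp

theorem herm_matching {γ g P : GL (Fin 2) E} {J : Matrix (Fin 2) (Fin 2) E} {u v w : Fin 2 → E}
    (hg : P * γ * P⁻¹ = g) (hw : (P : Matrix (Fin 2) (Fin 2) E) *ᵥ u = w)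
    (hv : v ᵥ* ((P⁻¹ : GL (Fin 2) E) : Matrix (Fin 2) (Fin 2) E) = hermStar σ J w) :
    herm σ J w w = v ⬝ᵥ u ∧
      herm σ J w ((g : Matrix (Fin 2) (Fin 2) E) *ᵥ w) =
        v ⬝ᵥ ((γ : Matrix (Fin 2) (Fin 2) E) *ᵥ u) := by
  constructor
  · rw [herm, ← hv, ← hw, ← Matrix.dotProduct_mulVec, Matrix.mulVec_mulVec, ← Units.val_mul,
      inv_mul_cancel, Units.val_one, Matrix.one_mulVec]
  · rw [herm, ← hv, ← hw, ← hg, ← Matrix.dotProduct_mulVec, Matrix.mulVec_mulVec,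
      Matrix.mulVec_mulVec, ← Units.val_mul, ← Units.val_mul,
      show P⁻¹ * (P * γ * P⁻¹) * P = γ by group]

/- If `d d̄ - 1 = t t̄`, then `(t - d) w + g w` is an isotropic vector of the Hermitian space. -/
theorem not_exists_mul_conj_eq (hσ : ∀ z, σ (σ z) = z) (h2 : (2 : E) ≠ 0)
    {γ : S2 σ} {a b c d : E} {e : F}
    (hγ : ((γ : GL (Fin 2) E) : Matrix (Fin 2) (Fin 2) E) = !![a, b; c, d])
    (hrs : IsRegSSMinus γ ![0, 1] ![0, e]) : ¬ ∃ t : E, t * σ t = d * σ d - 1 := by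
  rintro ⟨t, ht⟩
  obtain ⟨-, J, hJns, g, w, hg, hgrs, P, hPγ, hPu, hPv⟩ := hrs
  obtain ⟨hw, hwg⟩ := herm_matching hPγ hPu hPv
  rw [hγ] at hwg
  simp only [dotProduct, Fin.sum_univ_two, Matrix.cons_val_zero,
    Matrix.cons_val_one, map_zero, map_one, Matrix.mulVec, Matrix.of_apply, Matrix.cons_val',
    Matrix.cons_val_fin_one, zero_mul, mul_one, mul_zero, zero_add] at hw hwg
  have hgw := herm_symm hσ hJns.1 w ((g : Matrix (Fin 2) (Fin 2) E) *ᵥ w)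
  rw [hwg, map_mul, AlgEquiv.commutes] at hgw
  have hgg := (herm_mulVec_mulVec hg w w).trans hw
  refine not_isNonsplitHermitian_of_isotropic hσ h2
    (z := (t - d) • w + (1 : E) • ((g : Matrix (Fin 2) (Fin 2) E) *ᵥ w)) (fun h0 => ?_) ?_ hJns
  · have hli := LinearIndependent.pair_iff.1 (linearIndependent_of_isRegSS hgrs).1
    exact one_ne_zero (hli _ _ h0).2
  · simp only [herm_add_left, herm_smul_left, herm_add_right, herm_smul_right, hw, hwg, hgw, hgg,
      map_sub, map_one]
    linear_combination algebraMap F E e * ht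

end Matching

section Invariants

variable {F E : Type*} [NormedField F] [NormedField E] [NormedAlgebra F E] {ϖ : F}
  {σ : E ≃ₐ[F] E} {a b c d : E}

theorem norm_mul_conj_sub_one (hϖE : IsUniformizer (algebraMap F E ϖ))
    (hσn : ∀ x, ‖σ x‖ = ‖x‖) (hbcd : c * σ b + d * σ d = 1) (hb : b ≠ 0) (hc : c ≠ 0) :
    ‖d * σ d - 1‖ = ‖ϖ‖ ^ (val (algebraMap F E ϖ) b + val (algebraMap F E ϖ) c) := by
  rw [show d * σ d - 1 = -(σ b * c) by linear_combination hbcd, norm_neg, norm_mul, hσn,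
    norm_eq_zpow_val hϖE hb, norm_eq_zpow_val hϖE hc, ← zpow_add₀ hϖE.norm_pos.ne',
    norm_algebraMap']

theorem norm_eq_one_of_mul_conj_add_eq_one [IsUltrametricDist E] (hσn : ∀ x, ‖σ x‖ = ‖x‖)
    {x y : E} (hxy : x * σ x + y = 1) (hy : ‖y‖ < 1) : ‖x‖ = 1 := by
  have h : ‖x * σ x‖ = 1 := by
    rw [show x * σ x = 1 - y by linear_combination hxy, norm_sub_eq_left (by rwa [norm_one]),
      norm_one]
  rw [norm_mul, hσn, ← sq] at h
  exact (pow_eq_one_iff_of_nonneg (norm_nonneg _) two_ne_zero).1 h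

variable [IsUltrametricDist F] [ProperSpace F]

/- `d d̄ - 1 = -c b̄` lies in `F`; were its valuation even, it would be a norm. -/
theorem odd_val_add_val (hdeg : Module.finrank F E = 2) (hσ : σ ≠ AlgEquiv.refl)
    (hϖ : IsUniformizer ϖ) (hϖE : IsUniformizer (algebraMap F E ϖ)) (h2 : ‖(2 : F)‖ = 1)
    {γ : S2 σ} {e : F}
    (hγ : ((γ : GL (Fin 2) E) : Matrix (Fin 2) (Fin 2) E) = !![a, b; c, d])
    (hrs : IsRegSSMinus γ ![0, 1] ![0, e]) (hb : b ≠ 0) (hc : c ≠ 0) :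
    Odd (val (algebraMap F E ϖ) b + val (algebraMap F E ϖ) c) := by
  have : FiniteDimensional F E := .of_finrank_eq_succ hdeg
  have hσ2 := conj_conj hdeg hσ
  have h20 : (2 : E) ≠ 0 := by
    rw [← norm_ne_zero_iff, ← map_ofNat (algebraMap F E) 2, norm_algebraMap', h2]
    exact one_ne_zero
  obtain ⟨f, hf⟩ := exists_algebraMap_eq_of_conj_eq hdeg hσ (x := d * σ d - 1) (by
    rw [map_sub, map_mul, hσ2, map_one, mul_comm])
  have hfn : ‖f‖ = ‖ϖ‖ ^ (val (algebraMap F E ϖ) b + val (algebraMap F E ϖ) c) := by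
    rw [← norm_algebraMap' E, hf,
      norm_mul_conj_sub_one hϖE (norm_conj hϖ σ) (S2_entries hγ).2.2 hb hc]
  have hf0 : f ≠ 0 := norm_ne_zero_iff.1 (by rw [hfn]; exact (zpow_pos hϖ.norm_pos _).ne')
  rw [← Int.not_even_iff_odd, ← val_eq_of_norm hϖ hfn]
  intro heven
  obtain ⟨t, ht⟩ := exists_mul_conj_eq_of_even_val hdeg hϖ hϖE hσ h2 hf0 heven
  exact not_exists_mul_conj_eq hσ2 h20 hγ hrs ⟨t, ht.trans hf⟩

/- If `v(b) + v(c) < 0`, then `v(d d̄) = v(d d̄ - 1) = v(b) + v(c)` is even. -/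
theorem val_add_val_pos (hdeg : Module.finrank F E = 2) (hϖ : IsUniformizer ϖ)
    (hϖE : IsUniformizer (algebraMap F E ϖ)) (hbcd : c * σ b + d * σ d = 1)
    (hb : b ≠ 0) (hc : c ≠ 0)
    (hodd : Odd (val (algebraMap F E ϖ) b + val (algebraMap F E ϖ) c)) :
    0 < val (algebraMap F E ϖ) b + val (algebraMap F E ϖ) c := by
  have : FiniteDimensional F E := .of_finrank_eq_succ hdeg
  have : IsUltrametricDist E := isUltrametricDist_of_normedAlgebra F E
  by_contra! hnonpos
  have hneg : val (algebraMap F E ϖ) b + val (algebraMap F E ϖ) c < 0 :=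
    hnonpos.lt_of_ne fun h0 => by simp [h0] at hodd
  have hnorm := norm_mul_conj_sub_one hϖE (norm_conj hϖ σ) hbcd hb hc
  have hdd : ‖d * σ d‖ = ‖ϖ‖ ^ (val (algebraMap F E ϖ) b + val (algebraMap F E ϖ) c) := by
    rw [← sub_add_cancel (d * σ d) 1, norm_add_eq_left, hnorm]
    rwa [norm_one, hnorm, ← zpow_zero ‖ϖ‖, hϖ.zpow_lt_zpow_iff]
  have hd0 : d ≠ 0 := by
    rintro rfl
    rw [zero_mul, norm_zero] at hdd
    exact (zpow_pos hϖ.norm_pos _).ne hdd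
  rw [norm_mul, norm_conj hϖ, norm_eq_zpow_val hϖE hd0, norm_algebraMap',
    ← zpow_add₀ hϖ.norm_pos.ne', hϖ.zpow_inj] at hdd
  rw [← hdd, ← Int.not_even_iff_odd] at hodd
  exact hodd ⟨_, rfl⟩

end Invariants

section FormCoeffs

variable {F E : Type*} [NormedField F] [NormedField E] [NormedAlgebra F E]

/-- The coefficients `B = b c̄`, `D = ϖ^{-v(c)} (d - a) c̄` and `ε = ϖ^{-2 v(c)} c c̄`, in `F`, of
the binary quadratic form that controls the upper right entry of the conjugates of
`!![a, b; c, d]` by triangular matrices. Here `a` and `d` are units and `vb = v(b)`, `vc = v(c)`. -/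
structure FormCoeffs (σ : E ≃ₐ[F] E) (ϖ : F) (a b c d : E) (vb vc : ℤ) (B D ε : F) : Prop where
  norm_a : ‖a‖ = 1
  norm_b : ‖b‖ = ‖ϖ‖ ^ vb
  norm_c : ‖c‖ = ‖ϖ‖ ^ vc
  norm_d : ‖d‖ = 1
  norm_conj_c : ‖σ c‖ = ‖c‖
  algebraMap_const : algebraMap F E B = b * σ c
  algebraMap_linear : algebraMap F E D * algebraMap F E (ϖ ^ vc) = (d - a) * σ c
  algebraMap_square : algebraMap F E ε * algebraMap F E (ϖ ^ vc) ^ 2 = c * σ c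

namespace FormCoeffs

variable {ϖ : F} {σ : E ≃ₐ[F] E} {a b c d : E} {vb vc : ℤ} {B D ε : F}

theorem norm_const (h : FormCoeffs σ ϖ a b c d vb vc B D ε) (hϖ : IsUniformizer ϖ) :
    ‖B‖ = ‖ϖ‖ ^ (vb + vc) := by
  rw [← norm_algebraMap' E, h.algebraMap_const, norm_mul, h.norm_conj_c, h.norm_b, h.norm_c,
    zpow_add₀ hϖ.norm_pos.ne']

theorem norm_linear (h : FormCoeffs σ ϖ a b c d vb vc B D ε) (hϖ : IsUniformizer ϖ) :
    ‖D‖ = ‖d - a‖ := by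
  have hD := congrArg norm h.algebraMap_linear
  rw [norm_mul, norm_mul, norm_algebraMap', norm_algebraMap', norm_zpow, h.norm_conj_c,
    h.norm_c] at hD
  exact mul_right_cancel₀ (zpow_pos hϖ.norm_pos _).ne' hD

theorem norm_linear_le_one [IsUltrametricDist E] (h : FormCoeffs σ ϖ a b c d vb vc B D ε)
    (hϖ : IsUniformizer ϖ) : ‖D‖ ≤ 1 := by
  rw [h.norm_linear hϖ]
  exact norm_sub_le_of_le h.norm_d.le h.norm_a.le

theorem norm_square (h : FormCoeffs σ ϖ a b c d vb vc B D ε) (hϖ : IsUniformizer ϖ) :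
    ‖ε‖ = 1 := by
  have hε := congrArg norm h.algebraMap_square
  rw [norm_mul, norm_mul, norm_pow, norm_algebraMap', norm_algebraMap', norm_zpow, h.norm_conj_c,
    h.norm_c, ← sq] at hε
  exact mul_right_cancel₀ (pow_pos (zpow_pos hϖ.norm_pos _) 2).ne' (by rw [hε, one_mul])

end FormCoeffs

variable [IsUltrametricDist F] [ProperSpace F] {ϖ : F} {σ : E ≃ₐ[F] E} {a b c d : E}

theorem exists_formCoeffs (hdeg : Module.finrank F E = 2) (hσ : σ ≠ AlgEquiv.refl)
    (hϖ : IsUniformizer ϖ) (hϖE : IsUniformizer (algebraMap F E ϖ)) {γ : S2 σ}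
    (hγ : ((γ : GL (Fin 2) E) : Matrix (Fin 2) (Fin 2) E) = !![a, b; c, d])
    (hb : b ≠ 0) (hc : c ≠ 0)
    (hpos : 0 < val (algebraMap F E ϖ) b + val (algebraMap F E ϖ) c) :
    ∃ B D ε : F, FormCoeffs σ ϖ a b c d (val (algebraMap F E ϖ) b) (val (algebraMap F E ϖ) c)
      B D ε := by
  have : FiniteDimensional F E := .of_finrank_eq_succ hdeg
  have : IsUltrametricDist E := isUltrametricDist_of_normedAlgebra F E
  have hσ2 := conj_conj hdeg hσ
  have hσn := norm_conj hϖ σ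
  obtain ⟨h11, h21, h22⟩ := S2_entries hγ
  have hbn := norm_eq_zpow_val hϖE hb
  have hcn := norm_eq_zpow_val hϖE hc
  rw [norm_algebraMap'] at hbn hcn
  have hbc : ‖b‖ * ‖c‖ < 1 := by
    rwa [hbn, hcn, ← zpow_add₀ hϖ.norm_pos.ne', ← zpow_zero ‖ϖ‖, hϖ.zpow_lt_zpow_iff]
  obtain ⟨B, hB⟩ := exists_algebraMap_eq_of_conj_eq hdeg hσ (x := b * σ c) (by
    rw [show b * σ c = 1 - a * σ a by linear_combination h11]
    simp only [map_sub, map_mul, map_one, hσ2]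
    ring)
  obtain ⟨D, hD⟩ := exists_algebraMap_eq_of_conj_eq hdeg hσ (x := (d - a) * σ c) (by
    rw [show (d - a) * σ c = -(c * σ a + a * σ c) by linear_combination h21]
    simp only [map_neg, map_add, map_mul, hσ2]
    ring)
  obtain ⟨ε, hε⟩ := exists_algebraMap_eq_of_conj_eq hdeg hσ (x := c * σ c) (by
    rw [map_mul, hσ2, mul_comm])
  have hp : algebraMap F E (ϖ ^ val (algebraMap F E ϖ) c) ≠ 0 :=
    (map_ne_zero _).2 (zpow_ne_zero _ hϖ.1)
  exact ⟨B, D / ϖ ^ val (algebraMap F E ϖ) c, ε / (ϖ ^ val (algebraMap F E ϖ) c) ^ 2,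
    { norm_a := norm_eq_one_of_mul_conj_add_eq_one hσn h11 (by rwa [norm_mul, hσn])
      norm_b := hbn
      norm_c := hcn
      norm_d := norm_eq_one_of_mul_conj_add_eq_one hσn (add_comm _ _ |>.trans h22)
        (by rwa [norm_mul, hσn, mul_comm])
      norm_conj_c := hσn c
      algebraMap_const := hB
      algebraMap_linear := by rw [map_div₀, hD, div_mul_cancel₀ _ hp]
      algebraMap_square := by rw [map_div₀, hε, map_pow, div_mul_cancel₀ _ (pow_ne_zero _ hp)] }⟩

end FormCoeffs

section TriangularConjugation

variable {F E : Type*} [NormedField F] [NormedField E] [NormedAlgebra F E]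
  {σ : E ≃ₐ[F] E} {ϖ : F} {a b c d : E}

theorem extGL_triangularRep_val (hϖ : IsUniformizer ϖ) (m n : ℤ) (y : F) :
    (extGL E (triangularRep hϖ m n y)).val =
      !![algebraMap F E (ϖ ^ m), algebraMap F E y; 0, algebraMap F E (ϖ ^ n)] := by
  ext i j
  rw [extGL, Matrix.GeneralLinearGroup.map_apply, triangularRep_val]
  fin_cases i <;> fin_cases j <;> simp

theorem extGL_triangularRep_inv_val (hϖ : IsUniformizer ϖ) (m n : ℤ) (y : F) :
    ((extGL E (triangularRep hϖ m n y))⁻¹).val =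
      !![(algebraMap F E (ϖ ^ m))⁻¹,
          -((algebraMap F E (ϖ ^ m))⁻¹ * algebraMap F E y * (algebraMap F E (ϖ ^ n))⁻¹);
        0, (algebraMap F E (ϖ ^ n))⁻¹] := by
  ext i j
  rw [extGL, ← map_inv, Matrix.GeneralLinearGroup.map_apply, triangularRep_inv_val]
  fin_cases i <;> fin_cases j <;> simp

theorem actS2_triangularRep_val (hϖ : IsUniformizer ϖ) {γ : S2 σ}
    (hγ : ((γ : GL (Fin 2) E) : Matrix (Fin 2) (Fin 2) E) = !![a, b; c, d]) (m n : ℤ) (y : F) :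
    ((actS2 (triangularRep hϖ m n y) γ : S2 σ) : GL (Fin 2) E).val =
      !![a + algebraMap F E y * c / algebraMap F E (ϖ ^ m),
          (algebraMap F E (ϖ ^ m) ^ 2 * b +
              algebraMap F E (ϖ ^ m) * algebraMap F E y * (d - a) - algebraMap F E y ^ 2 * c) /
            (algebraMap F E (ϖ ^ m) * algebraMap F E (ϖ ^ n));
        algebraMap F E (ϖ ^ n) * c / algebraMap F E (ϖ ^ m),
          d - algebraMap F E y * c / algebraMap F E (ϖ ^ m)] := by
  have hm : algebraMap F E (ϖ ^ m) ≠ 0 := (map_ne_zero _).2 (zpow_ne_zero _ hϖ.1)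
  have hn : algebraMap F E (ϖ ^ n) ≠ 0 := (map_ne_zero _).2 (zpow_ne_zero _ hϖ.1)
  rw [actS2, Units.val_mul, Units.val_mul, hγ, extGL_triangularRep_val,
    extGL_triangularRep_inv_val]
  simp only [Matrix.mul_fin_two, EmbeddingLike.apply_eq_iff_eq, Matrix.vecCons_inj, and_true]
  refine ⟨⟨?_, ?_⟩, ?_, ?_⟩ <;> field_simp <;> ring

theorem mem_KSle_iff (hϖ : IsUniformizer ϖ) {γ : S2 σ} {r : ℕ} :
    γ ∈ KSle σ ϖ r ↔ ∀ i j, ‖(γ : GL (Fin 2) E) i j‖ ≤ ‖ϖ‖ ^ (-r : ℤ) := by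
  refine forall₂_congr fun i j => ?_
  rw [norm_mul, norm_pow, norm_algebraMap', zpow_neg, zpow_natCast, mul_comm,
    ← le_div_iff₀ (pow_pos hϖ.norm_pos r), one_div]

theorem norm_actS2_triangularRep_lower_left (hϖ : IsUniformizer ϖ) {γ : S2 σ}
    (hγ : ((γ : GL (Fin 2) E) : Matrix (Fin 2) (Fin 2) E) = !![a, b; c, d]) {vc : ℤ}
    (hc : ‖c‖ = ‖ϖ‖ ^ vc) (k n : ℤ) (y : F) :
    ‖((actS2 (triangularRep hϖ (k + vc) n y) γ : S2 σ) : GL (Fin 2) E) 1 0‖ = ‖ϖ‖ ^ (n - k) := by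
  rw [actS2_triangularRep_val hϖ hγ]
  simp only [Matrix.of_apply, Matrix.cons_val', Matrix.cons_val_zero, Matrix.cons_val_one,
    Matrix.cons_val_fin_one, norm_div, norm_mul, norm_algebraMap', norm_zpow, hc]
  rw [← zpow_add₀ hϖ.norm_pos.ne', ← zpow_sub₀ hϖ.norm_pos.ne']
  congr 1
  ring

namespace FormCoeffs

variable {vb vc : ℤ} {B D ε : F}

theorem mul_conj_eq_quadForm (h : FormCoeffs σ ϖ a b c d vb vc B D ε) (x y : F) :
    (algebraMap F E (x * ϖ ^ vc) ^ 2 * b +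
        algebraMap F E (x * ϖ ^ vc) * algebraMap F E y * (d - a) - algebraMap F E y ^ 2 * c) * σ c =
      algebraMap F E ((ϖ ^ vc) ^ 2 * quadForm B D ε x y) := by
  simp only [quadForm, map_mul, map_add, map_sub, map_pow]
  linear_combination
    -algebraMap F E (ϖ ^ vc) ^ 2 * algebraMap F E x ^ 2 * h.algebraMap_const -
      algebraMap F E (ϖ ^ vc) * algebraMap F E x * algebraMap F E y * h.algebraMap_linear +
      algebraMap F E y ^ 2 * h.algebraMap_square

theorem norm_actS2_triangularRep_upper_right (h : FormCoeffs σ ϖ a b c d vb vc B D ε)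
    (hϖ : IsUniformizer ϖ) {γ : S2 σ}
    (hγ : ((γ : GL (Fin 2) E) : Matrix (Fin 2) (Fin 2) E) = !![a, b; c, d]) (k n : ℤ) (y : F) :
    ‖((actS2 (triangularRep hϖ (k + vc) n y) γ : S2 σ) : GL (Fin 2) E) 0 1‖ =
      ‖quadForm B D ε (ϖ ^ k) y‖ * ‖ϖ‖ ^ (-(k + n)) := by
  have hpow (j : ℤ) : ‖ϖ‖ ^ j ≠ 0 := (zpow_pos hϖ.norm_pos j).ne'
  have hnum : ‖algebraMap F E (ϖ ^ (k + vc)) ^ 2 * b +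
      algebraMap F E (ϖ ^ (k + vc)) * algebraMap F E y * (d - a) - algebraMap F E y ^ 2 * c‖ =
      ‖ϖ‖ ^ vc * ‖quadForm B D ε (ϖ ^ k) y‖ := by
    refine mul_right_cancel₀ (hpow vc) ?_
    rw [zpow_add₀ hϖ.1]
    have hnorm := congrArg norm (h.mul_conj_eq_quadForm (ϖ ^ k) y)
    rw [norm_mul, h.norm_conj_c, h.norm_c, norm_algebraMap', norm_mul, norm_pow,
      norm_zpow] at hnorm
    rw [hnorm]
    ring
  rw [actS2_triangularRep_val hϖ hγ]
  simp only [Matrix.of_apply, Matrix.cons_val', Matrix.cons_val_zero, Matrix.cons_val_one,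
    Matrix.cons_val_fin_one]
  rw [norm_div, hnum, norm_mul, norm_algebraMap', norm_algebraMap', norm_zpow, norm_zpow, zpow_neg,
    zpow_add₀ hϖ.norm_pos.ne', zpow_add₀ hϖ.norm_pos.ne']
  field_simp [hpow]

theorem actS2_triangularRep_mem_KSle_iff [IsUltrametricDist E]
    (h : FormCoeffs σ ϖ a b c d vb vc B D ε) (hϖ : IsUniformizer ϖ) {γ : S2 σ}
    (hγ : ((γ : GL (Fin 2) E) : Matrix (Fin 2) (Fin 2) E) = !![a, b; c, d])
    (r : ℕ) (k : ℤ) (n : ℕ) (y : F) :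
    actS2 (triangularRep hϖ (k + vc) n y) γ ∈ KSle σ ϖ r ↔ FormCond ϖ B D ε n r k y := by
  have hpow (j : ℤ) : 0 < ‖ϖ‖ ^ j := zpow_pos hϖ.norm_pos j
  have hr : 1 ≤ ‖ϖ‖ ^ (-r : ℤ) := by
    rw [← zpow_zero ‖ϖ‖, hϖ.zpow_le_zpow_iff]
    omega
  have hshift : ‖algebraMap F E y * c / algebraMap F E (ϖ ^ (k + vc))‖ ≤ ‖ϖ‖ ^ (-r : ℤ) ↔
      ‖y‖ ≤ ‖ϖ‖ ^ (k - r) := by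
    rw [norm_div, norm_mul, norm_algebraMap', norm_algebraMap', h.norm_c, norm_zpow,
      zpow_add₀ hϖ.norm_pos.ne', mul_div_mul_right _ _ (hpow vc).ne', div_le_iff₀ (hpow k),
      ← zpow_add₀ hϖ.norm_pos.ne', neg_add_eq_sub]
  have hlower := norm_actS2_triangularRep_lower_left hϖ hγ h.norm_c k n y
  have hupper := h.norm_actS2_triangularRep_upper_right hϖ hγ k n y
  have hform : ‖quadForm B D ε (ϖ ^ k) y‖ * ‖ϖ‖ ^ (-(k + n)) ≤ ‖ϖ‖ ^ (-r : ℤ) ↔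
      ‖quadForm B D ε (ϖ ^ k) y‖ ≤ ‖ϖ‖ ^ (k + n - r) := by
    rw [zpow_neg _ (k + n), ← div_eq_mul_inv, div_le_iff₀ (hpow _),
      ← zpow_add₀ hϖ.norm_pos.ne', neg_add_eq_sub]
  rw [mem_KSle_iff hϖ, Fin.forall_fin_two, Fin.forall_fin_two, Fin.forall_fin_two, hlower, hupper,
    hform, hϖ.zpow_le_zpow_iff, actS2_triangularRep_val hϖ hγ, FormCond]
  simp only [Matrix.of_apply, Matrix.cons_val', Matrix.cons_val_zero, Matrix.cons_val_one,
    Matrix.cons_val_fin_one]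
  rw [norm_add_le_iff_right (h.norm_a.trans_le hr), norm_sub_le_iff_right (h.norm_d.trans_le hr),
    hshift, show -(r : ℤ) ≤ n - k ↔ k ≤ n + r by omega]
  tauto

end FormCoeffs

end TriangularConjugation

section Invariance

variable {F E : Type*} [NormedField F] [NormedField E] [NormedAlgebra F E] {σ : E ≃ₐ[F] E}

theorem actS2_one (γ : S2 σ) : actS2 1 γ = γ := by
  apply Subtype.ext
  change extGL E 1 * γ * (extGL E 1)⁻¹ = _
  rw [extGL, map_one, one_mul, inv_one, mul_one]

theorem actS2_mul (g h : GL (Fin 2) F) (γ : S2 σ) : actS2 (g * h) γ = actS2 g (actS2 h γ) := by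
  apply Subtype.ext
  change extGL E (g * h) * γ * (extGL E (g * h))⁻¹ =
    extGL E g * (extGL E h * γ * (extGL E h)⁻¹) * (extGL E g)⁻¹
  simp only [extGL, map_mul, mul_inv_rev, mul_assoc]

variable [IsUltrametricDist F]

theorem norm_det_le_one {A : Matrix (Fin 2) (Fin 2) F} (hA : ∀ i j, ‖A i j‖ ≤ 1) :
    ‖A.det‖ ≤ 1 := by
  rw [Matrix.det_fin_two]
  refine norm_sub_le_of_le ?_ ?_ <;> rw [norm_mul] <;>
    exact mul_le_one₀ (hA _ _) (norm_nonneg _) (hA _ _)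

theorem norm_mulVec_apply_le_one {A : Matrix (Fin 2) (Fin 2) F} (hA : ∀ i j, ‖A i j‖ ≤ 1)
    {x : Fin 2 → F} (hx : ∀ i, ‖x i‖ ≤ 1) (i : Fin 2) : ‖(A *ᵥ x) i‖ ≤ 1 := by
  rw [Matrix.mulVec, dotProduct]
  refine IsUltrametricDist.norm_sum_le_of_forall_le_of_nonneg zero_le_one fun j _ => ?_
  rw [norm_mul]
  exact mul_le_one₀ (hA i j) (norm_nonneg _) (hx j)

theorem norm_vecMul_apply_le_one {A : Matrix (Fin 2) (Fin 2) F} (hA : ∀ i j, ‖A i j‖ ≤ 1)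
    {x : Fin 2 → F} (hx : ∀ i, ‖x i‖ ≤ 1) (i : Fin 2) : ‖(x ᵥ* A) i‖ ≤ 1 := by
  rw [← Matrix.mulVec_transpose]
  exact norm_mulVec_apply_le_one (fun i j => hA j i) hx i

variable {κ : GL (Fin 2) F}

theorem norm_det_integral (hκ : κ ∈ integralSubgroup F) : ‖κ.val.det‖ = 1 := by
  have hmul : ‖κ.val.det‖ * ‖κ⁻¹.val.det‖ = 1 := by
    rw [← norm_mul, ← Matrix.det_mul, Units.mul_inv, Matrix.det_one, norm_one]
  refine le_antisymm (norm_det_le_one hκ.1) ?_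
  rw [← hmul]
  exact mul_le_of_le_one_right (norm_nonneg _) (norm_det_le_one hκ.2)

theorem indInt_integral_mul (hκ : κ ∈ integralSubgroup F) (h : GL (Fin 2) F) (u v : Fin 2 → F) :
    indInt ((κ * h).val *ᵥ u, v ᵥ* (κ * h)⁻¹.val) = indInt (h.val *ᵥ u, v ᵥ* h⁻¹.val) := by
  let integral (g : GL (Fin 2) F) : Prop :=
    (∀ i, ‖(g.val *ᵥ u) i‖ ≤ 1) ∧ ∀ i, ‖(v ᵥ* g⁻¹.val) i‖ ≤ 1
  have translate {κ g : GL (Fin 2) F} (hκ : κ ∈ integralSubgroup F) (hg : integral g) :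
      integral (κ * g) := by
    simp only [integral, mul_inv_rev, Units.val_mul, ← Matrix.mulVec_mulVec,
      ← Matrix.vecMul_vecMul]
    exact ⟨norm_mulVec_apply_le_one hκ.1 hg.1, norm_vecMul_apply_le_one hκ.2 hg.2⟩
  have hiff : integral (κ * h) ↔ integral h :=
    ⟨fun hh => inv_mul_cancel_left κ h ▸ translate (inv_mem hκ) hh, translate hκ⟩
  exact Set.indicator_const_eq_indicator_const hiff

theorem actS2_mem_KSle {ϖ : F} {r : ℕ} (hκ : κ ∈ integralSubgroup F) {γ : S2 σ}
    (hγ : γ ∈ KSle σ ϖ r) : actS2 κ γ ∈ KSle σ ϖ r := by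
  have : IsUltrametricDist E := isUltrametricDist_of_normedAlgebra F E
  have integral_extGL {g : GL (Fin 2) F} (hg : g ∈ integralSubgroup F) (i j : Fin 2) :
      ‖extGL E g i j‖ ≤ 1 := by
    rw [extGL, Matrix.GeneralLinearGroup.map_apply, norm_algebraMap']
    exact hg.1 i j
  have hmul := norm_matrix_mul_apply_le_one
    (norm_matrix_mul_apply_le_one (integral_extGL hκ)
      (B := algebraMap F E ϖ ^ r • (γ : GL (Fin 2) E).val) hγ)
    (integral_extGL (inv_mem hκ))
  intro i j
  specialize hmul i j
  rwa [Matrix.mul_smul, Matrix.smul_mul, extGL, extGL, map_inv] at hmul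

theorem indKSle_actS2 {ϖ : F} {r : ℕ} (hκ : κ ∈ integralSubgroup F) (γ : S2 σ) :
    indKSle σ ϖ r (actS2 κ γ) = indKSle σ ϖ r γ := by
  have hiff : actS2 κ γ ∈ KSle σ ϖ r ↔ γ ∈ KSle σ ϖ r := by
    refine ⟨fun h => ?_, actS2_mem_KSle hκ⟩
    rw [← actS2_one γ, ← inv_mul_cancel κ, actS2_mul]
    exact actS2_mem_KSle (inv_mem hκ) h
  exact Set.indicator_const_eq_indicator_const hiff

theorem orbIntegrand_integral_mul {ϖ : F} (hϖ : IsUniformizer ϖ) (γ : S2 σ) (u v : Fin 2 → F)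
    {φ : S2 σ → ℂ} (hφ : ∀ κ ∈ integralSubgroup F, ∀ γ, φ (actS2 κ γ) = φ γ) (s : ℂ)
    (hκ : κ ∈ integralSubgroup F) (h : GL (Fin 2) F) :
    orbIntegrand ϖ γ u v φ s (κ * h) = orbIntegrand ϖ γ u v φ s h := by
  have hdet : val ϖ (κ * h).val.det = val ϖ h.val.det :=
    val_congr hϖ (κ * h).det_ne_zero (by
      rw [Units.val_mul, Matrix.det_mul, norm_mul, norm_det_integral hκ, one_mul])
  rw [orbIntegrand, orbIntegrand, indInt_integral_mul hκ, actS2_mul, hφ κ hκ, eta, eta, absF, absF,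
    hdet]

end Invariance

section OrbitalSum

theorem FormCond.le_and_le {K : Type*} [NormedField K] [IsUltrametricDist K] {ϖ B D ε : K}
    (hϖ : IsUniformizer ϖ) {l : ℤ} (hl : 0 < l) (hB : ‖B‖ = ‖ϖ‖ ^ l) (hD : ‖D‖ ≤ 1) (hε : ‖ε‖ = 1)
    {n r : ℕ} {k : ℤ} {y : K} (hy : ‖y‖ ≤ 1) (h : FormCond ϖ B D ε n r k y) :
    -(r + l) ≤ k ∧ k ≤ n + r := by
  refine ⟨?_, h.2.1⟩
  by_contra! hk
  have hconst : ‖(ϖ ^ k) ^ 2 * B‖ = ‖ϖ‖ ^ (2 * k + l) := by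
    rw [norm_mul, norm_pow, norm_zpow, hB, ← zpow_natCast, ← zpow_mul, mul_comm k,
      ← zpow_add₀ hϖ.norm_pos.ne', Nat.cast_ofNat]
  have hlinear : ‖ϖ ^ k * y * D‖ ≤ ‖ϖ‖ ^ k := by
    rw [norm_mul, norm_mul, norm_zpow, mul_assoc]
    exact mul_le_of_le_one_right (zpow_pos hϖ.norm_pos _).le (mul_le_one₀ hy (norm_nonneg _) hD)
  have hsquare : ‖ε * y ^ 2‖ ≤ ‖ϖ‖ ^ k := by
    rw [norm_mul, hε, one_mul, norm_pow]
    refine (pow_le_one₀ (norm_nonneg _) hy).trans ?_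
    rw [← zpow_zero ‖ϖ‖, hϖ.zpow_le_zpow_iff]
    omega
  have hlt : ‖ϖ ^ k * y * D - ε * y ^ 2‖ < ‖(ϖ ^ k) ^ 2 * B‖ := by
    refine (norm_sub_le_of_le hlinear hsquare).trans_lt ?_
    rw [hconst, hϖ.zpow_lt_zpow_iff]
    omega
  have hnorm := h.2.2
  rw [quadForm, add_sub_assoc, norm_add_eq_left hlt, hconst, hϖ.zpow_le_zpow_iff] at hnorm
  omega

variable {F : Type*} [NormedField F] {ϖ : F}

open Classical in
theorem indInt_triangularRep (hϖ : IsUniformizer ϖ) {e : F} (he : e ≠ 0) (m n : ℤ) (y : F) :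
    indInt ((triangularRep hϖ m n y).val *ᵥ ![0, 1],
        ![0, e] ᵥ* (triangularRep hϖ m n y)⁻¹.val) =
      if ‖y‖ ≤ 1 ∧ 0 ≤ n ∧ n ≤ val ϖ e then 1 else 0 := by
  have hcol : (triangularRep hϖ m n y).val *ᵥ ![0, 1] = ![y, ϖ ^ n] := by
    rw [triangularRep_val]
    ext i
    fin_cases i <;> simp [Matrix.mulVec, dotProduct]
  have hrow : ![0, e] ᵥ* (triangularRep hϖ m n y)⁻¹.val = ![0, e * (ϖ ^ n)⁻¹] := by
    rw [triangularRep_inv_val]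
    ext i
    fin_cases i <;> simp [Matrix.vecMul, dotProduct]
  have hn : ‖ϖ ^ n‖ ≤ 1 ↔ 0 ≤ n := by rw [norm_zpow, hϖ.zpow_le_one_iff]
  have hne : ‖e * (ϖ ^ n)⁻¹‖ ≤ 1 ↔ n ≤ val ϖ e := by
    rw [norm_mul, norm_inv, norm_zpow, norm_eq_zpow_val hϖ he, ← zpow_neg,
      ← zpow_add₀ hϖ.norm_pos.ne', hϖ.zpow_le_one_iff]
    omega
  rw [hcol, hrow, indInt, Set.indicator_apply]
  simp only [Set.mem_ofPred_eq, Fin.forall_fin_two, Matrix.cons_val_zero, Matrix.cons_val_one,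
    Matrix.cons_val_fin_one, norm_zero, zero_le_one, true_and, hn, hne, and_assoc]
  rfl

variable [IsUltrametricDist F]

/-- The factor `η(x) |x|_F ^ (-s)` of the orbital integrand, for an element `x` of valuation
`j`. -/
noncomputable def weight (F : Type*) [NormedField F] [IsUltrametricDist F] (s : ℂ) (j : ℤ) : ℂ :=
  (-1) ^ j * (((residueCard F : ℝ) ^ (-j) : ℝ) : ℂ) ^ (-s)

theorem hasDerivAt_weight [ProperSpace F] (hϖ : IsUniformizer ϖ) (j : ℤ) :
    HasDerivAt (fun s => weight F s j) (Real.log (residueCard F) * altWeight j) 0 := by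
  have hq : (0 : ℝ) < residueCard F := by exact_mod_cast (one_lt_residueCard hϖ).pos
  have hx : (0 : ℝ) < (residueCard F : ℝ) ^ (-j) := zpow_pos hq _
  have hpow := ((hasDerivAt_id (0 : ℂ)).neg.const_cpow
    (Or.inl (Complex.ofReal_ne_zero.2 hx.ne'))).const_mul ((-1 : ℂ) ^ j)
  refine hpow.congr_deriv ?_
  rw [← Complex.ofReal_log hx.le, Real.log_zpow, altWeight]
  simp only [Pi.neg_apply, id_eq, neg_zero, Complex.cpow_zero]
  push_cast
  ring

variable {E : Type*} [NormedField E] [NormedAlgebra F E] {σ : E ≃ₐ[F] E}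

open Classical in
theorem orbIntegrand_triangularRep (hϖ : IsUniformizer ϖ) {e : F} (he : e ≠ 0) (γ : S2 σ)
    (φ : S2 σ → ℂ) (s : ℂ) (m n : ℤ) (y : F) :
    orbIntegrand ϖ γ ![0, 1] ![0, e] φ s (triangularRep hϖ m n y) =
      if ‖y‖ ≤ 1 ∧ 0 ≤ n ∧ n ≤ val ϖ e then
        weight F s (m + n) * φ (actS2 (triangularRep hϖ m n y) γ) else 0 := by
  have hdet : val ϖ (triangularRep hϖ m n y).val.det = m + n := by
    rw [triangularRep_val, Matrix.det_fin_two_of, mul_zero, sub_zero, ← zpow_add₀ hϖ.1]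
    exact val_eq_of_norm hϖ (norm_zpow _ _)
  rw [orbIntegrand, indInt_triangularRep hϖ he, eta, absF, hdet, weight]
  split_ifs
  · ring
  · simp only [mul_zero, zero_mul]

theorem orbIntegrand_eq_of_mul_inv_mem (hϖ : IsUniformizer ϖ) (γ : S2 σ) (u v : Fin 2 → F)
    {φ : S2 σ → ℂ} (hφ : ∀ κ ∈ integralSubgroup F, ∀ γ, φ (actS2 κ γ) = φ γ) (s : ℂ)
    {h g : GL (Fin 2) F} (hhg : h * g⁻¹ ∈ integralSubgroup F) :
    orbIntegrand ϖ γ u v φ s h = orbIntegrand ϖ γ u v φ s g := by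
  rw [← orbIntegrand_integral_mul hϖ γ u v hφ s hhg g, inv_mul_cancel_right]

theorem exists_mul_triangularRep_inv_mem_of_orbIntegrand_ne_zero (hϖ : IsUniformizer ϖ) {e : F}
    (he : e ≠ 0) {γ : S2 σ} {φ : S2 σ → ℂ}
    (hφ : ∀ κ ∈ integralSubgroup F, ∀ γ, φ (actS2 κ γ) = φ γ)
    {Y : ℕ → Finset F} (hY : ∀ n, IsReps ϖ n (Y n)) {s : ℂ} {h : GL (Fin 2) F}
    (hh : orbIntegrand ϖ γ ![0, 1] ![0, e] φ s h ≠ 0) :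
    ∃ (m : ℤ) (n : ℕ), ∃ y ∈ Y n, n ≤ val ϖ e ∧ φ (actS2 (triangularRep hϖ m n y) γ) ≠ 0 ∧
      h * (triangularRep hϖ m n y)⁻¹ ∈ integralSubgroup F := by
  obtain ⟨m, n, x, hrep⟩ := exists_mul_triangularRep_inv_mem hϖ h
  have hx := hh
  rw [orbIntegrand_eq_of_mul_inv_mem hϖ γ _ _ hφ s hrep, orbIntegrand_triangularRep hϖ he,
    ite_ne_right_iff] at hx
  obtain ⟨⟨hx, hn, hne⟩, -⟩ := hx
  lift n to ℕ using hn
  obtain ⟨y, ⟨hy, hxy⟩, -⟩ := (hY n).2 x hx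
  have hrep' : h * (triangularRep hϖ m n y)⁻¹ ∈ integralSubgroup F := by
    have := mul_mem hrep ((triangularRep_mul_inv_mem_iff hϖ (m := m) (n := n) (y := y)).2
      ⟨rfl, rfl, by rwa [zpow_natCast]⟩)
    rwa [← mul_assoc, inv_mul_cancel_right] at this
  rw [orbIntegrand_eq_of_mul_inv_mem hϖ γ _ _ hφ s hrep', orbIntegrand_triangularRep hϖ he,
    ite_ne_right_iff] at hh
  exact ⟨m, n, y, hy, hne, right_ne_zero_of_mul hh.2, hrep'⟩

variable [ProperSpace F] [MeasurableSpace (GL (Fin 2) F)] [BorelSpace (GL (Fin 2) F)]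

/- The matrices `triangularRep hϖ m n y`, with `y` running over representatives modulo `ϖ ^ n`,
represent `GL₂(O_F) \ GL₂(F)`; the vectors `![0, 1]` and `![0, e]` bound `n` and `y`. -/
theorem integrable_and_orb_eq_sum (μ : Measure (GL (Fin 2) F)) [μ.IsHaarMeasure]
    (hμ : μ (integralGL F) = 1) (hϖ : IsUniformizer ϖ) {e : F} (he : e ≠ 0) (γ : S2 σ)
    {φ : S2 σ → ℂ} (hφ : ∀ κ ∈ integralSubgroup F, ∀ γ, φ (actS2 κ γ) = φ γ) {I : Finset ℤ}
    (hI : ∀ m (n : ℕ) y, ‖y‖ ≤ 1 → n ≤ val ϖ e →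
      φ (actS2 (triangularRep hϖ m n y) γ) ≠ 0 → m ∈ I)
    {Y : ℕ → Finset F} (hY : ∀ n, IsReps ϖ n (Y n)) (s : ℂ) :
    Integrable (orbIntegrand ϖ γ ![0, 1] ![0, e] φ s) μ ∧
      Orb μ ϖ γ ![0, 1] ![0, e] φ s = ∑ n ∈ Finset.range (val ϖ e + 1).toNat, ∑ m ∈ I,
        weight F s (m + n) * ∑ y ∈ Y n, φ (actS2 (triangularRep hϖ m n y) γ) := by
  have := isMulRightInvariant_GL_two hϖ μ
  let T := (Finset.range (val ϖ e + 1).toNat).sigma fun n => I ×ˢ Y n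
  have hT : ∀ i ∈ T, ∀ j ∈ T, triangularRep hϖ j.2.1 j.1 j.2.2 *
      (triangularRep hϖ i.2.1 i.1 i.2.2)⁻¹ ∈ integralSubgroup F → i = j := by
    rintro ⟨n, m, y⟩ hi ⟨n', m', y'⟩ hj hij
    obtain ⟨rfl, hn, hy⟩ := (triangularRep_mul_inv_mem_iff hϖ).1 hij
    obtain rfl := Int.natCast_inj.1 hn
    simp only [T, Finset.mem_sigma, Finset.mem_product] at hi hj
    rw [zpow_natCast] at hy
    rw [(hY n).eq_of_norm_sub_le hj.2.2 hi.2.2 hy]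
  have hsupp (h : GL (Fin 2) F) (hh : orbIntegrand ϖ γ ![0, 1] ![0, e] φ s h ≠ 0) :
      ∃ i ∈ T, h * (triangularRep hϖ i.2.1 i.1 i.2.2)⁻¹ ∈ integralSubgroup F := by
    obtain ⟨m, n, y, hy, hne, hφne, hmem⟩ :=
      exists_mul_triangularRep_inv_mem_of_orbIntegrand_ne_zero hϖ he hφ hY hh
    refine ⟨⟨n, m, y⟩, ?_, hmem⟩
    simp only [T, Finset.mem_sigma, Finset.mem_range, Finset.mem_product]
    exact ⟨by omega, hI m n y ((hY n).norm_le_one hy) hne hφne, hy⟩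
  obtain ⟨hint, hsum⟩ := integral_eq_sum_of_left_invariant μ (U := integralSubgroup F)
    isOpen_integralGL.measurableSet (hμ.trans_ne ENNReal.one_ne_top) T _
    (fun κ hκ h => orbIntegrand_integral_mul hϖ γ _ _ hφ s hκ h) hT hsupp
  refine ⟨hint, ?_⟩
  have hone : μ.real (integralSubgroup F) = 1 := by
    rw [measureReal_def, show (integralSubgroup F : Set _) = integralGL F from rfl, hμ,
      ENNReal.toReal_one]
  rw [Orb, hsum, Finset.sum_sigma]
  refine Finset.sum_congr rfl fun n hn => ?_
  simp only [Finset.sum_product, Finset.mul_sum]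
  refine Finset.sum_congr rfl fun m _ => Finset.sum_congr rfl fun y hy => ?_
  rw [Finset.mem_range] at hn
  rw [hone, one_smul, orbIntegrand_triangularRep hϖ he,
    if_pos ⟨(hY n).norm_le_one hy, by omega, by omega⟩]

end OrbitalSum

section FormSums

variable {K : Type*} [NormedField K]

open Classical in
/-- The contribution of the matrices `!![ϖ ^ (k + vc), y; 0, ϖ ^ n]`, for fixed `n`, to the
derivative at `s = 0` of the orbital integral of `indKSle σ ϖ r`, up to the factor `log q`. The
range of `k` contains, for all `n ≤ ve`, the `k` for which `FormCond` has a solution `y`. -/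
noncomputable def formSum (ϖ B D ε : K) (l vc ve : ℤ) (Y : Finset K) (n r : ℕ) : ℂ :=
  ∑ k ∈ Finset.Ico (-(r + l)) (ve + r + 1),
    altWeight (k + (n + vc)) * ({y ∈ Y | FormCond ϖ B D ε n r k y}.card : ℂ)

variable [IsUltrametricDist K] [ProperSpace K] {ϖ B D ε ρ₁ ρ₂ : K} {l δ ve : ℤ} {n : ℕ}
  {Y : Finset K}

theorem formSum_eq_ballSum (hϖ : IsUniformizer ϖ) (hl : Odd l) (hl0 : 0 < l)
    (hB : ‖B‖ = ‖ϖ‖ ^ l) (hD : ‖D‖ ≤ ‖ϖ‖ ^ ((l + 1) / 2)) (hε : ‖ε‖ = 1) (hY : IsReps ϖ n Y)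
    (hn : n ≤ ve) (vc : ℤ) (r : ℕ) :
    formSum ϖ B D ε l vc ve Y n r =
      (-1) ^ (vc + r) * ballSum (residueCard K) ((l - 1) / 2) n r :=
  sum_altWeight_mul_of_ball _ hl hl0 (by omega) (by omega) vc
    (hY.card_formCond_of_odd hϖ hl hB hD hε r)

/- For `n ≤ r + δ`, a ball around a root which meets the ring of integers contains it. -/
theorem IsSplitForm.formSum_eq_ballSum (hϖ : IsUniformizer ϖ)
    (hS : IsSplitForm ϖ B D ε ρ₁ ρ₂ l δ) (hl : Odd l) (hδ : 0 ≤ δ) (hY : IsReps ϖ n Y)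
    (hn : n ≤ ve) (vc : ℤ) {r : ℕ} (hnr : n ≤ r + δ) :
    formSum ϖ B D ε l vc ve Y n r =
      (-1) ^ (vc + r) * ballSum (residueCard K) ((l - 1) / 2) n r := by
  classical
  have hlδ := hS.two_mul_lt
  refine sum_altWeight_mul_of_ball _ hl (by omega) (by omega) (by omega) vc fun k => ?_
  have ballCount_of_nonpos {j : ℤ} (hj : j ≤ 0) :
      ballCount (residueCard K) n j = residueCard K ^ n := by
    rw [ballCount, Int.toNat_of_nonpos hj, Nat.sub_zero]
  rcases le_or_gt (n - r - 2 * δ) k with hk | hk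
  · rw [hS.card_formCond_of_le hϖ hY hk]
    exact if_congr (by omega) rfl rfl
  · rw [hS.card_formCond_of_lt hϖ hδ hY hk, if_neg (by omega), zero_add,
      ballCount_of_nonpos (by omega), ballCount_of_nonpos (by omega)]
    exact if_congr (by omega) rfl rfl

theorem IsSplitForm.formSum_eq_splitSum (hϖ : IsUniformizer ϖ)
    (hS : IsSplitForm ϖ B D ε ρ₁ ρ₂ l δ) (hl : Odd l) (hδ : 0 ≤ δ) (hY : IsReps ϖ n Y)
    (hn : n ≤ ve) (vc : ℤ) {r : ℕ} (hnr : r + δ ≤ n) :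
    formSum ϖ B D ε l vc ve Y n r = (-1) ^ (vc + r) * splitSum (residueCard K) l δ n r := by
  classical
  refine sum_altWeight_mul_of_split _ hl hδ hS.two_mul_lt (by omega) (by omega) (by omega) vc
    fun k => ?_
  rcases le_or_gt (n - r - 2 * δ) k with hk | hk
  · rw [hS.card_formCond_of_le hϖ hY hk, if_pos hk]
  · rw [hS.card_formCond_of_lt hϖ hδ hY hk, if_neg hk.not_ge, min_eq_left (by omega)]
    congr 1 <;> exact if_congr (by omega) rfl rfl

theorem neg_one_zpow_add_one_mul_add (j : ℤ) (x y : ℂ) :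
    (-1) ^ (j + 1) * ((-1) ^ (j + 1) * x + (-1) ^ j * y) = x - y := by
  rw [neg_one_zpow_add_one]
  linear_combination (x - y) * neg_one_zpow_mul_self j

variable {vb vc : ℤ} {Z : ℕ → Finset K}

theorem sum_formSum_eq_closedForm (hϖ : IsUniformizer ϖ) (hodd : Odd (vb + vc))
    (hpos : 0 < vb + vc) (hB : ‖B‖ = ‖ϖ‖ ^ (vb + vc)) (hD : ‖D‖ ≤ ‖ϖ‖ ^ ((vb + vc + 1) / 2))
    (hε : ‖ε‖ = 1) (hZ : ∀ n, IsReps ϖ n (Z n)) (ve : ℤ) (r : ℕ) {δ : WithTop ℤ}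
    (hδ : ((vb + vc : ℤ) : WithTop ℤ) < δ + δ) :
    (-1) ^ (vc + (r + 1 : ℕ)) * ∑ n ∈ Finset.range (ve + 1).toNat,
        (formSum ϖ B D ε (vb + vc) vc ve (Z n) n (r + 1) +
          formSum ϖ B D ε (vb + vc) vc ve (Z n) n r) =
      closedForm (residueCard K) (r + 1) vb vc ve δ := by
  rw [← sum_eq_closedForm_of_ball _ ve hpos hδ, Finset.mul_sum]
  refine Finset.sum_congr rfl fun n hn => ?_
  rw [Finset.mem_range] at hn
  rw [formSum_eq_ballSum hϖ hodd hpos hB hD hε (hZ n) (by omega),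
    formSum_eq_ballSum hϖ hodd hpos hB hD hε (hZ n) (by omega), Nat.cast_succ, ← add_assoc,
    neg_one_zpow_add_one_mul_add, ballSum_succ_sub _ (by omega), Nat.cast_succ]

theorem IsSplitForm.sum_formSum_eq_closedForm (hϖ : IsUniformizer ϖ)
    (hS : IsSplitForm ϖ B D ε ρ₁ ρ₂ (vb + vc) δ) (hodd : Odd (vb + vc)) (hδ : 0 ≤ δ)
    (hZ : ∀ n, IsReps ϖ n (Z n)) (ve : ℤ) (r : ℕ) :
    (-1) ^ (vc + (r + 1 : ℕ)) * ∑ n ∈ Finset.range (ve + 1).toNat,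
        (formSum ϖ B D ε (vb + vc) vc ve (Z n) n (r + 1) +
          formSum ϖ B D ε (vb + vc) vc ve (Z n) n r) =
      closedForm (residueCard K) (r + 1) vb vc ve δ := by
  have hlδ := hS.two_mul_lt
  rw [Finset.mul_sum]
  refine sum_eq_closedForm_of_split _ ve hδ (by omega) (fun n hn hlow => ?_) fun n hn hhigh => ?_
  · rw [hS.formSum_eq_ballSum hϖ hodd hδ (hZ n) hn vc (by omega),
      hS.formSum_eq_ballSum hϖ hodd hδ (hZ n) hn vc (by omega), Nat.cast_succ, ← add_assoc,
      neg_one_zpow_add_one_mul_add, ballSum_succ_sub _ (by omega)]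
    congr 1
    omega
  · rw [hS.formSum_eq_splitSum hϖ hodd hδ (hZ n) hn vc (by omega),
      hS.formSum_eq_splitSum hϖ hodd hδ (hZ n) hn vc (by omega), Nat.cast_succ, ← add_assoc,
      neg_one_zpow_add_one_mul_add, splitSum_succ_sub _ hδ (by omega), Nat.cast_succ]

end FormSums

section Derivative

variable {F E : Type*} [NormedField F] [NormedField E] [NormedAlgebra F E] {σ : E ≃ₐ[F] E}
  {ϖ : F}

theorem orbIntegrand_add [IsUltrametricDist F] (γ : S2 σ) (u v : Fin 2 → F) (φ₁ φ₂ : S2 σ → ℂ)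
    (s : ℂ) : orbIntegrand ϖ γ u v (φ₁ + φ₂) s =
      orbIntegrand ϖ γ u v φ₁ s + orbIntegrand ϖ γ u v φ₂ s := by
  funext h
  simp only [orbIntegrand, Pi.add_apply, add_mul]

namespace FormCoeffs

variable {a b c d : E} {vb vc : ℤ} {B D ε : F}

open Classical in
theorem indKSle_actS2_triangularRep [IsUltrametricDist E]
    (h : FormCoeffs σ ϖ a b c d vb vc B D ε) (hϖ : IsUniformizer ϖ) {γ : S2 σ}
    (hγ : ((γ : GL (Fin 2) E) : Matrix (Fin 2) (Fin 2) E) = !![a, b; c, d])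
    (r : ℕ) (k : ℤ) (n : ℕ) (y : F) :
    indKSle σ ϖ r (actS2 (triangularRep hϖ (k + vc) n y) γ) =
      if FormCond ϖ B D ε n r k y then 1 else 0 := by
  rw [indKSle, Set.indicator_apply]
  exact if_congr (h.actS2_triangularRep_mem_KSle_iff hϖ hγ r k n y) rfl rfl

variable [IsUltrametricDist F] [ProperSpace F]

theorem sum_formSum_eq_closedForm (h : FormCoeffs σ ϖ a b c d vb vc B D ε)
    (hϖ : IsUniformizer ϖ) (hϖE : IsUniformizer (algebraMap F E ϖ)) (h2 : ‖(2 : F)‖ = 1)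
    (hodd : Odd (vb + vc)) (hpos : 0 < vb + vc) {Y : ℕ → Finset F}
    (hY : ∀ n, IsReps ϖ n (Y n)) (ve : ℤ) (r : ℕ) :
    (-1) ^ (vc + (r + 1 : ℕ)) * ∑ n ∈ Finset.range (ve + 1).toNat,
        (formSum ϖ B D ε (vb + vc) vc ve (Y n) n (r + 1) +
          formSum ϖ B D ε (vb + vc) vc ve (Y n) n r) =
      closedForm (residueCard F) (r + 1) vb vc ve (ord (algebraMap F E ϖ) (d - a)) := by
  have : IsUltrametricDist E := isUltrametricDist_of_normedAlgebra F E
  have hB := h.norm_const hϖ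
  have hε := h.norm_square hϖ
  by_cases hda : d - a = 0
  · have hD : ‖D‖ = 0 := by rw [h.norm_linear hϖ, hda, norm_zero]
    rw [ord, if_pos hda]
    exact SemiLie.sum_formSum_eq_closedForm hϖ hodd hpos hB
      (hD.trans_le (zpow_pos hϖ.norm_pos _).le) hε hY ve r (WithTop.coe_lt_top _)
  obtain ⟨δ, hδ⟩ : ∃ δ, δ = val (algebraMap F E ϖ) (d - a) := ⟨_, rfl⟩
  have hD : ‖D‖ = ‖ϖ‖ ^ δ := by
    rw [h.norm_linear hϖ, norm_eq_zpow_val hϖE hda, norm_algebraMap', hδ]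
  rw [ord, if_neg hda, ← hδ]
  rcases lt_or_gt_of_ne (show 2 * δ ≠ vb + vc from fun heq =>
    Int.not_even_iff_odd.2 hodd (heq ▸ even_two_mul δ)) with hlt | hgt
  · have hδ0 : 0 ≤ δ := hϖ.zpow_le_one_iff.1 (hD ▸ h.norm_linear_le_one hϖ)
    obtain ⟨ρ₁, ρ₂, hS⟩ := exists_isSplitForm hϖ h2 hε hlt hB hD
    exact hS.sum_formSum_eq_closedForm hϖ hodd hδ0 hY ve r
  · refine SemiLie.sum_formSum_eq_closedForm hϖ hodd hpos hB ?_ hε hY ve r ?_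
    · rw [hD, hϖ.zpow_le_zpow_iff]
      omega
    · rw [← WithTop.coe_add, WithTop.coe_lt_coe]
      omega

variable [MeasurableSpace (GL (Fin 2) F)] [BorelSpace (GL (Fin 2) F)]

open Classical in
theorem integrable_and_orb_indKSle_eq_sum (h : FormCoeffs σ ϖ a b c d vb vc B D ε)
    (μ : Measure (GL (Fin 2) F)) [μ.IsHaarMeasure]
    (hμ : μ (integralGL F) = 1) (hϖ : IsUniformizer ϖ) {e : F} (he : e ≠ 0) {γ : S2 σ}
    (hγ : ((γ : GL (Fin 2) E) : Matrix (Fin 2) (Fin 2) E) = !![a, b; c, d])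
    (hpos : 0 < vb + vc) {Y : ℕ → Finset F} (hY : ∀ n, IsReps ϖ n (Y n)) (r : ℕ) (s : ℂ) :
    Integrable (orbIntegrand ϖ γ ![0, 1] ![0, e] (indKSle σ ϖ r) s) μ ∧
      Orb μ ϖ γ ![0, 1] ![0, e] (indKSle σ ϖ r) s =
        ∑ n ∈ Finset.range (val ϖ e + 1).toNat,
          ∑ k ∈ Finset.Ico (-(r + (vb + vc))) (val ϖ e + r + 1),
            weight F s (k + (n + vc)) * ({y ∈ Y n | FormCond ϖ B D ε n r k y}.card : ℂ) := by
  have : IsUltrametricDist E := isUltrametricDist_of_normedAlgebra F E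
  have hI (m : ℤ) (n : ℕ) (y : F) (hy : ‖y‖ ≤ 1) (hn : n ≤ val ϖ e)
      (hne : indKSle σ ϖ r (actS2 (triangularRep hϖ m n y) γ) ≠ 0) :
      m ∈ Finset.Ico (-(r + (vb + vc)) + vc) (val ϖ e + r + 1 + vc) := by
    obtain ⟨k, rfl⟩ : ∃ k, m = k + vc := ⟨m - vc, by ring⟩
    rw [h.indKSle_actS2_triangularRep hϖ hγ, ite_ne_right_iff] at hne
    have := hne.1.le_and_le hϖ hpos (h.norm_const hϖ) (h.norm_linear_le_one hϖ)
      (h.norm_square hϖ) hy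
    rw [Finset.mem_Ico]
    omega
  obtain ⟨hint, horb⟩ := integrable_and_orb_eq_sum μ hμ hϖ he γ
    (fun κ hκ γ => indKSle_actS2 hκ γ) hI hY s
  refine ⟨hint, horb.trans (Finset.sum_congr rfl fun n _ => ?_)⟩
  rw [← Finset.sum_Ico_add' _ _ _ vc]
  refine Finset.sum_congr rfl fun k _ => ?_
  simp only [h.indKSle_actS2_triangularRep hϖ hγ, Finset.sum_boole]
  rw [add_assoc, add_comm vc]

theorem hasDerivAt_orb_indKSle (h : FormCoeffs σ ϖ a b c d vb vc B D ε)
    (μ : Measure (GL (Fin 2) F)) [μ.IsHaarMeasure]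
    (hμ : μ (integralGL F) = 1) (hϖ : IsUniformizer ϖ) {e : F} (he : e ≠ 0) {γ : S2 σ}
    (hγ : ((γ : GL (Fin 2) E) : Matrix (Fin 2) (Fin 2) E) = !![a, b; c, d])
    (hpos : 0 < vb + vc) {Y : ℕ → Finset F} (hY : ∀ n, IsReps ϖ n (Y n)) (r : ℕ) :
    HasDerivAt (Orb μ ϖ γ ![0, 1] ![0, e] (indKSle σ ϖ r))
      (Real.log (residueCard F) * ∑ n ∈ Finset.range (val ϖ e + 1).toNat,
        formSum ϖ B D ε (vb + vc) vc (val ϖ e) (Y n) n r) 0 := by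
  classical
  rw [funext fun s => (h.integrable_and_orb_indKSle_eq_sum μ hμ hϖ he hγ hpos hY r s).2]
  refine (HasDerivAt.fun_sum fun (n : ℕ) _ => HasDerivAt.fun_sum fun k _ =>
    (hasDerivAt_weight hϖ (k + (n + vc))).mul_const _).congr_deriv ?_
  simp only [formSum, Finset.mul_sum, mul_assoc]

theorem integrable_and_hasDerivAt_orb (h : FormCoeffs σ ϖ a b c d vb vc B D ε)
    (μ : Measure (GL (Fin 2) F)) [μ.IsHaarMeasure]
    (hμ : μ (integralGL F) = 1) (hϖ : IsUniformizer ϖ) {e : F} (he : e ≠ 0) {γ : S2 σ}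
    (hγ : ((γ : GL (Fin 2) E) : Matrix (Fin 2) (Fin 2) E) = !![a, b; c, d])
    (hpos : 0 < vb + vc) {Y : ℕ → Finset F} (hY : ∀ n, IsReps ϖ n (Y n)) (r₁ r₂ : ℕ) :
    (∀ s, Integrable
      (orbIntegrand ϖ γ ![0, 1] ![0, e] (indKSle σ ϖ r₁ + indKSle σ ϖ r₂) s) μ) ∧
      HasDerivAt (Orb μ ϖ γ ![0, 1] ![0, e] (indKSle σ ϖ r₁ + indKSle σ ϖ r₂))
        (Real.log (residueCard F) * ∑ n ∈ Finset.range (val ϖ e + 1).toNat,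
          (formSum ϖ B D ε (vb + vc) vc (val ϖ e) (Y n) n r₁ +
            formSum ϖ B D ε (vb + vc) vc (val ϖ e) (Y n) n r₂)) 0 := by
  have hint (r : ℕ) (s : ℂ) :=
    (h.integrable_and_orb_indKSle_eq_sum μ hμ hϖ he hγ hpos hY r s).1
  refine ⟨fun s => ?_, ?_⟩
  · rw [orbIntegrand_add]
    exact (hint r₁ s).add (hint r₂ s)
  · have horb : Orb μ ϖ γ ![0, 1] ![0, e] (indKSle σ ϖ r₁ + indKSle σ ϖ r₂) =
        Orb μ ϖ γ ![0, 1] ![0, e] (indKSle σ ϖ r₁) +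
          Orb μ ϖ γ ![0, 1] ![0, e] (indKSle σ ϖ r₂) := funext fun s => by
      rw [Orb, orbIntegrand_add, Pi.add_apply]
      exact integral_add (hint r₁ s) (hint r₂ s)
    rw [horb, Finset.sum_add_distrib, mul_add]
    exact (h.hasDerivAt_orb_indKSle μ hμ hϖ he hγ hpos hY r₁).add
      (h.hasDerivAt_orb_indKSle μ hμ hϖ he hγ hpos hY r₂)

end FormCoeffs

end Derivative

end SemiLie

theorem mainTheorem4_general {F E : Type*} [NormedField F] [IsUltrametricDist F] [ProperSpace F]
    [NormedField E] [NormedAlgebra F E] (h2 : ‖(2 : F)‖ = 1)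
    (hdeg : Module.finrank F E = 2) (hunr : SemiLie.IsUnramified F E)
    (σ : E ≃ₐ[F] E) (hσ : σ ≠ AlgEquiv.refl)
    (ϖ : F) (hϖ : SemiLie.IsUniformizer ϖ)
    [MeasurableSpace (GL (Fin 2) F)] [BorelSpace (GL (Fin 2) F)]
    (μ : Measure (GL (Fin 2) F)) [μ.IsHaarMeasure] (hμ : μ (SemiLie.integralGL F) = 1)
    (γ : SemiLie.S2 σ) (a b c d : E) (e : F)
    (hγ : ((γ : GL (Fin 2) E) : Matrix (Fin 2) (Fin 2) E) = !![a, b; c, d])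
    (hrs : SemiLie.IsRegSSMinus γ ![0, 1] ![0, e])
    (r : ℕ) (hr : 1 ≤ r) :
    let q : ℕ := SemiLie.residueCard F
    let vb : ℤ := SemiLie.val (algebraMap F E ϖ) b
    let vc : ℤ := SemiLie.val (algebraMap F E ϖ) c
    let ve : ℤ := SemiLie.val ϖ e
    let δ : WithTop ℤ := SemiLie.ord (algebraMap F E ϖ) (d - a)
    let N : ℤ := SemiLie.constN r vb vc ve δ
    let C : ℚ := SemiLie.constC r vb vc ve δ
    let C' : ℚ := SemiLie.constC' r vb vc ve δ
    let φ : SemiLie.S2 σ → ℂ := SemiLie.indKSle σ ϖ r + SemiLie.indKSle σ ϖ (r - 1)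
    (∀ s : ℂ, Integrable (SemiLie.orbIntegrand ϖ γ ![0, 1] ![0, e] φ s) μ) ∧
    DifferentiableAt ℂ (SemiLie.Orb μ ϖ γ ![0, 1] ![0, e] φ) 0 ∧
    (-1 : ℂ) ^ (vc + (r : ℤ)) / (Real.log q : ℂ) * SemiLie.dOrb μ ϖ γ ![0, 1] ![0, e] φ
      = (∑ j ∈ Finset.Icc (0 : ℤ) N, (q : ℂ) ^ j)
        + (C : ℂ) * (q : ℂ) ^ N + (C' : ℂ) * (q : ℂ) ^ (N - 1) := by
  intro q vb vc ve δ N C C' φ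
  have hϖE := hunr ϖ hϖ
  obtain ⟨hb, hc, he⟩ := SemiLie.ne_zero_of_isRegSSMinus hγ hrs
  have hodd : Odd (vb + vc) := SemiLie.odd_val_add_val hdeg hσ hϖ hϖE h2 hγ hrs hb hc
  have hpos : 0 < vb + vc :=
    SemiLie.val_add_val_pos hdeg hϖ hϖE (SemiLie.S2_entries hγ).2.2 hb hc hodd
  obtain ⟨B, D, ε, hcoeffs⟩ := SemiLie.exists_formCoeffs hdeg hσ hϖ hϖE hγ hb hc hpos
  choose Y hY using SemiLie.exists_isReps hϖ
  obtain ⟨r, rfl⟩ : ∃ r', r = r' + 1 := ⟨r - 1, by omega⟩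
  obtain ⟨hint, hderiv⟩ :=
    hcoeffs.integrable_and_hasDerivAt_orb μ hμ hϖ he hγ hpos hY (r + 1) r
  refine ⟨hint, hderiv.differentiableAt, ?_⟩
  have hlog : (Real.log q : ℂ) ≠ 0 :=
    mod_cast (Real.log_pos (mod_cast SemiLie.one_lt_residueCard hϖ)).ne'
  have hdOrb : SemiLie.dOrb μ ϖ γ ![0, 1] ![0, e] φ = _ := hderiv.deriv
  rw [hdOrb, ← mul_assoc, div_mul_cancel₀ _ hlog]
  exact hcoeffs.sum_formSum_eq_closedForm hϖ hϖE h2 hodd hpos hY ve r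

theorem mainTheorem4 {p : ℕ} [Fact p.Prime] (hp : p ≠ 2)
    {F E : Type*} [NormedField F] [NormedAlgebra ℚ_[p] F] [FiniteDimensional ℚ_[p] F]
    [IsUltrametricDist F] [NormedField E] [NormedAlgebra F E]
    (hdeg : Module.finrank F E = 2) (hunr : SemiLie.IsUnramified F E)
    (σ : E ≃ₐ[F] E) (hσ : σ ≠ AlgEquiv.refl)
    (ϖ : F) (hϖ : SemiLie.IsUniformizer ϖ)
    [MeasurableSpace (GL (Fin 2) F)] [BorelSpace (GL (Fin 2) F)]
    (μ : Measure (GL (Fin 2) F)) [μ.IsHaarMeasure] (hμ : μ (SemiLie.integralGL F) = 1)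
    (γ : SemiLie.S2 σ) (a b c d : E) (e : F)
    (hγ : ((γ : GL (Fin 2) E) : Matrix (Fin 2) (Fin 2) E) = !![a, b; c, d])
    (hrs : SemiLie.IsRegSSMinus γ ![0, 1] ![0, e])
    (r : ℕ) (hr : 1 ≤ r) :
    let q : ℕ := SemiLie.residueCard F
    let vb : ℤ := SemiLie.val (algebraMap F E ϖ) b
    let vc : ℤ := SemiLie.val (algebraMap F E ϖ) c
    let ve : ℤ := SemiLie.val ϖ e
    let δ : WithTop ℤ := SemiLie.ord (algebraMap F E ϖ) (d - a)
    let N : ℤ := SemiLie.constN r vb vc ve δ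
    let C : ℚ := SemiLie.constC r vb vc ve δ
    let C' : ℚ := SemiLie.constC' r vb vc ve δ
    let φ : SemiLie.S2 σ → ℂ := SemiLie.indKSle σ ϖ r + SemiLie.indKSle σ ϖ (r - 1)
    (∀ s : ℂ, Integrable (SemiLie.orbIntegrand ϖ γ ![0, 1] ![0, e] φ s) μ) ∧
    DifferentiableAt ℂ (SemiLie.Orb μ ϖ γ ![0, 1] ![0, e] φ) 0 ∧
    (-1 : ℂ) ^ (vc + (r : ℤ)) / (Real.log q : ℂ) * SemiLie.dOrb μ ϖ γ ![0, 1] ![0, e] φ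
      = (∑ j ∈ Finset.Icc (0 : ℤ) N, (q : ℂ) ^ j)
        + (C : ℂ) * (q : ℂ) ^ N + (C' : ℂ) * (q : ℂ) ^ (N - 1) := by
  have : ProperSpace F := FiniteDimensional.proper ℚ_[p] F
  exact mainTheorem4_general (SemiLie.norm_two_eq_one hp F) hdeg hunr σ hσ ϖ hϖ μ hμ γ a b c d e
    hγ hrs r hr
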